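/- **Setting.** Let the state space $\mathcal X$, the control space $\mathcal U$ and the measurement space $\mathcal Y$ be non-empty standard Borel spaces (for example Borel subsets of Euclidean spaces, or countable discrete sets), and let $\lambda_{\mathcal X}$, $\lambda_{\mathcal Y}$ be $\sigma$-finite reference measures on $\mathcal X$ and $\mathcal Y$ (for example Lebesgue measure or counting measure). Consider the system $$X_{t+1}=f_t(X_t,U_t,W_t),\qquad Y_0=g_0(X_0,V_0),\qquad Y_{t+1}=g_{t+1}(X_{t+1},U_t,V_{t+1}),\qquad t\ge 0,$$ with measurable $f_t,g_t$ and independent $X_0,W_0,W_1,\dots,V_0,V_1,\dots$, such that $X_0$ has a density $p(x_0)$ and there are jointly measurable densities $p(x_{t+1}\mid x_t,u_t)$, $p(y_0\mid x_0)$, $p(y_{t+1}\mid x_{t+1},u_t)$ of the corresponding conditional laws, with respect to $\lambda_{\mathcal X}$, $\lambda_{\mathcal Y}$. Write $X^t=(X_0,\dots,X_t)$, and similarly $Y^t$, $U^t$. For a law $\nu$ on $\mathcal X$ with density $p$ let $h(\nu)=-\int p\log p\,d\lambda_{\mathcal X}$, and let $h(X\mid Z)=E_Z[h(X\mid z)]$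 be the average of the entropies $h(X\mid z)$ of the conditional laws of $X$ given $Z=z$; for state trajectories $X^T$ the product reference measure is used. Fix a horizon $T\ge0$, measurable costs $c_t:\mathcal X\times\mathcal U\to[0,\infty)$ and $\gamma\ge 0$. An output feedback policy $\mu=(\mu_t)$ draws $U_t$ from a conditional distribution $\mu_t(\cdot\mid y^t,u^{t-1})$. The smoothing-averse problem is to maximise over $\mu$ $$J(\mu)=h(X^T\mid Y^T,U^{T-1})-\gamma\,E\Big[\sum_{t=0}^{T-1}c_t(X_t,U_t)\Big].$$ Assume that $h(X_0\mid Y_0)$ converges absolutely (as an iterated integral) and call $\mu$ admissible if, for all $0\le t<T$, the entropies $h(X_{t+1}\mid Y^{t+1},U^t)$, $h(X_{t+1}\mid Y^t,U^t)$, $h(X_{t+1}\mid X_t,Y^t,U^t)$ converge absolutely and $\gamma E[c_t(X_t,U_t)]<\infty$. Let an information state be a probability density $\pi$ on $\mathcal X$, let $\pi_0$ be the Bayes posterior of $X_0$ given $Y_0$, and let $\Pi(\pi,u,y)$ at time $t$ be the Bayesian filter map: predict $\pi^-_u(x')=\int p(x'\mid x,u)\pi(x)\,dx$, then $$\Pi(\pi,u,y)(x')=\frac{p(y\mid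 x',u)\,\pi^-_u(x')}{\int p(y\mid x'',u)\,\pi^-_u(x'')\,dx''},$$ the transition and measurement densities being $p(x_{t+1}\mid x_t,u_t)$ and $p(y_{t+1}\mid x_{t+1},u_t)$ (if the denominator is $0$ or $\infty$, which has probability zero, put $\Pi(\pi,u,y)=\pi^-_u$, and likewise for $\pi_0$). Define $$\tilde r(\pi_t,u_t,y_{t+1})=h\big(\Pi(\pi_t,u_t,y_{t+1})\big)-h\big(\pi^-_{u_t}\big)+\int h\big(p(\cdot\mid x_t,u_t)\big)\pi_t(x_t)\,dx_t,$$ $$r(\pi_t,u_t)=E\big[\tilde r(\pi_t,u_t,Y_{t+1})-\gamma c_t(X_t,u_t)\,\big|\,\pi_t,u_t\big],$$ where, given $(\pi_t,u_t)$, $X_t\sim\pi_t$, $X_{t+1}\sim p(\cdot\mid X_t,u_t)$, $Y_{t+1}\sim p(\cdot\mid X_{t+1},u_t)$. The fully observed problem is to maximise $$V_{\bar\mu}(\pi_0)=E\Big[\sum_{t=0}^{T-1}r(\pi_t,U_t)\,\Big|\,\pi_0\Big]\quad\text{subject to}\quad \pi_{t+1}=\Pi(\pi_t,U_t,Y_{t+1}),\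 \ Y_{t+1}\sim p(y_{t+1}\mid\pi_t,U_t),\ \ U_t\sim\bar\mu_t(\cdot\mid\pi_t),$$ over policies $\bar\mu=(\bar\mu_t)$ that depend only on $\pi_t$; $\bar\mu$ is admissible if all the integrals defining $E[\sum_{t<T} r(\pi_t,U_t)]$ converge absolutely, $\pi_0$ having the law of the posterior of $X_0$ given $Y_0$. **Theorem.** The two problems are equivalent up to the constant $h(X_0\mid Y_0)$: 1. Under every output feedback policy, $\pi_t$ (computed from $(Y^t,U^{t-1})$ by the filter recursion) is almost surely the conditional law of $X_t$ given $(Y^t,U^{t-1})$; and for every admissible $\mu$ the smoother entropy converges absolutely, $\sum_{t<T}r(\pi_t,U_t)$ is integrable, and $J(\mu)=h(X_0\mid Y_0)+E\big[\sum_{t=0}^{T-1}r(\pi_t,U_t)\big]$. 2. A policy $\bar\mu$ is admissible for the fully observed problem if and only if the output feedback policy $U_t\sim\bar\mu_t(\cdot\mid\pi_t)$ that it induces is admissible. In that case $V_{\bar\mu}(\pi_0)$ is well defined for almost every $\pi_0$ and integrable, and $J(\bar\mu)=h(X_0\mid Y_0)+E[V_{\bar\mu}(\pi_0)]$. 3.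 For every admissible output feedback policy $\mu$ there is an admissible $\bar\mu$ depending only on $\pi_t$ with $J(\bar\mu)=J(\mu)$. 4. Consequently, with suprema over admissible policies, $\sup_\mu J(\mu)=h(X_0\mid Y_0)+\sup_{\bar\mu}E[V_{\bar\mu}(\pi_0)]=h(X_0\mid Y_0)+E\big[\operatorname{ess\,sup}_{\bar\mu}V_{\bar\mu}(\pi_0)\big]$ in $[-\infty,\infty]$. 5. An admissible $\bar\mu$ induces an optimal policy of the smoothing-averse problem (among admissible ones) if and only if it is optimal for the fully observed problem, i.e. for every admissible $\bar\mu'$ one has $V_{\bar\mu'}(\pi_0)\le V_{\bar\mu}(\pi_0)$ for almost every $\pi_0$. -/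

import Mathlib

open MeasureTheory ProbabilityTheory
open scoped ENNReal NNReal

namespace SmoothingAverse

noncomputable section

/-! ### Entropies relative to a reference measure -/

/-- The entropy `-∫ p log p dlam` of `ν`, where `p = dν/dlam` is the density of `ν` with respect to
the reference measure `lam` (Lebesgue measure: differential entropy; counting measure: the entropy
of a probability mass function). -/
def entropy {A : Type*} [MeasurableSpace A] (lam ν : Measure A) : ℝ :=
  ∫ a, Real.negMulLog (ν.rnDeriv lam a).toReal ∂lam

/-- `∫ |p log p| dlam`; the integral that defines `entropy lam ν` converges absolutely if and only
if this is finite. -/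
def absEntropy {A : Type*} [MeasurableSpace A] (lam ν : Measure A) : ℝ≥0∞ :=
  ∫⁻ a, ‖Real.negMulLog (ν.rnDeriv lam a).toReal‖ₑ ∂lam

/-- The (average) conditional entropy `h(X | Z) = E_Z [h(X | z)]` of the random variable `X` given
the random variable `Z`, where `h(X | z)` is the entropy of the conditional law of `X` given
`Z = z`. -/
def condEntropy {Ω A B : Type*} [MeasurableSpace Ω] [MeasurableSpace A] [StandardBorelSpace A]
    [Nonempty A] [MeasurableSpace B] (lam : Measure A) (X : Ω → A) (Z : Ω → B)
    (P : Measure Ω) [IsFiniteMeasure P] : ℝ :=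
  ∫ z, entropy lam (condDistrib X Z P z) ∂(P.map Z)

/-- `E_Z [∫ |p(x | Z) log p(x | Z)| dx]`; the conditional entropy `h(X | Z)` is an absolutely
convergent iterated integral if and only if this is finite. -/
def absCondEntropy {Ω A B : Type*} [MeasurableSpace Ω] [MeasurableSpace A] [StandardBorelSpace A]
    [Nonempty A] [MeasurableSpace B] (lam : Measure A) (X : Ω → A) (Z : Ω → B)
    (P : Measure Ω) [IsFiniteMeasure P] : ℝ≥0∞ :=
  ∫⁻ z, absEntropy lam (condDistrib X Z P z) ∂(P.map Z)

/-- The expectation of an extended-real function, `E[v⁺] - E[v⁻]`. -/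
def expect {A : Type*} [MeasurableSpace A] (P : Measure A) (v : A → EReal) : EReal :=
  ((∫⁻ a, (v a).toENNReal ∂P : ℝ≥0∞) : EReal) - ((∫⁻ a, (-v a).toENNReal ∂P : ℝ≥0∞) : EReal)

/-- Appending one entry to a sequence is measurable. -/
lemma measurable_snoc {A : Type*} [MeasurableSpace A] (n : ℕ) :
    Measurable (fun p : (Fin n → A) × A => (Fin.snoc p.1 p.2 : Fin (n + 1) → A)) := by
  refine measurable_pi_iff.2 fun i => ?_
  induction i using Fin.lastCases with
  | last => simpa using measurable_snd
  | cast i => simpa [Function.comp_def] using (measurable_pi_apply i).comp measurable_fst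

/-! ### The controlled system -/

variable {X U Y W V : Type*} [MeasurableSpace X] [MeasurableSpace U] [MeasurableSpace Y]
  [MeasurableSpace W] [MeasurableSpace V]

variable (X U Y W V) in
/-- The partially observed stochastic system
`X_{t+1} = f_t(X_t, U_t, W_t)`, `Y_0 = g_0(X_0, V_0)`, `Y_{t+1} = g_{t+1}(X_{t+1}, U_t, V_{t+1})`,
with independent noises `W_t`, `V_t`, all of whose (conditional) laws have densities with respect to
reference measures `lamX` on the state space and `lamY` on the measurement space (Lebesgue measure
on a subset of `ℝⁿ` or counting measure on a discrete set, for example).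

The field `g t` is the measurement function of time `t + 1`. -/
structure System where
  f : ℕ → X → U → W → X
  g0 : X → V → Y
  g : ℕ → X → U → V → Y
  /-- the law of `X_0` -/
  lawX0 : Measure X
  /-- the law of `W_t` -/
  lawW : ℕ → Measure W
  /-- the law of `V_t` -/
  lawV : ℕ → Measure V
  lamX : Measure X
  lamY : Measure Y
  /-- `p(x_{t+1} | x_t, u_t)`, in the order of arguments `t x_t u_t x_{t+1}` -/
  transDens : ℕ → X → U → X → ℝ≥0∞
  /-- `p(y_0 | x_0)`, in the order of arguments `x_0 y_0` -/
  obsDens0 : X → Y → ℝ≥0∞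
  /-- `p(y_{t+1} | x_{t+1}, u_t)`, in the order of arguments `t x_{t+1} u_t y_{t+1}` -/
  obsDens : ℕ → X → U → Y → ℝ≥0∞
  measurable_f : ∀ t, Measurable (fun p : (X × U) × W => f t p.1.1 p.1.2 p.2)
  measurable_g0 : Measurable (fun p : X × V => g0 p.1 p.2)
  measurable_g : ∀ t, Measurable (fun p : (X × U) × V => g t p.1.1 p.1.2 p.2)
  isProb_lawX0 : IsProbabilityMeasure lawX0
  isProb_lawW : ∀ t, IsProbabilityMeasure (lawW t)
  isProb_lawV : ∀ t, IsProbabilityMeasure (lawV t)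
  sigmaFinite_lamX : SigmaFinite lamX
  sigmaFinite_lamY : SigmaFinite lamY
  measurable_transDens : ∀ t, Measurable (fun p : (X × U) × X => transDens t p.1.1 p.1.2 p.2)
  measurable_obsDens0 : Measurable (fun p : X × Y => obsDens0 p.1 p.2)
  measurable_obsDens : ∀ t, Measurable (fun p : (X × U) × Y => obsDens t p.1.1 p.1.2 p.2)
  /-- `X_0` has a density. -/
  lawX0_ac : lawX0 ≪ lamX
  /-- `transDens t x u` is the density of `f_t(x, u, W_t)`. -/
  trans_eq : ∀ t x u, (lawW t).map (f t x u) = lamX.withDensity (transDens t x u)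
  /-- `obsDens0 x` is the density of `g_0(x, V_0)`. -/
  obs0_eq : ∀ x, (lawV 0).map (g0 x) = lamY.withDensity (obsDens0 x)
  /-- `obsDens t x u` is the density of `g_{t+1}(x, u, V_{t+1})`. -/
  obs_eq : ∀ t x u, (lawV (t + 1)).map (g t x u) = lamY.withDensity (obsDens t x u)

attribute [instance] System.isProb_lawX0 System.isProb_lawW System.isProb_lawV
  System.sigmaFinite_lamX System.sigmaFinite_lamY

namespace System

variable (S : System X U Y W V)

/-- The state transition kernel `p(x_{t+1} | x_t, u_t)`: the law of `f_t(x_t, u_t, W_t)`. -/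
def transK (t : ℕ) : Kernel (X × U) X :=
  (Kernel.id ×ₖ Kernel.const (X × U) (S.lawW t)).map (fun p => S.f t p.1.1 p.1.2 p.2)

/-- The measurement kernel `p(y_0 | x_0)` of time `0`: the law of `g_0(x_0, V_0)`. -/
def obsK0 : Kernel X Y :=
  (Kernel.id ×ₖ Kernel.const X (S.lawV 0)).map (fun p => S.g0 p.1 p.2)

/-- The measurement kernel `p(y_{t+1} | x_{t+1}, u_t)`: the law of `g_{t+1}(x_{t+1}, u_t, V_{t+1})`. -/
def obsK (t : ℕ) : Kernel (X × U) Y :=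
  (Kernel.id ×ₖ Kernel.const (X × U) (S.lawV (t + 1))).map (fun p => S.g t p.1.1 p.1.2 p.2)

instance (t : ℕ) : IsMarkovKernel (S.transK t) :=
  Kernel.IsMarkovKernel.map _ (S.measurable_f t)

instance : IsMarkovKernel S.obsK0 :=
  Kernel.IsMarkovKernel.map _ S.measurable_g0

instance (t : ℕ) : IsMarkovKernel (S.obsK t) :=
  Kernel.IsMarkovKernel.map _ (S.measurable_g t)

lemma transK_apply (t : ℕ) (p : X × U) :
    S.transK t p = S.lamX.withDensity (S.transDens t p.1 p.2) := by
  rw [← S.trans_eq, transK, Kernel.map_apply _ (S.measurable_f t), Kernel.prod_apply,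
    Kernel.id_apply, Kernel.const_apply, Measure.dirac_prod,
    Measure.map_map (S.measurable_f t) measurable_prodMk_left]
  rfl

/-! ### Output feedback policies and the law of the trajectories -/

end System

/-- Realisations of `(X^t, Y^t, U^{t-1})`. -/
abbrev Traj (X U Y : Type*) (t : ℕ) : Type _ := (Fin (t + 1) → X) × (Fin (t + 1) → Y) × (Fin t → U)

/-- Realisations of `(Y^t, U^{t-1})`, the information available to the controller at time `t`. -/
abbrev ObsHist (U Y : Type*) (t : ℕ) : Type _ := (Fin (t + 1) → Y) × (Fin t → U)

variable (U Y) in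
/-- A (possibly randomised) output feedback policy: `U_t` is drawn from a conditional distribution
given `(y^t, u^{t-1})`. -/
structure OutputPolicy where
  ker : (t : ℕ) → Kernel (ObsHist U Y t) U
  isMarkov : ∀ t, IsMarkovKernel (ker t)

attribute [instance] OutputPolicy.isMarkov

namespace System

variable (S : System X U Y W V)

/-- The conditional law of `(U_t, X_{t+1}, Y_{t+1})` given `(X^t, Y^t, U^{t-1})` under `μ`. -/
def stepK (μ : OutputPolicy U Y) (t : ℕ) : Kernel (Traj X U Y t) (U × X × Y) :=
  ((μ.ker t).comap Prod.snd measurable_snd) ⊗ₖ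
    (((S.transK t).comap (fun q : Traj X U Y t × U => (q.1.1 (Fin.last t), q.2)) (by fun_prop)) ⊗ₖ
      ((S.obsK t).comap (fun q : (Traj X U Y t × U) × X => (q.2, q.1.2)) (by fun_prop)))

instance (μ : OutputPolicy U Y) (t : ℕ) : IsMarkovKernel (S.stepK μ t) := by
  unfold stepK; infer_instance

/-- Append `(u_t, x_{t+1}, y_{t+1})` to `(x^t, y^t, u^{t-1})`. -/
def extend (X U Y : Type*) (t : ℕ) (p : Traj X U Y t × (U × X × Y)) : Traj X U Y (t + 1) :=
  (Fin.snoc p.1.1 p.2.2.1, Fin.snoc p.1.2.1 p.2.2.2, Fin.snoc p.1.2.2 p.2.1)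

lemma measurable_extend (t : ℕ) : Measurable (extend X U Y t) :=
  ((measurable_snoc (t + 1)).comp (by fun_prop : Measurable
      fun p : Traj X U Y t × (U × X × Y) => (p.1.1, p.2.2.1))).prodMk
    (((measurable_snoc (t + 1)).comp (by fun_prop : Measurable
      fun p : Traj X U Y t × (U × X × Y) => (p.1.2.1, p.2.2.2))).prodMk
    ((measurable_snoc t).comp (by fun_prop : Measurable
      fun p : Traj X U Y t × (U × X × Y) => (p.1.2.2, p.2.1))))

/-- The joint law of `(X_0, Y_0)`. -/
def initLaw : Measure (X × Y) := S.lawX0 ⊗ₘ S.obsK0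

instance : IsProbabilityMeasure S.initLaw := by
  unfold initLaw; infer_instance

/-- The joint law of `(X^t, Y^t, U^{t-1})` under the policy `μ`. -/
def law (μ : OutputPolicy U Y) : (t : ℕ) → Measure (Traj X U Y t)
  | 0 => S.initLaw.map (fun p => (fun _ => p.1, fun _ => p.2, Fin.elim0))
  | t + 1 => (law μ t ⊗ₘ S.stepK μ t).map (extend X U Y t)

instance (μ : OutputPolicy U Y) (t : ℕ) : IsProbabilityMeasure (S.law μ t) := by
  induction t with
  | zero =>
    exact Measure.isProbabilityMeasure_map (by fun_prop : Measurable _).aemeasurable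
  | succ t ih =>
    exact Measure.isProbabilityMeasure_map (measurable_extend t).aemeasurable

/-! ### The smoothing-averse control problem -/

section Problem

variable [StandardBorelSpace X] [Nonempty X]

/-- The smoother entropy `h(X^T | Y^T, U^{T-1})` under `μ`, relative to the product reference measure
on state trajectories. -/
def smootherEntropy (μ : OutputPolicy U Y) (T : ℕ) : ℝ :=
  condEntropy (Measure.pi fun _ : Fin (T + 1) => S.lamX)
    (fun ω : Traj X U Y T => ω.1) (fun ω => ω.2) (S.law μ T)

/-- Finite if and only if the smoother entropy converges absolutely. -/
def absSmootherEntropy (μ : OutputPolicy U Y) (T : ℕ) : ℝ≥0∞ :=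
  absCondEntropy (Measure.pi fun _ : Fin (T + 1) => S.lamX)
    (fun ω : Traj X U Y T => ω.1) (fun ω => ω.2) (S.law μ T)

/-- The objective `h(X^T | Y^T, U^{T-1}) - γ E[∑_{t<T} c_t(X_t, U_t)]`. -/
def objective (c : ℕ → X → U → ℝ≥0) (γ : ℝ≥0) (T : ℕ) (μ : OutputPolicy U Y) : ℝ :=
  S.smootherEntropy μ T -
    γ * ∫ ω, ∑ t : Fin T, (c t (ω.1 t.castSucc) (ω.2.2 t) : ℝ) ∂(S.law μ T)

/-- The policies for which the quantities of the problem are well defined and finite: for `t < T`, the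
conditional entropies `h(X_{t+1} | Y^{t+1}, U^t)`, `h(X_{t+1} | Y^t, U^t)` and
`h(X_{t+1} | X_t, Y^t, U^t)` converge absolutely, and `γ c_t(X_t, U_t)` has finite expectation. -/
def Admissible (c : ℕ → X → U → ℝ≥0) (γ : ℝ≥0) (T : ℕ) (μ : OutputPolicy U Y) : Prop :=
  ∀ t < T,
    absCondEntropy S.lamX (fun ω : Traj X U Y (t + 1) => ω.1 (Fin.last (t + 1)))
      (fun ω => ω.2) (S.law μ (t + 1)) < ⊤ ∧
    absCondEntropy S.lamX (fun ω : Traj X U Y (t + 1) => ω.1 (Fin.last (t + 1)))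
      (fun ω => ((Fin.init ω.2.1 : Fin (t + 1) → Y), ω.2.2)) (S.law μ (t + 1)) < ⊤ ∧
    absCondEntropy S.lamX (fun ω : Traj X U Y (t + 1) => ω.1 (Fin.last (t + 1)))
      (fun ω => (ω.1 (Fin.last t).castSucc, (Fin.init ω.2.1 : Fin (t + 1) → Y), ω.2.2))
      (S.law μ (t + 1)) < ⊤ ∧
    ∫⁻ ω, (γ * c t (ω.1 (Fin.last t).castSucc) (ω.2.2 (Fin.last t)) : ℝ≥0∞)
      ∂(S.law μ (t + 1)) < ⊤

/-- The constant `h(X_0 | Y_0)`. -/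
def initEntropy : ℝ := condEntropy S.lamX Prod.fst Prod.snd S.initLaw

/-- Finite if and only if `h(X_0 | Y_0)` converges absolutely. -/
def absInitEntropy : ℝ≥0∞ := absCondEntropy S.lamX Prod.fst Prod.snd S.initLaw

end Problem

/-! ### Information states and the Bayesian filter -/

/-- Information states: probability densities on the state space, represented by the probability
measures that are absolutely continuous with respect to the reference measure. -/
abbrev Info : Type _ := {π : Measure X // IsProbabilityMeasure π ∧ π ≪ S.lamX}

instance (π : S.Info) : IsProbabilityMeasure π.1 := π.2.1

/-- The law `π` of `X_t` given `(π_t, u_t) = (π, u)`. -/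
def stateK : Kernel (S.Info × U) X :=
  ⟨fun p => p.1.1, measurable_subtype_coe.comp measurable_fst⟩

instance : IsMarkovKernel S.stateK := ⟨fun p => p.1.2.1⟩

/-- The joint law `p(x_{t+1} | x_t, u_t) π_t(x_t)` of `(X_t, X_{t+1})` given `(π_t, u_t)`. -/
def jointK (t : ℕ) : Kernel (S.Info × U) (X × X) :=
  S.stateK ⊗ₖ (S.transK t).comap (fun q : (S.Info × U) × X => (q.2, q.1.2)) (by fun_prop)

instance (t : ℕ) : IsMarkovKernel (S.jointK t) := by
  unfold jointK; infer_instance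

/-- The predicted law `π_{t+1|t}` of `X_{t+1}` given `(π_t, u_t)`. -/
def predK (t : ℕ) : Kernel (S.Info × U) X := (S.jointK t).snd

instance (t : ℕ) : IsMarkovKernel (S.predK t) := by
  unfold predK; infer_instance

/-- The joint law of `(X_t, Y_{t+1})` given `(π_t, u_t)`. -/
def stateObsK (t : ℕ) : Kernel (S.Info × U) (X × Y) :=
  (S.jointK t ⊗ₖ (S.obsK t).comap (fun q : (S.Info × U) × (X × X) => (q.2.2, q.1.2))
    (by fun_prop)).map (fun q => (q.1.1, q.2))

instance (t : ℕ) : IsMarkovKernel (S.stateObsK t) := by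
  unfold stateObsK
  exact Kernel.IsMarkovKernel.map _ (by fun_prop)

/-- The law `p(y_{t+1} | π_t, u_t)`. -/
def obsPredK (t : ℕ) : Kernel (S.Info × U) Y := (S.stateObsK t).snd

instance (t : ℕ) : IsMarkovKernel (S.obsPredK t) := by
  unfold obsPredK; infer_instance

/-- Bayes' rule: the posterior, proportional to `ℓ` times the prior. If the normalising constant
is `0` or infinite, which happens with probability zero, the prior is kept. -/
def bayes (prior : Measure X) (ℓ : X → ℝ≥0∞) : Measure X :=
  open Classical in
  if (∫⁻ x, ℓ x ∂prior) = 0 ∨ (∫⁻ x, ℓ x ∂prior) = ⊤ then prior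
  else (∫⁻ x, ℓ x ∂prior)⁻¹ • prior.withDensity ℓ

lemma isProb_bayes (prior : Measure X) [IsProbabilityMeasure prior] (ℓ : X → ℝ≥0∞) :
    IsProbabilityMeasure (bayes prior ℓ) := by
  unfold bayes
  split_ifs with h
  · infer_instance
  · rw [not_or] at h
    refine ⟨?_⟩
    rw [Measure.smul_apply, withDensity_apply _ MeasurableSet.univ, Measure.restrict_univ,
      smul_eq_mul, ENNReal.inv_mul_cancel h.1 h.2]

lemma bayes_ac (prior : Measure X) (ℓ : X → ℝ≥0∞) : bayes prior ℓ ≪ prior := by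
  unfold bayes
  split_ifs with h
  · exact Measure.AbsolutelyContinuous.rfl
  · exact (withDensity_absolutelyContinuous _ _).smul_left _

lemma measurable_bayes {A B : Type*} [MeasurableSpace A] [MeasurableSpace B]
    (κ : Kernel A X) [IsMarkovKernel κ] (a : B → A) (ha : Measurable a) (ℓ : B → X → ℝ≥0∞)
    (hℓ : Measurable (Function.uncurry ℓ)) :
    Measurable (fun b => bayes (κ (a b)) (ℓ b)) := by
  classical
  have hZ : Measurable (fun b => ∫⁻ x, ℓ b x ∂(κ (a b))) := by
    have := Measurable.lintegral_kernel_prod_right' (κ := κ.comap a ha) hℓ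
    simpa using this
  unfold bayes
  refine Measurable.ite ((hZ (measurableSet_singleton 0)).union (hZ (measurableSet_singleton ⊤)))
    (κ.measurable.comp ha) ?_
  refine Measure.measurable_of_measurable_coe _ fun s hs => ?_
  simp only [Measure.smul_apply, smul_eq_mul, withDensity_apply _ hs]
  refine hZ.inv.mul ?_
  have hℓ' : Measurable (Function.uncurry fun b x => s.indicator (ℓ b) x) := by
    have : (Function.uncurry fun b x => s.indicator (ℓ b) x)
        = (Prod.snd ⁻¹' s).indicator (Function.uncurry ℓ) := by
      ext ⟨b, x⟩; simp [Set.indicator]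
    rw [this]; exact hℓ.indicator (measurable_snd hs)
  have := Measurable.lintegral_kernel_prod_right' (κ := κ.comap a ha) hℓ'
  simpa [lintegral_indicator hs] using this

lemma predK_ac (t : ℕ) (p : S.Info × U) : S.predK t p ≪ S.lamX := by
  refine Measure.AbsolutelyContinuous.mk fun s hs h0 => ?_
  rw [predK, Kernel.snd_apply' _ _ hs, jointK, Kernel.compProd_apply (measurable_snd hs)]
  refine (lintegral_congr fun x => ?_).trans lintegral_zero
  have : S.transK t (x, p.2) ≪ S.lamX := by
    rw [transK_apply]; exact withDensity_absolutelyContinuous _ _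
  exact this h0

/-- The initial information state `π_0`, the posterior of `X_0` given `Y_0 = y`. -/
def filterInit (y : Y) : S.Info :=
  ⟨bayes S.lawX0 (fun x => S.obsDens0 x y), isProb_bayes _ _,
    (bayes_ac _ _).trans S.lawX0_ac⟩

/-- The Bayesian filter map `π_{t+1} = Π(π_t, u_t, y_{t+1})`. -/
def filterStep (t : ℕ) (π : S.Info) (u : U) (y : Y) : S.Info :=
  ⟨bayes (S.predK t (π, u)) (fun x => S.obsDens t x u y), isProb_bayes _ _,
    (bayes_ac _ _).trans (S.predK_ac t (π, u))⟩

lemma measurable_filterInit : Measurable S.filterInit :=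
  (measurable_bayes (Kernel.const Unit S.lawX0) (fun _ : Y => ()) measurable_const
    (fun y x => S.obsDens0 x y) (S.measurable_obsDens0.comp measurable_swap)).subtype_mk

lemma measurable_filterStep (t : ℕ) :
    Measurable (fun q : (S.Info × U) × Y => S.filterStep t q.1.1 q.1.2 q.2) := by
  refine (measurable_bayes (S.predK t) (fun q : (S.Info × U) × Y => q.1) measurable_fst
    (fun q x => S.obsDens t x q.1.2 q.2) ?_).subtype_mk
  exact (S.measurable_obsDens t).comp
    (by fun_prop : Measurable fun r : ((S.Info × U) × Y) × X => ((r.2, r.1.1.2), r.1.2))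

/-- The information state `π_t` as a function of `(y^t, u^{t-1})`, by the filter recursion. -/
def filter : (t : ℕ) → ObsHist U Y t → S.Info
  | 0, h => S.filterInit (h.1 0)
  | t + 1, h => S.filterStep t (filter t (Fin.init h.1, Fin.init h.2))
      (h.2 (Fin.last t)) (h.1 (Fin.last (t + 1)))

lemma measurable_filter (t : ℕ) : Measurable (S.filter (U := U) t) := by
  induction t with
  | zero => exact S.measurable_filterInit.comp (by fun_prop)
  | succ t ih =>
    have h1 : Measurable (fun h : ObsHist U Y (t + 1) =>
        ((Fin.init h.1, Fin.init h.2) : ObsHist U Y t)) := by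
      unfold Fin.init; fun_prop
    exact (S.measurable_filterStep t).comp
      (((ih.comp h1).prodMk (by fun_prop : Measurable fun h : ObsHist U Y (t + 1) =>
        h.2 (Fin.last t))).prodMk (by fun_prop : Measurable fun h : ObsHist U Y (t + 1) =>
        h.1 (Fin.last (t + 1))))

/-! ### The fully observed control problem -/

/-- `r̃(π_t, u_t, y_{t+1}) = h(X_{t+1} | y^{t+1}, u^t) - h(X_{t+1} | y^t, u^t)
+ h(X_{t+1} | X_t, y^t, u^t)`, as a function of the information state. -/
def rTilde (t : ℕ) (π : S.Info) (u : U) (y : Y) : ℝ :=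
  entropy S.lamX (S.filterStep t π u y).1 - entropy S.lamX (S.predK t (π, u))
    + ∫ x, entropy S.lamX (S.transK t (x, u)) ∂π.1

/-- The stage reward `r(π, u) = E[r̃(π_t, u_t, Y_{t+1}) - γ c_t(X_t, u_t) | π_t = π, u_t = u]`. -/
def reward (c : ℕ → X → U → ℝ≥0) (γ : ℝ≥0) (t : ℕ) (π : S.Info) (u : U) : ℝ :=
  ∫ q, (S.rTilde t π u q.2 - γ * (c t q.1 u : ℝ)) ∂(S.stateObsK t (π, u))

/-- Finite if and only if all the integrals in the definition of `reward` converge absolutely. -/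
def absReward (c : ℕ → X → U → ℝ≥0) (γ : ℝ≥0) (t : ℕ) (π : S.Info) (u : U) : ℝ≥0∞ :=
  (∫⁻ y, absEntropy S.lamX (S.filterStep t π u y).1 ∂(S.obsPredK t (π, u)))
    + absEntropy S.lamX (S.predK t (π, u))
    + (∫⁻ x, absEntropy S.lamX (S.transK t (x, u)) ∂π.1)
    + ∫⁻ x, (γ * c t x u : ℝ≥0∞) ∂π.1

/-- The law of `π_{t+1} = Π(π_t, u_t, Y_{t+1})`, `Y_{t+1} ∼ p(y_{t+1} | π_t, u_t)`, given
`(π_t, u_t)`. -/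
def infoStepK (t : ℕ) : Kernel (S.Info × U) S.Info :=
  (Kernel.id ×ₖ S.obsPredK t).map (fun q => S.filterStep t q.1.1 q.1.2 q.2)

instance (t : ℕ) : IsMarkovKernel (S.infoStepK t) :=
  Kernel.IsMarkovKernel.map _ (S.measurable_filterStep t)

/-- A (possibly randomised) policy that depends only on the information state: `U_t` is drawn from
a conditional distribution given `π_t`. -/
structure InfoPolicy where
  ker : ℕ → Kernel S.Info U
  isMarkov : ∀ t, IsMarkovKernel (ker t)

attribute [instance] InfoPolicy.isMarkov

variable {S}

/-- The law of `(π^t, U^{t-1})` given `π_0` in the fully observed problem. -/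
def infoLaw (ν : S.InfoPolicy) : (t : ℕ) → Kernel S.Info ((Fin (t + 1) → S.Info) × (Fin t → U))
  | 0 => Kernel.deterministic (fun π => (fun _ => π, Fin.elim0)) (by fun_prop)
  | t + 1 =>
    (infoLaw ν t ⊗ₖ
      (((ν.ker t).comap (fun q : S.Info × ((Fin (t + 1) → S.Info) × (Fin t → U)) =>
          q.2.1 (Fin.last t)) (by fun_prop)) ⊗ₖ
        ((S.infoStepK t).comap
          (fun q : (S.Info × ((Fin (t + 1) → S.Info) × (Fin t → U))) × U =>
            (q.1.2.1 (Fin.last t), q.2)) (by fun_prop)))).map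
      (fun p => (Fin.snoc p.1.1 p.2.2, Fin.snoc p.1.2 p.2.1))

instance (ν : S.InfoPolicy) (t : ℕ) : IsMarkovKernel (infoLaw ν t) := by
  induction t with
  | zero => unfold infoLaw; infer_instance
  | succ t ih =>
    unfold infoLaw
    refine Kernel.IsMarkovKernel.map _ ?_
    exact ((measurable_snoc (t + 1)).comp (by fun_prop : Measurable
        fun p : ((Fin (t + 1) → S.Info) × (Fin t → U)) × (U × S.Info) => (p.1.1, p.2.2))).prodMk
      ((measurable_snoc t).comp (by fun_prop : Measurable
        fun p : ((Fin (t + 1) → S.Info) × (Fin t → U)) × (U × S.Info) => (p.1.2, p.2.1)))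

variable (S)

/-- The total reward `∑_{t<T} r(π_t, u_t)` along `(π^T, u^{T-1})`. -/
def totalReward (c : ℕ → X → U → ℝ≥0) (γ : ℝ≥0) (T : ℕ)
    (p : (Fin (T + 1) → S.Info) × (Fin T → U)) : ℝ :=
  ∑ t : Fin T, S.reward c γ t (p.1 t.castSucc) (p.2 t)

/-- The conditional expected total reward `E[∑_{t<T} r(π_t, U_t) | π_0 = π]` under the policy `ν`. -/
def infoValue (c : ℕ → X → U → ℝ≥0) (γ : ℝ≥0) (T : ℕ) (ν : S.InfoPolicy) (π : S.Info) : ℝ :=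
  ∫ p, S.totalReward c γ T p ∂(infoLaw ν T π)

/-- The law of the initial information state `π_0`. -/
def infoInit : Measure S.Info := S.initLaw.map (fun p => S.filterInit p.2)

instance : IsProbabilityMeasure S.infoInit :=
  Measure.isProbabilityMeasure_map (S.measurable_filterInit.comp measurable_snd).aemeasurable

/-- The policies of the fully observed problem for which the total reward is well defined: all the
integrals that define it converge absolutely. -/
def InfoAdmissible (c : ℕ → X → U → ℝ≥0) (γ : ℝ≥0) (T : ℕ) (ν : S.InfoPolicy) : Prop :=
  ∫⁻ π, ∫⁻ p, ∑ t : Fin T, S.absReward c γ t (p.1 t.castSucc) (p.2 t) ∂(infoLaw ν T π)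
    ∂S.infoInit < ⊤

variable {S}

/-- The output feedback policy that feeds the filter output `π_t` to a policy of the fully observed
problem. -/
def InfoPolicy.toOutput (ν : S.InfoPolicy) : OutputPolicy U Y where
  ker t := (ν.ker t).comap (S.filter t) (S.measurable_filter t)
  isMarkov _ := inferInstance

variable (S)

/-- The path `(π^T, u^{T-1})` of information states and controls along `(y^T, u^{T-1})`, where `π_s` is
the filter output for the truncation `(y^s, u^{s-1})`. -/
def infoPath (T : ℕ) (h : ObsHist U Y T) : (Fin (T + 1) → S.Info) × (Fin T → U) :=
  (fun s => S.filter s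
      (fun i => h.1 (Fin.castLE (Nat.succ_le_of_lt s.isLt) i),
        fun i => h.2 (Fin.castLE (Nat.le_of_lt_succ s.isLt) i)), h.2)

/-- `v(π_0)` is the supremum over all admissible policies of the conditional expected total reward
given `π_0`, in the almost sure sense (essential supremum). -/
def IsOptimalValue (c : ℕ → X → U → ℝ≥0) (γ : ℝ≥0) (T : ℕ) (v : S.Info → EReal) : Prop :=
  (∀ ν : S.InfoPolicy, S.InfoAdmissible c γ T ν →
    ∀ᵐ π ∂S.infoInit, (S.infoValue c γ T ν π : EReal) ≤ v π) ∧
  ∀ w : S.Info → EReal, Measurable w →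
    (∀ ν : S.InfoPolicy, S.InfoAdmissible c γ T ν →
      ∀ᵐ π ∂S.infoInit, (S.infoValue c γ T ν π : EReal) ≤ w π) →
    ∀ᵐ π ∂S.infoInit, v π ≤ w π

end System

end

end SmoothingAverse

/-! The theorem rests on a chain rule for the smoother density. Let the smoother be computed
recursively: extend the law of the path by the transition kernel, then apply Bayes' rule. The
measurement at time `t + 1` depends on the path only through its last state, so the Bayes factor `w`
of the path is the Bayes factor of the predicted state (`bayesWeight_map`). Hence the smoother
density is multiplied in each step by (transition density) · `w`, while the filter density is
(predicted density) · `w`. Eliminating `w` and taking logarithms, the log smoother density grows in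
each step by log transition + log filter − log predictor (`logSmooth_succ_ae_eq`). This is a
pointwise identity almost surely, so the entropies telescope as soon as the separate logarithms are
integrable (`logSmooth_chain`).

The law of `(X_t, X_{t+1}, Y_{t+1})` given the history and `U_t` is determined by `(π_t, U_t)`,
whatever the policy is (`map_infoLastStep_law`). The stage reward is therefore a conditional
expectation of the increment minus the cost, and both admissibility and the objective depend on the
policy only through the laws `ctrlLaw` of `(π_t, U_t)` for `t < T` (`admissible_iff`,
`objective_eq`). Drawing `U_t` from its conditional law given `π_t` reproduces all of these laws, by
induction on `t` (`ctrlLaw_markovPolicy`). So policies of the information state suffice. Their laws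
in the fully observed problem are the same ones, disintegrated over `π_0` (`ctrlLaw_trackOutput`,
`map_ctrl_infoLaw`).

For the essential supremum, countably many policies suffice, and the maximum of finitely many of
their values is attained by choosing among them according to `π_0`. Such a choice remembers `π_0`,
so it is not a policy of `π_t` alone. It is an output feedback policy, however, and passing to
conditional laws once more gives an admissible policy of `π_t` with the same mean value
(`exists_infoPolicy_integral_eq`). Monotone convergence along the running maxima gives the optimal
value (`exists_isOptimalValue`), and a choice between two policies turns optimality on average into
optimality for almost every `π_0`. -/

namespace SmoothingAverse

/-! ### Bayes' rule -/

section Bayes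

variable {A B Y : Type*} [MeasurableSpace A] [MeasurableSpace B] [MeasurableSpace Y]

/-- The density of the Bayes posterior relative to the prior. -/
noncomputable def bayesWeight (prior : Measure A) (ℓ : A → ℝ≥0∞) (a : A) : ℝ≥0∞ :=
  open Classical in
  if (∫⁻ x, ℓ x ∂prior) = 0 ∨ (∫⁻ x, ℓ x ∂prior) = ⊤ then 1
  else (∫⁻ x, ℓ x ∂prior)⁻¹ * ℓ a

lemma System.bayes_eq_withDensity (prior : Measure A) (ℓ : A → ℝ≥0∞) (hℓ : Measurable ℓ) :
    System.bayes prior ℓ = prior.withDensity (bayesWeight prior ℓ) := by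
  unfold System.bayes bayesWeight
  split_ifs with h
  · exact withDensity_one.symm
  · rw [← withDensity_smul _ hℓ]
    rfl

lemma measurable_bayesWeight {C : Type*} [MeasurableSpace C] (κ : Kernel B A) [IsMarkovKernel κ]
    (a : C → B) (ha : Measurable a) (ℓ : C → A → ℝ≥0∞) (hℓ : Measurable (Function.uncurry ℓ)) :
    Measurable (fun p : C × A => bayesWeight (κ (a p.1)) (ℓ p.1) p.2) := by
  classical
  have hZ : Measurable (fun b => ∫⁻ x, ℓ b x ∂(κ (a b))) := by
    have := Measurable.lintegral_kernel_prod_right' (κ := κ.comap a ha) hℓ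
    simpa using this
  have hZ' : Measurable (fun p : C × A => ∫⁻ x, ℓ p.1 x ∂(κ (a p.1))) := hZ.comp measurable_fst
  unfold bayesWeight
  exact Measurable.ite ((hZ' (measurableSet_singleton 0)).union (hZ' (measurableSet_singleton ⊤)))
    measurable_const (hZ'.inv.mul hℓ)

/-- If the likelihood sees only `g a`, conditioning commutes with the push-forward along `g`. With
`g` the last coordinate of a path, this makes the filter a marginal of the smoother. -/
lemma System.bayes_map (prior : Measure A) (g : A → B) (hg : Measurable g) (ℓ : B → ℝ≥0∞)
    (hℓ : Measurable ℓ) :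
    (System.bayes prior (fun a => ℓ (g a))).map g = System.bayes (prior.map g) ℓ := by
  unfold System.bayes
  rw [lintegral_map hℓ hg]
  split_ifs with h
  · rfl
  · rw [Measure.map_smul]
    congr 1
    ext s hs
    rw [Measure.map_apply hg hs, withDensity_apply _ (hg hs), withDensity_apply _ hs,
      ← lintegral_indicator hs, lintegral_map (hℓ.indicator hs) hg, ← lintegral_indicator (hg hs)]
    rfl

/-- The normalising constants of the prior and of its image agree. This puts the same Bayes factor
into the smoother and the filter, which is why it drops out of the chain rule. -/
lemma bayesWeight_map (prior : Measure A) (g : A → B) (hg : Measurable g) (ℓ : B → ℝ≥0∞)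
    (hℓ : Measurable ℓ) (a : A) :
    bayesWeight prior (fun a => ℓ (g a)) a = bayesWeight (prior.map g) ℓ (g a) := by
  unfold bayesWeight
  rw [lintegral_map hℓ hg]

/-- Averaging over the joint law of a hidden variable and a measurement is averaging over the
posterior and then over the measurement. -/
lemma lintegral_bayes (prior : Measure A) [IsProbabilityMeasure prior] (lamY : Measure Y)
    [SigmaFinite lamY] (O : Kernel A Y) [IsMarkovKernel O] (ℓ : A → Y → ℝ≥0∞)
    (hℓ : Measurable (Function.uncurry ℓ)) (hO : ∀ a, O a = lamY.withDensity (ℓ a))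
    (F : A → Y → ℝ≥0∞) (hF : Measurable (Function.uncurry F)) :
    ∫⁻ a, ∫⁻ y, F a y ∂O a ∂prior
      = ∫⁻ a, ∫⁻ y, ∫⁻ a', F a' y ∂(System.bayes prior (fun a => ℓ a y)) ∂O a ∂prior := by
  -- Tonelli: with the measurement integrated last against `lamY`, Bayes' rule can be checked for
  -- each `y` separately.
  have key : ∀ G : A → Y → ℝ≥0∞, Measurable (Function.uncurry G) →
      ∫⁻ a, ∫⁻ y, G a y ∂O a ∂prior = ∫⁻ y, ∫⁻ a, ℓ a y * G a y ∂prior ∂lamY := by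
    intro G hG
    rw [lintegral_lintegral_swap ((hℓ.comp measurable_swap).mul
      (hG.comp measurable_swap)).aemeasurable]
    refine lintegral_congr fun a => ?_
    rw [hO, lintegral_withDensity_eq_lintegral_mul _ hℓ.of_uncurry_left hG.of_uncurry_left]
    rfl
  have hℓy : ∀ y, Measurable fun a => ℓ a y := fun y => hℓ.of_uncurry_right
  have hFy : ∀ y, Measurable fun a => F a y := fun y => hF.of_uncurry_right
  have hpost : Measurable fun y => System.bayes prior (fun a => ℓ a y) :=
    System.measurable_bayes (Kernel.const Unit prior) (fun _ : Y => ()) measurable_const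
      (fun y a => ℓ a y) (hℓ.comp measurable_swap)
  let post : Kernel Y A := ⟨_, hpost⟩
  have hmk : IsMarkovKernel post := ⟨fun y => System.isProb_bayes _ _⟩
  have hG : Measurable fun y => ∫⁻ a', F a' y ∂(System.bayes prior (fun a => ℓ a y)) :=
    Measurable.lintegral_kernel_prod_right' (κ := post) (hF.comp measurable_swap)
  rw [key F hF, key (fun _ y => ∫⁻ a', F a' y ∂(System.bayes prior (fun a => ℓ a y)))
    (hG.comp measurable_snd)]
  -- The evidence is a density of total mass one, hence finite almost everywhere.
  have hZtop : ∀ᵐ y ∂lamY, ∫⁻ a, ℓ a y ∂prior < ⊤ := by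
    refine ae_lt_top hℓ.lintegral_prod_left' ?_
    have h1 := key (fun _ _ => 1) measurable_const
    simp only [mul_one, lintegral_const, measure_univ] at h1
    exact h1 ▸ ENNReal.one_ne_top
  refine lintegral_congr_ae ?_
  filter_upwards [hZtop] with y hy
  rw [lintegral_mul_const _ (hℓy y)]
  unfold System.bayes
  split_ifs with h
  -- Where the evidence vanishes, so does the likelihood for prior-almost every `a`. Both sides are
  -- then zero, and the default value in `bayes` plays no role.
  · rcases h with h | h
    · rw [h, zero_mul]
      rw [lintegral_eq_zero_iff (hℓy y)] at h
      refine (lintegral_eq_zero_iff ((hℓy y).mul (hFy y))).2 ?_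
      filter_upwards [h] with a ha
      simp only [Pi.zero_apply] at ha ⊢
      rw [Pi.mul_apply, ha, zero_mul]
    · exact absurd h hy.ne
  · rw [not_or] at h
    rw [lintegral_smul_measure, smul_eq_mul, ← mul_assoc, ENNReal.mul_inv_cancel h.1 h.2, one_mul,
      lintegral_withDensity_eq_lintegral_mul _ (hℓy y) (hFy y)]
    rfl

end Bayes

/-! ### Entropies of measures given by densities -/

section Entropy

variable {A B Ω : Type*} [MeasurableSpace A] [MeasurableSpace B] [MeasurableSpace Ω]

lemma ae_withDensity_ne_zero_ne_top {lam : Measure A} {D : A → ℝ≥0∞} (hD : Measurable D)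
    [IsFiniteMeasure (lam.withDensity D)] : ∀ᵐ a ∂lam.withDensity D, D a ≠ 0 ∧ D a ≠ ⊤ := by
  rw [ae_withDensity_iff hD]
  have h : ∫⁻ a, D a ∂lam ≠ ⊤ := by
    have := measure_ne_top (lam.withDensity D) Set.univ
    rwa [withDensity_apply _ MeasurableSet.univ, Measure.restrict_univ] at this
  filter_upwards [ae_lt_top hD h] with a ha h0 using ⟨h0, ha.ne⟩

/-- The logarithm of a density. -/
noncomputable def logDens (d : ℝ≥0∞) : ℝ := Real.log d.toReal

lemma measurable_logDens : Measurable logDens := Real.measurable_log.comp ENNReal.measurable_toReal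

/-- `logDens` takes the default value `0` at `0` and at `⊤`, so additivity needs both factors to
avoid these values. -/
lemma logDens_mul {a b : ℝ≥0∞} (ha : a ≠ 0) (ha' : a ≠ ⊤) (hb : b ≠ 0) (hb' : b ≠ ⊤) :
    logDens (a * b) = logDens a + logDens b := by
  unfold logDens
  rw [ENNReal.toReal_mul, Real.log_mul (ENNReal.toReal_ne_zero.2 ⟨ha, ha'⟩)
    (ENNReal.toReal_ne_zero.2 ⟨hb, hb'⟩)]

lemma lintegral_ne_top_of_isFinite {lam : Measure A} {D : A → ℝ≥0∞}
    [IsFiniteMeasure (lam.withDensity D)] : ∫⁻ a, D a ∂lam ≠ ⊤ := by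
  have := measure_ne_top (lam.withDensity D) Set.univ
  rwa [withDensity_apply _ MeasurableSet.univ, Measure.restrict_univ] at this

lemma absEntropy_withDensity' (lam : Measure A) [SigmaFinite lam] {D : A → ℝ≥0∞}
    (hD : Measurable D) :
    absEntropy lam (lam.withDensity D) = ∫⁻ a, ‖Real.negMulLog (D a).toReal‖ₑ ∂lam := by
  unfold absEntropy
  refine lintegral_congr_ae ?_
  filter_upwards [Measure.rnDeriv_withDensity lam hD] with a ha
  rw [ha]

lemma entropy_withDensity' (lam : Measure A) [SigmaFinite lam] {D : A → ℝ≥0∞}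
    (hD : Measurable D) :
    entropy lam (lam.withDensity D) = ∫ a, Real.negMulLog (D a).toReal ∂lam := by
  unfold entropy
  refine integral_congr_ae ?_
  filter_upwards [Measure.rnDeriv_withDensity lam hD] with a ha
  rw [ha]

/-- One factor `D` of `D log D` is absorbed into the measure. This turns entropies into expectations
of log densities, which can be added along a trajectory. -/
lemma absEntropy_withDensity (lam : Measure A) [SigmaFinite lam] {D : A → ℝ≥0∞}
    (hD : Measurable D) [IsFiniteMeasure (lam.withDensity D)] :
    absEntropy lam (lam.withDensity D) = ∫⁻ a, ‖logDens (D a)‖ₑ ∂(lam.withDensity D) := by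
  rw [absEntropy_withDensity' lam hD,
    lintegral_withDensity_eq_lintegral_mul lam hD
      (g := fun a => ‖logDens (D a)‖ₑ) (measurable_logDens.comp hD).enorm]
  refine lintegral_congr_ae ?_
  filter_upwards [ae_lt_top hD lintegral_ne_top_of_isFinite] with a ha
  simp only [Pi.mul_apply, Real.negMulLog, logDens, neg_mul, enorm_neg, enorm_mul]
  rw [Real.enorm_of_nonneg ENNReal.toReal_nonneg, ENNReal.ofReal_toReal ha.ne]

lemma entropy_withDensity (lam : Measure A) [SigmaFinite lam] {D : A → ℝ≥0∞}
    (hD : Measurable D) [IsFiniteMeasure (lam.withDensity D)] :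
    entropy lam (lam.withDensity D) = - ∫ a, logDens (D a) ∂(lam.withDensity D) := by
  rw [entropy_withDensity' lam hD, integral_withDensity_eq_integral_toReal_smul hD
    (ae_lt_top hD lintegral_ne_top_of_isFinite), ← integral_neg]
  simp [Real.negMulLog, logDens]

lemma measurable_entropy (lam : Measure A) [SigmaFinite lam] (κ : B → Measure A)
    (D : B → A → ℝ≥0∞) (hD : Measurable (Function.uncurry D))
    (hκ : ∀ b, κ b = lam.withDensity (D b)) : Measurable fun b => entropy lam (κ b) := by
  have : (fun b => entropy lam (κ b)) = fun b => ∫ a, Real.negMulLog (D b a).toReal ∂lam := by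
    funext b
    rw [hκ, entropy_withDensity' lam hD.of_uncurry_left]
  rw [this]
  exact (StronglyMeasurable.integral_prod_right'
    (Real.continuous_negMulLog.measurable.comp hD.ennreal_toReal).stronglyMeasurable).measurable

/-- The criterion by which every conditional law below is identified: `κ` is the law of `X` given
`Z` once it averages correctly against nonnegative functions of the pair. -/
lemma map_prodMk_eq_compProd_of_lintegral {P : Measure Ω}
    [IsProbabilityMeasure P] {X : Ω → A} {Z : Ω → B} (hX : Measurable X) (hZ : Measurable Z)
    (κ : Kernel B A) [IsMarkovKernel κ]
    (h : ∀ F : B × A → ℝ≥0∞, Measurable F →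
      ∫⁻ ω, F (Z ω, X ω) ∂P = ∫⁻ ω, ∫⁻ a, F (Z ω, a) ∂κ (Z ω) ∂P) :
    P.map (fun ω => (Z ω, X ω)) = (P.map Z) ⊗ₘ κ := by
  refine Measure.ext_of_lintegral _ fun F hF => ?_
  rw [lintegral_map hF (hZ.prodMk hX), h F hF, Measure.lintegral_compProd hF,
    lintegral_map (Measurable.lintegral_kernel_prod_right' hF) hZ]

lemma integrable_integral_of_compProd {P : Measure B} [SFinite P] {κ : Kernel B A}
    [IsSFiniteKernel κ] {f : B × A → ℝ} (hf : Integrable f (P ⊗ₘ κ)) :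
    Integrable (fun b => ∫ a, f (b, a) ∂κ b) P :=
  Integrable.integral_compProd (κ := Kernel.const Unit P) (η := Kernel.prodMkLeft Unit κ)
    (a := ()) hf

section Disintegration

variable (lam : Measure A) (P : Measure Ω) [IsProbabilityMeasure P] {X : Ω → A}
  {Z : Ω → B} (hX : Measurable X) (hZ : Measurable Z) (κ : Kernel B A) [IsMarkovKernel κ]
  (h : P.map (fun ω => (Z ω, X ω)) = (P.map Z) ⊗ₘ κ)
  (D : B → A → ℝ≥0∞) (hD : Measurable (Function.uncurry D))
  (hκ : ∀ b, κ b = lam.withDensity (D b))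

include hX hZ h hD hκ

/-- A point drawn from a law almost surely avoids the zeros and the poles of its density. This
discharges the side conditions of `logDens_mul` along random trajectories. -/
lemma ae_condDens_ne_zero_ne_top : ∀ᵐ ω ∂P, D (Z ω) (X ω) ≠ 0 ∧ D (Z ω) (X ω) ≠ ⊤ := by
  have hs : MeasurableSet {p : B × A | D p.1 p.2 ≠ 0 ∧ D p.1 p.2 ≠ ⊤} :=
    (hD (measurableSet_singleton 0).compl).inter (hD (measurableSet_singleton ⊤).compl)
  have key : ∀ᵐ p ∂(P.map (fun ω => (Z ω, X ω))), D p.1 p.2 ≠ 0 ∧ D p.1 p.2 ≠ ⊤ := by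
    rw [h, Measure.ae_compProd_iff hs]
    refine Filter.Eventually.of_forall fun b => ?_
    have : IsFiniteMeasure (lam.withDensity (D b)) := hκ b ▸ inferInstance
    rw [hκ]
    exact ae_withDensity_ne_zero_ne_top hD.of_uncurry_left
  exact (ae_map_iff (hZ.prodMk hX).aemeasurable hs).1 key

/-- Tonelli along the disintegration of the joint law. No integrability is needed, so finiteness
transfers in both directions. -/
lemma lintegral_absEntropy_eq [SigmaFinite lam] : ∫⁻ z, absEntropy lam (κ z) ∂(P.map Z)
    = ∫⁻ ω, ‖logDens (D (Z ω) (X ω))‖ₑ ∂P := by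
  have hm : Measurable fun p : B × A => ‖logDens (D p.1 p.2)‖ₑ :=
    (measurable_logDens.comp hD).enorm
  have : ∫⁻ ω, ‖logDens (D (Z ω) (X ω))‖ₑ ∂P
      = ∫⁻ p, ‖logDens (D p.1 p.2)‖ₑ ∂(P.map (fun ω => (Z ω, X ω))) := by
    rw [lintegral_map hm (hZ.prodMk hX)]
  rw [this, h, Measure.lintegral_compProd hm]
  refine lintegral_congr fun b => ?_
  have : IsFiniteMeasure (lam.withDensity (D b)) := hκ b ▸ inferInstance
  rw [hκ, absEntropy_withDensity lam hD.of_uncurry_left]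

lemma integral_entropy_eq [SigmaFinite lam]
    (hint : Integrable (fun ω => logDens (D (Z ω) (X ω))) P) :
    Integrable (fun z => entropy lam (κ z)) (P.map Z) ∧
      ∫ z, entropy lam (κ z) ∂(P.map Z) = - ∫ ω, logDens (D (Z ω) (X ω)) ∂P := by
  have hm : Measurable fun p : B × A => logDens (D p.1 p.2) := measurable_logDens.comp hD
  have hm' : AEStronglyMeasurable (fun p : B × A => logDens (D p.1 p.2))
      (P.map (fun ω => (Z ω, X ω))) := hm.aestronglyMeasurable
  have e : ∫ ω, logDens (D (Z ω) (X ω)) ∂P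
      = ∫ p, logDens (D p.1 p.2) ∂(P.map (fun ω => (Z ω, X ω))) := by
    rw [integral_map (hZ.prodMk hX).aemeasurable hm']
  have hint' : Integrable (fun p : B × A => logDens (D p.1 p.2)) ((P.map Z) ⊗ₘ κ) := by
    rw [← h]
    exact (integrable_map_measure hm' (hZ.prodMk hX).aemeasurable).2 hint
  have e2 : ∀ b, entropy lam (κ b) = - ∫ a, logDens (D b a) ∂κ b := fun b => by
    have : IsFiniteMeasure (lam.withDensity (D b)) := hκ b ▸ inferInstance
    rw [hκ, entropy_withDensity lam hD.of_uncurry_left]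
  simp only [e2]
  refine ⟨(integrable_integral_of_compProd hint').neg, ?_⟩
  rw [e, h, Measure.integral_compProd hint', ← integral_neg]

end Disintegration

variable [StandardBorelSpace A] [Nonempty A]

/-- Conditional laws on a standard Borel space are almost everywhere unique, so an explicit kernel
may replace `condDistrib`. -/
lemma absCondEntropy_eq (lam : Measure A) (P : Measure Ω)
    [IsProbabilityMeasure P] {X : Ω → A} {Z : Ω → B} (hX : Measurable X)
    (κ : Kernel B A) [IsMarkovKernel κ]
    (h : P.map (fun ω => (Z ω, X ω)) = (P.map Z) ⊗ₘ κ) :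
    absCondEntropy lam X Z P = ∫⁻ z, absEntropy lam (κ z) ∂(P.map Z) := by
  unfold absCondEntropy
  refine lintegral_congr_ae ?_
  filter_upwards [condDistrib_ae_eq_of_measure_eq_compProd Z hX.aemeasurable h] with z hz
  rw [hz]

lemma condEntropy_eq (lam : Measure A) (P : Measure Ω)
    [IsProbabilityMeasure P] {X : Ω → A} {Z : Ω → B} (hX : Measurable X)
    (κ : Kernel B A) [IsMarkovKernel κ]
    (h : P.map (fun ω => (Z ω, X ω)) = (P.map Z) ⊗ₘ κ) :
    condEntropy lam X Z P = ∫ z, entropy lam (κ z) ∂(P.map Z) := by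
  unfold condEntropy
  refine integral_congr_ae ?_
  filter_upwards [condDistrib_ae_eq_of_measure_eq_compProd Z hX.aemeasurable h] with z hz
  rw [hz]

/-- The absolute conditional entropy as an average of the logarithm of the conditional density. -/
lemma absCondEntropy_eq_lintegral_logDens (lam : Measure A) [SigmaFinite lam] (P : Measure Ω)
    [IsProbabilityMeasure P] {X : Ω → A} {Z : Ω → B} (hX : Measurable X) (hZ : Measurable Z)
    (κ : Kernel B A) [IsMarkovKernel κ]
    (h : P.map (fun ω => (Z ω, X ω)) = (P.map Z) ⊗ₘ κ)
    (D : B → A → ℝ≥0∞) (hD : Measurable (Function.uncurry D))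
    (hκ : ∀ b, κ b = lam.withDensity (D b)) :
    absCondEntropy lam X Z P = ∫⁻ ω, ‖logDens (D (Z ω) (X ω))‖ₑ ∂P := by
  rw [absCondEntropy_eq lam P hX κ h, lintegral_absEntropy_eq lam P hX hZ κ h D hD hκ]

/-- The conditional entropy as an average of the logarithm of the conditional density. -/
lemma condEntropy_eq_integral_logDens (lam : Measure A) [SigmaFinite lam] (P : Measure Ω)
    [IsProbabilityMeasure P] {X : Ω → A} {Z : Ω → B} (hX : Measurable X) (hZ : Measurable Z)
    (κ : Kernel B A) [IsMarkovKernel κ]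
    (h : P.map (fun ω => (Z ω, X ω)) = (P.map Z) ⊗ₘ κ)
    (D : B → A → ℝ≥0∞) (hD : Measurable (Function.uncurry D))
    (hκ : ∀ b, κ b = lam.withDensity (D b))
    (hint : Integrable (fun ω => logDens (D (Z ω) (X ω))) P) :
    condEntropy lam X Z P = - ∫ ω, logDens (D (Z ω) (X ω)) ∂P := by
  rw [condEntropy_eq lam P hX κ h, (integral_entropy_eq lam P hX hZ κ h D hD hκ hint).2]

end Entropy

end SmoothingAverse

/-! ### Correctness of the recursive smoother and filter under an arbitrary policy. -/

namespace SmoothingAverse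

noncomputable section

variable {X U Y W V : Type*} [MeasurableSpace X] [MeasurableSpace U] [MeasurableSpace Y]
  [MeasurableSpace W] [MeasurableSpace V]

lemma measurable_init {A : Type*} [MeasurableSpace A] (n : ℕ) :
    Measurable (fun f : Fin (n + 1) → A => (Fin.init f : Fin n → A)) := by
  unfold Fin.init; fun_prop

namespace System

variable (S : System X U Y W V)

lemma obsK_apply (t : ℕ) (p : X × U) :
    S.obsK t p = S.lamY.withDensity (S.obsDens t p.1 p.2) := by
  rw [← S.obs_eq, obsK, Kernel.map_apply _ (S.measurable_g t), Kernel.prod_apply,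
    Kernel.id_apply, Kernel.const_apply, Measure.dirac_prod,
    Measure.map_map (S.measurable_g t) measurable_prodMk_left]
  rfl

lemma obsK0_apply (x : X) : S.obsK0 x = S.lamY.withDensity (S.obsDens0 x) := by
  rw [← S.obs0_eq, obsK0, Kernel.map_apply _ S.measurable_g0, Kernel.prod_apply,
    Kernel.id_apply, Kernel.const_apply, Measure.dirac_prod,
    Measure.map_map S.measurable_g0 measurable_prodMk_left]
  rfl

/-! ### The smoother -/

/-- The filter as a Markov kernel. -/
def filterK (t : ℕ) : Kernel (ObsHist U Y t) X :=
  ⟨fun h => (S.filter t h).1, measurable_subtype_coe.comp (S.measurable_filter t)⟩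

instance (t : ℕ) : IsMarkovKernel (S.filterK t) := ⟨fun h => (S.filter t h).2.1⟩

/-- The law of `X^{t+1}` given `(y^t, u^t)`, if `κ` is the law of `X^t` given `(y^t, u^{t-1})`. -/
def pathPredK (t : ℕ) (κ : Kernel (ObsHist U Y t) (Fin (t + 1) → X)) :
    Kernel (ObsHist U Y t × U) (Fin (t + 2) → X) :=
  ((κ.comap Prod.fst measurable_fst) ⊗ₖ
    (S.transK t).comap (fun q : (ObsHist U Y t × U) × (Fin (t + 1) → X) =>
      (q.2 (Fin.last t), q.1.2)) (by fun_prop)).map (fun p => Fin.snoc p.1 p.2)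

instance (t : ℕ) (κ : Kernel (ObsHist U Y t) (Fin (t + 1) → X)) [IsMarkovKernel κ] :
    IsMarkovKernel (S.pathPredK t κ) :=
  Kernel.IsMarkovKernel.map _ (measurable_snoc (t + 1))

lemma lintegral_pathPredK (t : ℕ) (κ : Kernel (ObsHist U Y t) (Fin (t + 1) → X))
    [IsMarkovKernel κ] (p : ObsHist U Y t × U) {F : (Fin (t + 2) → X) → ℝ≥0∞}
    (hF : Measurable F) :
    ∫⁻ x, F x ∂S.pathPredK t κ p
      = ∫⁻ x, ∫⁻ x', F (Fin.snoc x x') ∂S.transK t (x (Fin.last t), p.2) ∂κ p.1 := by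
  rw [pathPredK, Kernel.map_apply _ (measurable_snoc (t + 1)),
    lintegral_map hF (measurable_snoc (t + 1)),
    Kernel.lintegral_compProd _ _ _ (hF.fun_comp (measurable_snoc (t + 1)))]
  rfl

/-- The recursively computed law of `X^t` given `(y^t, u^{t-1})`. -/
def smoothAux : (t : ℕ) → {κ : Kernel (ObsHist U Y t) (Fin (t + 1) → X) // IsMarkovKernel κ}
  | 0 => ⟨(S.filterK 0).map (fun x _ => x), Kernel.IsMarkovKernel.map _ (by fun_prop)⟩
  | t + 1 =>
    -- The recursion carries the Markov property in a subtype, because measurability of the Bayes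
    -- update requires it of the previous stage.
    have : IsMarkovKernel (smoothAux t).1 := (smoothAux t).2
    ⟨⟨fun h : ObsHist U Y (t + 1) =>
        bayes (S.pathPredK t (smoothAux t).1 ((Fin.init h.1, Fin.init h.2), h.2 (Fin.last t)))
          (fun x => S.obsDens t (x (Fin.last (t + 1))) (h.2 (Fin.last t))
            (h.1 (Fin.last (t + 1)))),
      measurable_bayes (S.pathPredK t (smoothAux t).1)
        (fun h : ObsHist U Y (t + 1) => ((Fin.init h.1, Fin.init h.2), h.2 (Fin.last t)))
        (by unfold Fin.init; fun_prop) _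
        ((S.measurable_obsDens t).comp
          (by fun_prop : Measurable fun r : ObsHist U Y (t + 1) × (Fin (t + 2) → X) =>
            ((r.2 (Fin.last (t + 1)), r.1.2 (Fin.last t)), r.1.1 (Fin.last (t + 1)))))⟩,
      ⟨fun _ => isProb_bayes _ _⟩⟩

/-- The smoother: the law of `X^t` given `(y^t, u^{t-1})`. -/
def smooth (t : ℕ) : Kernel (ObsHist U Y t) (Fin (t + 1) → X) := (S.smoothAux t).1

instance (t : ℕ) : IsMarkovKernel (S.smooth t) := (S.smoothAux t).2

lemma smooth_zero_apply (h : ObsHist U Y 0) :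
    S.smooth 0 h = (S.filter 0 h).1.map (fun x _ => x) := by
  change (S.filterK 0).map (fun x _ => x) h = _
  rw [Kernel.map_apply _ (by fun_prop)]
  rfl

lemma smooth_succ_apply (t : ℕ) (h : ObsHist U Y (t + 1)) :
    S.smooth (t + 1) h
      = bayes (S.pathPredK t (S.smooth t) ((Fin.init h.1, Fin.init h.2), h.2 (Fin.last t)))
          (fun x => S.obsDens t (x (Fin.last (t + 1))) (h.2 (Fin.last t))
            (h.1 (Fin.last (t + 1)))) := rfl

lemma lintegral_predK (t : ℕ) (p : S.Info × U) {F : X → ℝ≥0∞} (hF : Measurable F) :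
    ∫⁻ x, F x ∂S.predK t p = ∫⁻ x, ∫⁻ x', F x' ∂S.transK t (x, p.2) ∂p.1.1 := by
  rw [predK, Kernel.lintegral_snd _ _ hF, jointK,
    Kernel.lintegral_compProd _ _ _ (hF.fun_comp measurable_snd)]
  rfl

/-- The transition uses only the last state of the path, so predicting the path and then
marginalising is predicting the marginal. -/
lemma map_last_pathPredK (t : ℕ) (κ : Kernel (ObsHist U Y t) (Fin (t + 1) → X))
    [IsMarkovKernel κ] (p : ObsHist U Y t × U) (π : S.Info)
    (h : (κ p.1).map (fun x => x (Fin.last t)) = π.1) :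
    (S.pathPredK t κ p).map (fun x => x (Fin.last (t + 1))) = S.predK t (π, p.2) := by
  refine Measure.ext_of_lintegral _ fun F hF => ?_
  have hm : Measurable fun x => ∫⁻ x', F x' ∂S.transK t (x, p.2) :=
    hF.lintegral_kernel.comp (by fun_prop)
  rw [lintegral_map hF (by fun_prop), S.lintegral_pathPredK t κ p (by fun_prop),
    S.lintegral_predK t _ hF]
  simp only [Fin.snoc_last]
  rw [← h, lintegral_map hm (by fun_prop)]

/-- The last marginal of the smoother is the filter. -/
lemma map_last_smooth (t : ℕ) (h : ObsHist U Y t) :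
    (S.smooth t h).map (fun x => x (Fin.last t)) = (S.filter t h).1 := by
  induction t with
  | zero =>
    rw [smooth_zero_apply, Measure.map_map (by fun_prop) (by fun_prop)]
    exact Measure.map_id
  | succ t ih =>
    rw [smooth_succ_apply]
    -- The likelihood is a function of the last coordinate, so the Bayes update passes to the last
    -- marginal.
    have := bayes_map (S.pathPredK t (S.smooth t)
      ((Fin.init h.1, Fin.init h.2), h.2 (Fin.last t))) (fun x => x (Fin.last (t + 1)))
      (by fun_prop) (fun x => S.obsDens t x (h.2 (Fin.last t)) (h.1 (Fin.last (t + 1))))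
      ((S.measurable_obsDens t).comp (by fun_prop :
        Measurable fun x : X => ((x, h.2 (Fin.last t)), h.1 (Fin.last (t + 1)))))
    rw [this, S.map_last_pathPredK t (S.smooth t) _ _ (ih (Fin.init h.1, Fin.init h.2))]
    rfl

/-! ### Disintegrating the law of the trajectories -/

/-- The law of `(X_{t+1}, Y_{t+1})` given `(x_t, u_t)`. -/
def moveK (t : ℕ) : Kernel (Traj X U Y t × U) (X × Y) :=
  ((S.transK t).comap (fun q : Traj X U Y t × U => (q.1.1 (Fin.last t), q.2)) (by fun_prop)) ⊗ₖ
      ((S.obsK t).comap (fun q : (Traj X U Y t × U) × X => (q.2, q.1.2)) (by fun_prop))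

instance (t : ℕ) : IsMarkovKernel (S.moveK t) := by unfold moveK; infer_instance

lemma lintegral_moveK (t : ℕ) (p : Traj X U Y t × U) {F : X × Y → ℝ≥0∞} (hF : Measurable F) :
    ∫⁻ q, F q ∂S.moveK t p
      = ∫⁻ x, ∫⁻ y, F (x, y) ∂S.obsK t (x, p.2) ∂S.transK t (p.1.1 (Fin.last t), p.2) := by
  rw [moveK, Kernel.lintegral_compProd _ _ _ hF]
  rfl

lemma lintegral_stepK (μ : OutputPolicy U Y) (t : ℕ) (ω : Traj X U Y t) {F : U × X × Y → ℝ≥0∞}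
    (hF : Measurable F) :
    ∫⁻ q, F q ∂S.stepK μ t ω = ∫⁻ u, ∫⁻ q, F (u, q) ∂S.moveK t (ω, u) ∂μ.ker t ω.2 := by
  change ∫⁻ q, F q ∂(((μ.ker t).comap Prod.snd measurable_snd) ⊗ₖ S.moveK t) ω = _
  rw [Kernel.lintegral_compProd _ _ _ hF]
  rfl

lemma lintegral_law_succ (μ : OutputPolicy U Y) (t : ℕ) {F : Traj X U Y (t + 1) → ℝ≥0∞}
    (hF : Measurable F) :
    ∫⁻ ω, F ω ∂S.law μ (t + 1)
      = ∫⁻ ω, ∫⁻ q, F (extend X U Y t (ω, q)) ∂S.stepK μ t ω ∂S.law μ t := by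
  rw [law, lintegral_map hF (measurable_extend t),
    Measure.lintegral_compProd (hF.fun_comp (measurable_extend t))]

/-- The smoother is the law of `X^t` given `(Y^t, U^{t-1})`: one can average over it first. -/
def SmoothAverages (μ : OutputPolicy U Y) (t : ℕ) : Prop :=
  ∀ F : Traj X U Y t → ℝ≥0∞, Measurable F →
    ∫⁻ ω, F ω ∂S.law μ t = ∫⁻ ω, ∫⁻ x, F (x, ω.2) ∂S.smooth t ω.2 ∂S.law μ t

/-- Prepares the Bayes step of the induction: the past states are drawn from the smoother after the
control has been drawn. -/
lemma lintegral_law_succ_of_smoothAverages {μ : OutputPolicy U Y} {t : ℕ}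
    (h : S.SmoothAverages μ t) {F : Traj X U Y (t + 1) → ℝ≥0∞} (hF : Measurable F) :
    ∫⁻ ω, F ω ∂S.law μ (t + 1)
      = ∫⁻ ω, ∫⁻ u, ∫⁻ x, ∫⁻ x', ∫⁻ y, F (extend X U Y t ((x, ω.2), (u, x', y)))
          ∂S.obsK t (x', u) ∂S.transK t (x (Fin.last t), u) ∂S.smooth t ω.2 ∂μ.ker t ω.2
          ∂S.law μ t := by
  have hFe := hF.fun_comp (measurable_extend t)
  rw [S.lintegral_law_succ μ t hF,
    h _ (Measurable.lintegral_kernel_prod_right' (κ := S.stepK μ t) hFe)]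
  refine lintegral_congr fun ω => ?_
  have e1 : ∀ x, ∫⁻ q, F (extend X U Y t ((x, ω.2), q)) ∂S.stepK μ t (x, ω.2)
      = ∫⁻ u, ∫⁻ q, F (extend X U Y t ((x, ω.2), (u, q))) ∂S.moveK t ((x, ω.2), u)
        ∂μ.ker t ω.2 := fun x =>
    S.lintegral_stepK μ t (x, ω.2) (F := fun q => F (extend X U Y t ((x, ω.2), q)))
      (hFe.comp (by fun_prop))
  simp only [e1]
  -- The control is drawn from the history alone, so given the history it is independent of the past
  -- states and can be drawn first.
  rw [lintegral_lintegral_swap]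
  · refine lintegral_congr fun u => lintegral_congr fun x => ?_
    exact S.lintegral_moveK t ((x, ω.2), u)
      (F := fun q => F (extend X U Y t ((x, ω.2), (u, q)))) (hFe.comp (by fun_prop))
  · have := Measurable.lintegral_kernel_prod_right' (κ := S.moveK t)
      (f := fun p : (Traj X U Y t × U) × (X × Y) => F (extend X U Y t (p.1.1, (p.1.2, p.2))))
      (hFe.comp (by fun_prop))
    exact (this.comp (by fun_prop : Measurable fun p : (Fin (t + 1) → X) × U =>
      ((p.1, ω.2), p.2))).aemeasurable

lemma lintegral_law_zero (μ : OutputPolicy U Y) {F : Traj X U Y 0 → ℝ≥0∞} (hF : Measurable F) :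
    ∫⁻ ω, F ω ∂S.law μ 0
      = ∫⁻ x, ∫⁻ y, F (fun _ => x, fun _ => y, Fin.elim0) ∂S.obsK0 x ∂S.lawX0 := by
  have hm : Measurable fun p : X × Y =>
    ((fun _ => p.1, fun _ => p.2, Fin.elim0) : Traj X U Y 0) := by fun_prop
  rw [law, lintegral_map hF hm, initLaw, Measure.lintegral_compProd (hF.fun_comp hm)]

/-- Induction on `t`, each step being one application of `lintegral_bayes`. The policy cancels,
since its kernel does not look at the states; this is why `smooth` does not involve `μ`. -/
lemma smoothAverages (μ : OutputPolicy U Y) (t : ℕ) : S.SmoothAverages μ t := by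
  induction t with
  | zero =>
    intro F hF
    have hF' : Measurable fun ω : Traj X U Y 0 => ∫⁻ x, F (x, ω.2) ∂S.smooth 0 ω.2 :=
      Measurable.lintegral_kernel_prod_right' (κ := (S.smooth 0).comap
        (Prod.snd : Traj X U Y 0 → _) measurable_snd)
        (f := fun p : Traj X U Y 0 × (Fin 1 → X) => F (p.2, p.1.2)) (by fun_prop)
    rw [S.lintegral_law_zero μ hF, S.lintegral_law_zero μ hF',
      lintegral_bayes S.lawX0 S.lamY S.obsK0 S.obsDens0 S.measurable_obsDens0 S.obsK0_apply
        (fun x y => F (fun _ => x, fun _ => y, Fin.elim0)) (hF.comp (by fun_prop))]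
    refine lintegral_congr fun x => lintegral_congr fun y => ?_
    rw [smooth_zero_apply, lintegral_map (by fun_prop) (by fun_prop)]
    rfl
  | succ t ih =>
    -- For a fixed history and control, the new trajectory is a predicted path (the prior) followed
    -- by a measurement, as Bayes' rule requires.
    have key : ∀ G : Traj X U Y (t + 1) → ℝ≥0∞, Measurable G →
        ∫⁻ ω, G ω ∂S.law μ (t + 1)
          = ∫⁻ ω, ∫⁻ u, ∫⁻ x, ∫⁻ y, G (x, Fin.snoc ω.2.1 y, Fin.snoc ω.2.2 u)
            ∂S.obsK t (x (Fin.last (t + 1)), u) ∂S.pathPredK t (S.smooth t) (ω.2, u)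
            ∂μ.ker t ω.2 ∂S.law μ t := by
      intro G hG
      rw [S.lintegral_law_succ_of_smoothAverages ih hG]
      refine lintegral_congr fun ω => lintegral_congr fun u => ?_
      have hm : Measurable fun x : Fin (t + 2) → X =>
          ∫⁻ y, G (x, Fin.snoc ω.2.1 y, Fin.snoc ω.2.2 u)
            ∂S.obsK t (x (Fin.last (t + 1)), u) := by
        refine Measurable.lintegral_kernel_prod_right' (κ := (S.obsK t).comap
          (fun x : Fin (t + 2) → X => (x (Fin.last (t + 1)), u)) (by fun_prop))
          (f := fun p : (Fin (t + 2) → X) × Y =>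
            G (p.1, Fin.snoc ω.2.1 p.2, Fin.snoc ω.2.2 u)) (hG.comp ?_)
        exact measurable_fst.prodMk (((measurable_snoc (t + 1)).comp
          (by fun_prop : Measurable fun p : (Fin (t + 2) → X) × Y => (ω.2.1, p.2))).prodMk
            measurable_const)
      rw [S.lintegral_pathPredK t _ _ hm]
      simp only [Fin.snoc_last]
      rfl
    intro F hF
    have hF' : Measurable fun ω : Traj X U Y (t + 1) =>
        ∫⁻ x, F (x, ω.2) ∂S.smooth (t + 1) ω.2 :=
      Measurable.lintegral_kernel_prod_right' (κ := (S.smooth (t + 1)).comap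
        (Prod.snd : Traj X U Y (t + 1) → _) measurable_snd)
        (f := fun p : Traj X U Y (t + 1) × (Fin (t + 2) → X) => F (p.2, p.1.2)) (by fun_prop)
    rw [key F hF, key _ hF']
    refine lintegral_congr fun ω => lintegral_congr fun u => ?_
    have hO : ∀ x : Fin (t + 2) → X, (S.obsK t).comap
        (fun x : Fin (t + 2) → X => (x (Fin.last (t + 1)), u)) (by fun_prop) x
        = S.lamY.withDensity (S.obsDens t (x (Fin.last (t + 1))) u) := fun x => by
      rw [Kernel.comap_apply, obsK_apply]
    have hFm : Measurable fun p : (Fin (t + 2) → X) × Y =>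
        F (p.1, Fin.snoc ω.2.1 p.2, Fin.snoc ω.2.2 u) :=
      hF.comp (measurable_fst.prodMk (((measurable_snoc (t + 1)).comp
          (by fun_prop : Measurable fun p : (Fin (t + 2) → X) × Y => (ω.2.1, p.2))).prodMk
            measurable_const))
    have := lintegral_bayes (S.pathPredK t (S.smooth t) (ω.2, u)) S.lamY _
      (fun x y => S.obsDens t (x (Fin.last (t + 1))) u y)
      ((S.measurable_obsDens t).comp
        (by fun_prop : Measurable fun p : (Fin (t + 2) → X) × Y =>
          ((p.1 (Fin.last (t + 1)), u), p.2))) hO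
      (fun x y => F (x, Fin.snoc ω.2.1 y, Fin.snoc ω.2.2 u)) hFm
    refine this.trans ?_
    refine lintegral_congr fun x => lintegral_congr fun y => ?_
    rw [smooth_succ_apply]
    simp only [Fin.init_snoc, Fin.snoc_last]

lemma map_swap_law (μ : OutputPolicy U Y) (t : ℕ) :
    (S.law μ t).map (fun ω => (ω.2, ω.1)) = ((S.law μ t).map Prod.snd) ⊗ₘ S.smooth t := by
  refine map_prodMk_eq_compProd_of_lintegral measurable_fst measurable_snd _ fun F hF => ?_
  exact S.smoothAverages μ t (fun ω => F (ω.2, ω.1)) (by fun_prop)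

lemma lintegral_law_last (μ : OutputPolicy U Y) (t : ℕ) {F : ObsHist U Y t × X → ℝ≥0∞}
    (hF : Measurable F) :
    ∫⁻ ω, F (ω.2, ω.1 (Fin.last t)) ∂S.law μ t
      = ∫⁻ ω, ∫⁻ x, F (ω.2, x) ∂(S.filter t ω.2).1 ∂S.law μ t := by
  rw [S.smoothAverages μ t (fun ω => F (ω.2, ω.1 (Fin.last t))) (by fun_prop)]
  refine lintegral_congr fun ω => ?_
  rw [← map_last_smooth, lintegral_map (by fun_prop) (by fun_prop)]

lemma map_last_law (μ : OutputPolicy U Y) (t : ℕ) :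
    (S.law μ t).map (fun ω => (ω.2, ω.1 (Fin.last t)))
      = ((S.law μ t).map Prod.snd) ⊗ₘ S.filterK t :=
  map_prodMk_eq_compProd_of_lintegral (by fun_prop) measurable_snd _ fun _ hF =>
    S.lintegral_law_last μ t hF

/-- The information state is the conditional law of the state. -/
lemma condDistrib_last_ae_eq_filter [StandardBorelSpace X] [Nonempty X] (μ : OutputPolicy U Y)
    (t : ℕ) :
    ∀ᵐ h ∂((S.law μ t).map Prod.snd),
      condDistrib (fun ω : Traj X U Y t => ω.1 (Fin.last t)) (fun ω => ω.2) (S.law μ t) h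
        = (S.filter t h).1 :=
  condDistrib_ae_eq_of_measure_eq_compProd (Prod.snd : Traj X U Y t → _)
    (by fun_prop : Measurable fun ω : Traj X U Y t => ω.1 (Fin.last t)).aemeasurable
    (S.map_last_law μ t)

/-! ### One step of the system -/

/-- The joint law of `((X_t, X_{t+1}), Y_{t+1})` given `(π_t, u_t)`. -/
def oneStepK (t : ℕ) : Kernel (S.Info × U) ((X × X) × Y) :=
  S.jointK t ⊗ₖ (S.obsK t).comap (fun q : (S.Info × U) × (X × X) => (q.2.2, q.1.2))
    (by fun_prop)

instance (t : ℕ) : IsMarkovKernel (S.oneStepK t) := by unfold oneStepK; infer_instance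

lemma stateObsK_eq_map (t : ℕ) : S.stateObsK t = (S.oneStepK t).map (fun q => (q.1.1, q.2)) := rfl

lemma lintegral_oneStepK (t : ℕ) (p : S.Info × U) {F : (X × X) × Y → ℝ≥0∞} (hF : Measurable F) :
    ∫⁻ q, F q ∂S.oneStepK t p
      = ∫⁻ x, ∫⁻ x', ∫⁻ y, F ((x, x'), y) ∂S.obsK t (x', p.2) ∂S.transK t (x, p.2) ∂p.1.1 := by
  have hm : Measurable fun q : X × X => ∫⁻ y, F (q, y) ∂S.obsK t (q.2, p.2) :=
    Measurable.lintegral_kernel_prod_right' (κ := (S.obsK t).comap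
      (fun q : X × X => (q.2, p.2)) (by fun_prop)) hF
  rw [oneStepK, Kernel.lintegral_compProd _ _ _ hF]
  simp only [Kernel.comap_apply]
  rw [jointK, Kernel.lintegral_compProd _ _ _ hm]
  rfl

/-- The law of `((Y^t, U^{t-1}), U_t)`. -/
def histCtrlLaw (μ : OutputPolicy U Y) (t : ℕ) : Measure (ObsHist U Y t × U) :=
  ((S.law μ t).map Prod.snd) ⊗ₘ μ.ker t

instance (μ : OutputPolicy U Y) (t : ℕ) : IsProbabilityMeasure ((S.law μ t).map Prod.snd) :=
  Measure.isProbabilityMeasure_map measurable_snd.aemeasurable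

instance (μ : OutputPolicy U Y) (t : ℕ) : IsProbabilityMeasure (S.histCtrlLaw μ t) := by
  unfold histCtrlLaw; infer_instance

lemma lintegral_histCtrlLaw (μ : OutputPolicy U Y) (t : ℕ) {F : ObsHist U Y t × U → ℝ≥0∞}
    (hF : Measurable F) :
    ∫⁻ p, F p ∂S.histCtrlLaw μ t = ∫⁻ ω, ∫⁻ u, F (ω.2, u) ∂μ.ker t ω.2 ∂S.law μ t := by
  rw [histCtrlLaw, Measure.lintegral_compProd hF,
    lintegral_map (Measurable.lintegral_kernel_prod_right' hF) measurable_snd]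

/-- The last step `(((y^t, u^{t-1}), u_t), ((x_t, x_{t+1}), y_{t+1}))` of a trajectory. -/
def lastStep (t : ℕ) (ω : Traj X U Y (t + 1)) : (ObsHist U Y t × U) × ((X × X) × Y) :=
  (((Fin.init ω.2.1, Fin.init ω.2.2), ω.2.2 (Fin.last t)),
    ((ω.1 (Fin.last t).castSucc, ω.1 (Fin.last (t + 1))), ω.2.1 (Fin.last (t + 1))))

lemma measurable_lastStep (t : ℕ) : Measurable (lastStep (X := X) (U := U) (Y := Y) t) := by
  unfold lastStep Fin.init; fun_prop

lemma lastStep_extend {X U Y : Type*} (t : ℕ) (ω : Traj X U Y t) (u : U) (x : X) (y : Y) :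
    lastStep t (extend X U Y t (ω, (u, x, y)))
      = ((ω.2, u), ((ω.1 (Fin.last t), x), y)) := by
  simp only [lastStep, extend, Fin.init_snoc, Fin.snoc_last, Fin.snoc_castSucc]

/-- The one-step kernel as a function of the history. -/
def histStepK (t : ℕ) : Kernel (ObsHist U Y t × U) ((X × X) × Y) :=
  (S.oneStepK t).comap (fun p => (S.filter t p.1, p.2))
    (((S.measurable_filter t).comp measurable_fst).prodMk measurable_snd)

instance (t : ℕ) : IsMarkovKernel (S.histStepK t) := by unfold histStepK; infer_instance

/-- The information state is sufficient for prediction: given the history and `U_t`, the next step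
depends on the history only through the filter output. -/
lemma map_lastStep_law (μ : OutputPolicy U Y) (t : ℕ) :
    (S.law μ (t + 1)).map (lastStep t) = S.histCtrlLaw μ t ⊗ₘ S.histStepK t := by
  refine Measure.ext_of_lintegral _ fun F hF => ?_
  rw [lintegral_map hF (measurable_lastStep t), Measure.lintegral_compProd hF,
    S.lintegral_histCtrlLaw μ t (Measurable.lintegral_kernel_prod_right' hF),
    S.lintegral_law_succ_of_smoothAverages (S.smoothAverages μ t)
      (hF.fun_comp (measurable_lastStep t))]
  refine lintegral_congr fun ω => lintegral_congr fun u => ?_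
  simp only [lastStep_extend]
  have e := S.lintegral_oneStepK t (S.filter t ω.2, u) (F := fun q => F ((ω.2, u), q))
    (by fun_prop)
  change _ = ∫⁻ q, F ((ω.2, u), q) ∂S.oneStepK t (S.filter t ω.2, u)
  rw [e]
  have hm : Measurable fun x : X =>
      ∫⁻ x', ∫⁻ y, F ((ω.2, u), ((x, x'), y)) ∂S.obsK t (x', u) ∂S.transK t (x, u) := by
    have h1 : Measurable fun p : X × X =>
        ∫⁻ y, F ((ω.2, u), (p, y)) ∂S.obsK t (p.2, u) :=
      Measurable.lintegral_kernel_prod_right' (κ := (S.obsK t).comap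
        (fun p : X × X => (p.2, u)) (by fun_prop))
        (f := fun q : (X × X) × Y => F ((ω.2, u), q)) (by fun_prop)
    exact Measurable.lintegral_kernel_prod_right' (κ := (S.transK t).comap
        (fun x : X => (x, u)) (by fun_prop)) h1
  -- The integrand sees only the last state of the path, so the smoother may be replaced by its
  -- marginal, the filter.
  rw [← map_last_smooth, lintegral_map hm (by fun_prop)]

end System

end

end SmoothingAverse

namespace SmoothingAverse

noncomputable section

/-- Integration over product space, one coordinate at a time. -/
lemma lintegral_pi_snoc {A : Type*} [MeasurableSpace A] (lam : Measure A) [SigmaFinite lam] (n : ℕ)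
    {F : (Fin (n + 1) → A) → ℝ≥0∞} (hF : Measurable F) :
    ∫⁻ x, F x ∂(Measure.pi fun _ : Fin (n + 1) => lam)
      = ∫⁻ x, ∫⁻ a, F (Fin.snoc x a) ∂lam ∂(Measure.pi fun _ : Fin n => lam) := by
  have h := (measurePreserving_piFinSuccAbove (fun _ : Fin (n + 1) => lam) (Fin.last n)).symm
  rw [← h.lintegral_comp hF, lintegral_prod_symm' _ (hF.fun_comp h.measurable)]
  refine lintegral_congr fun x => lintegral_congr fun a => ?_
  congr 1
  exact Fin.insertNth_last' a x

lemma lintegral_pi_one {A : Type*} [MeasurableSpace A] (lam : Measure A) [SigmaFinite lam]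
    {F : (Fin 1 → A) → ℝ≥0∞} (hF : Measurable F) :
    ∫⁻ x, F x ∂(Measure.pi fun _ : Fin 1 => lam) = ∫⁻ a, F (fun _ => a) ∂lam := by
  rw [lintegral_pi_snoc lam 0 hF, Measure.pi_of_empty,
    lintegral_dirac' _ Subsingleton.measurable]
  refine lintegral_congr fun a => ?_
  congr 1

variable {X U Y W V : Type*} [MeasurableSpace X] [MeasurableSpace U] [MeasurableSpace Y]
  [MeasurableSpace W] [MeasurableSpace V]

namespace System

variable (S : System X U Y W V)

/-! ### Densities of the predictor, the filter and the smoother -/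

/-- The density of the predicted law. -/
def predDens (t : ℕ) (p : S.Info × U) (x' : X) : ℝ≥0∞ := ∫⁻ x, S.transDens t x p.2 x' ∂p.1.1

lemma measurable_predDens (t : ℕ) : Measurable (Function.uncurry (S.predDens t)) :=
  Measurable.lintegral_kernel_prod_right' (κ := S.stateK.comap
    (Prod.fst : (S.Info × U) × X → _) measurable_fst)
    (f := fun q : ((S.Info × U) × X) × X => S.transDens t q.2 q.1.1.2 q.1.2)
    ((S.measurable_transDens t).comp (by fun_prop : Measurable
      fun q : ((S.Info × U) × X) × X => ((q.2, q.1.1.2), q.1.2)))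

lemma predK_eq_withDensity (t : ℕ) (p : S.Info × U) :
    S.predK t p = S.lamX.withDensity (S.predDens t p) := by
  have hT : Measurable fun q : X × X => S.transDens t q.1 p.2 q.2 :=
    (S.measurable_transDens t).comp (by fun_prop : Measurable
      fun q : X × X => ((q.1, p.2), q.2))
  refine Measure.ext_of_lintegral _ fun F hF => ?_
  rw [lintegral_predK S t p hF,
    lintegral_withDensity_eq_lintegral_mul _ (S.measurable_predDens t).of_uncurry_left hF]
  have : ∀ x, ∫⁻ x', F x' ∂S.transK t (x, p.2)
      = ∫⁻ x', S.transDens t x p.2 x' * F x' ∂S.lamX := fun x => by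
    rw [transK_apply, lintegral_withDensity_eq_lintegral_mul _
      (hT.fun_comp (by fun_prop : Measurable fun x' : X => (x, x'))) hF]
    rfl
  simp only [this]
  rw [lintegral_lintegral_swap (by fun_prop)]
  refine lintegral_congr fun x' => ?_
  rw [lintegral_mul_const _ (by fun_prop)]
  rfl

/-- The weight with which the measurement multiplies the predicted density. -/
def stepWeight (t : ℕ) (p : S.Info × U) (y : Y) (x' : X) : ℝ≥0∞ :=
  bayesWeight (S.predK t p) (fun x => S.obsDens t x p.2 y) x'

lemma measurable_stepWeight (t : ℕ) :
    Measurable (fun q : ((S.Info × U) × Y) × X => S.stepWeight t q.1.1 q.1.2 q.2) :=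
  measurable_bayesWeight (S.predK t) (fun q : (S.Info × U) × Y => q.1) measurable_fst
    (fun q x => S.obsDens t x q.1.2 q.2) ((S.measurable_obsDens t).comp
      (by fun_prop : Measurable fun r : ((S.Info × U) × Y) × X => ((r.2, r.1.1.2), r.1.2)))

/-- The density of the filter after one step. -/
def filtDens (t : ℕ) (p : S.Info × U) (y : Y) (x' : X) : ℝ≥0∞ :=
  S.predDens t p x' * S.stepWeight t p y x'

lemma measurable_filtDens (t : ℕ) :
    Measurable (fun q : ((S.Info × U) × Y) × X => S.filtDens t q.1.1 q.1.2 q.2) :=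
  ((S.measurable_predDens t).comp (by fun_prop : Measurable
    fun q : ((S.Info × U) × Y) × X => (q.1.1, q.2))).mul (S.measurable_stepWeight t)

lemma filterStep_eq_withDensity (t : ℕ) (p : S.Info × U) (y : Y) :
    (S.filterStep t p.1 p.2 y).1 = S.lamX.withDensity (S.filtDens t p y) := by
  have h1 : Measurable (S.stepWeight t p y) := (S.measurable_stepWeight t).comp
    (by fun_prop : Measurable fun x : X => ((p, y), x))
  change bayes (S.predK t p) (fun x => S.obsDens t x p.2 y) = _
  -- Replacing `predK` by its density also changes the prior inside the Bayes weight; the last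
  -- rewrite restores it there.
  rw [bayes_eq_withDensity _ _ ((S.measurable_obsDens t).fun_comp
      (by fun_prop : Measurable fun x : X => ((x, p.2), y))), predK_eq_withDensity,
    ← withDensity_mul _ (S.measurable_predDens t).of_uncurry_left
      (by rw [← predK_eq_withDensity]; exact h1), ← predK_eq_withDensity]
  rfl

/-- The density of the initial information state. -/
def initDens (y : Y) (x : X) : ℝ≥0∞ :=
  S.lawX0.rnDeriv S.lamX x * bayesWeight S.lawX0 (fun x => S.obsDens0 x y) x

lemma measurable_initDens : Measurable (Function.uncurry S.initDens) :=
  ((Measure.measurable_rnDeriv _ _).comp measurable_snd).mul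
    (measurable_bayesWeight (Kernel.const Unit S.lawX0) (fun _ : Y => ()) measurable_const
      (fun y x => S.obsDens0 x y) (S.measurable_obsDens0.comp measurable_swap))

lemma filterInit_eq_withDensity (y : Y) :
    (S.filterInit y).1 = S.lamX.withDensity (S.initDens y) := by
  have h1 : Measurable (bayesWeight S.lawX0 (fun x => S.obsDens0 x y)) :=
    (measurable_bayesWeight (Kernel.const Unit S.lawX0) (fun _ : Y => ()) measurable_const
      (fun y x => S.obsDens0 x y) (S.measurable_obsDens0.comp measurable_swap)).comp
      (by fun_prop : Measurable fun x : X => (y, x))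
  change bayes S.lawX0 (fun x => S.obsDens0 x y) = _
  rw [bayes_eq_withDensity _ _ (S.measurable_obsDens0.fun_comp
      (by fun_prop : Measurable fun x : X => (x, y)))]
  conv_lhs => rw [← Measure.withDensity_rnDeriv_eq _ _ S.lawX0_ac]
  rw [← withDensity_mul _ (Measure.measurable_rnDeriv _ _)
    (by rw [Measure.withDensity_rnDeriv_eq _ _ S.lawX0_ac]; exact h1),
    Measure.withDensity_rnDeriv_eq _ _ S.lawX0_ac]
  rfl

/-- The density of the smoother. -/
def smoothDens : (t : ℕ) → ObsHist U Y t → (Fin (t + 1) → X) → ℝ≥0∞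
  | 0, h, x => S.initDens (h.1 0) (x 0)
  | t + 1, h, x => smoothDens t (Fin.init h.1, Fin.init h.2) (Fin.init x) *
      S.transDens t (x (Fin.last t).castSucc) (h.2 (Fin.last t)) (x (Fin.last (t + 1))) *
      S.stepWeight t (S.filter t (Fin.init h.1, Fin.init h.2), h.2 (Fin.last t))
        (h.1 (Fin.last (t + 1))) (x (Fin.last (t + 1)))

lemma measurable_histInit (t : ℕ) : Measurable (fun h : ObsHist U Y (t + 1) =>
    ((Fin.init h.1, Fin.init h.2) : ObsHist U Y t)) := by
  unfold Fin.init; fun_prop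

lemma measurable_histCtrl (t : ℕ) : Measurable (fun h : ObsHist U Y (t + 1) =>
    ((S.filter t (Fin.init h.1, Fin.init h.2), h.2 (Fin.last t)) : S.Info × U)) :=
  ((S.measurable_filter t).comp (measurable_histInit t)).prodMk (by fun_prop)

lemma measurable_smoothDens (t : ℕ) :
    Measurable (Function.uncurry (S.smoothDens (U := U) t)) := by
  induction t with
  | zero =>
    exact S.measurable_initDens.comp
      (by fun_prop : Measurable fun p : ObsHist U Y 0 × (Fin 1 → X) => (p.1.1 0, p.2 0))
  | succ t ih =>
    refine ((ih.comp (((measurable_histInit t).comp measurable_fst).prodMk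
      ((measurable_init (t + 1)).comp measurable_snd))).mul
      ((S.measurable_transDens t).comp (by fun_prop : Measurable
        fun p : ObsHist U Y (t + 1) × (Fin (t + 2) → X) =>
          ((p.2 (Fin.last t).castSucc, p.1.2 (Fin.last t)), p.2 (Fin.last (t + 1)))))).mul ?_
    exact (S.measurable_stepWeight t).comp
      ((((S.measurable_histCtrl t).comp measurable_fst).prodMk (by fun_prop)).prodMk
        (by fun_prop : Measurable fun p : ObsHist U Y (t + 1) × (Fin (t + 2) → X) =>
          p.2 (Fin.last (t + 1))))

/-- The factorisation behind the chain rule: relative to product measure, each step contributes a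
transition density and the very Bayes weight that updates the filter. -/
lemma smooth_eq_withDensity (t : ℕ) (h : ObsHist U Y t) :
    S.smooth t h = (Measure.pi fun _ : Fin (t + 1) => S.lamX).withDensity (S.smoothDens t h) := by
  induction t with
  | zero =>
    have hD : Measurable (S.smoothDens 0 h) := (S.measurable_smoothDens 0).of_uncurry_left
    refine Measure.ext_of_lintegral _ fun F hF => ?_
    rw [smooth_zero_apply, lintegral_map hF (by fun_prop),
      lintegral_withDensity_eq_lintegral_mul _ hD hF, lintegral_pi_one _ (hD.mul hF)]
    change ∫⁻ x, F (fun _ => x) ∂(S.filterInit (h.1 0)).1 = _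
    rw [filterInit_eq_withDensity, lintegral_withDensity_eq_lintegral_mul _
      S.measurable_initDens.of_uncurry_left (by fun_prop)]
    rfl
  | succ t ih =>
    set h₀ : ObsHist U Y t := (Fin.init h.1, Fin.init h.2) with hh₀
    set u := h.2 (Fin.last t) with hu
    have hD : Measurable (S.smoothDens t h₀) := (S.measurable_smoothDens t).of_uncurry_left
    have hT : Measurable fun z : Fin (t + 2) → X =>
        S.transDens t (z (Fin.last t).castSucc) u (z (Fin.last (t + 1))) :=
      (S.measurable_transDens t).comp (by fun_prop : Measurable fun z : Fin (t + 2) → X =>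
        ((z (Fin.last t).castSucc, u), z (Fin.last (t + 1))))
    have hDT : Measurable fun z : Fin (t + 2) → X => S.smoothDens t h₀ (Fin.init z) *
        S.transDens t (z (Fin.last t).castSucc) u (z (Fin.last (t + 1))) :=
      (hD.comp (measurable_init (t + 1))).mul hT
    -- Before the measurement, the path density is the old smoother density times the transition
    -- density: Tonelli with the last coordinate split off.
    have hpred : S.pathPredK t (S.smooth t) (h₀, u)
        = (Measure.pi fun _ : Fin (t + 2) => S.lamX).withDensity fun z =>
          S.smoothDens t h₀ (Fin.init z) *
            S.transDens t (z (Fin.last t).castSucc) u (z (Fin.last (t + 1))) := by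
      refine Measure.ext_of_lintegral _ fun F hF => ?_
      have hFs : ∀ x : Fin (t + 1) → X, Measurable fun x' : X =>
          F (Fin.snoc x x' : Fin (t + 2) → X) := fun x =>
        hF.comp ((measurable_snoc (t + 1)).comp (by fun_prop : Measurable fun x' : X => (x, x')))
      have hTs : Measurable fun q : (Fin (t + 1) → X) × X =>
          S.transDens t (q.1 (Fin.last t)) u q.2 :=
        (S.measurable_transDens t).comp (by fun_prop : Measurable
          fun q : (Fin (t + 1) → X) × X => ((q.1 (Fin.last t), u), q.2))
      have hTs' : ∀ x : Fin (t + 1) → X, Measurable (S.transDens t (x (Fin.last t)) u) := fun x =>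
        hTs.comp (by fun_prop : Measurable fun x' : X => (x, x'))
      have hFsn : Measurable fun q : (Fin (t + 1) → X) × X =>
          F (Fin.snoc q.1 q.2 : Fin (t + 2) → X) := hF.comp (measurable_snoc (t + 1))
      rw [S.lintegral_pathPredK t _ _ hF, ih,
        lintegral_withDensity_eq_lintegral_mul _ hDT hF, lintegral_pi_snoc _ _ (hDT.mul hF)]
      have e : ∀ x : Fin (t + 1) → X,
          ∫⁻ x', F (Fin.snoc x x') ∂S.transK t (x (Fin.last t), u)
            = ∫⁻ x', S.transDens t (x (Fin.last t)) u x' * F (Fin.snoc x x') ∂S.lamX := fun x => by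
        rw [transK_apply, lintegral_withDensity_eq_lintegral_mul _ (hTs' x) (hFs x)]
        rfl
      simp only [e]
      rw [lintegral_withDensity_eq_lintegral_mul _ hD
        (Measurable.lintegral_prod_right' (f := fun q : (Fin (t + 1) → X) × X =>
          S.transDens t (q.1 (Fin.last t)) u q.2 * F (Fin.snoc q.1 q.2)) (hTs.mul hFsn))]
      refine lintegral_congr fun x => ?_
      simp only [Pi.mul_apply, Fin.init_snoc, Fin.snoc_castSucc, Fin.snoc_last]
      simp only [mul_assoc]
      exact (lintegral_const_mul _ ((hTs' x).mul (hFs x))).symm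
    have hobs : Measurable fun x : X => S.obsDens t x u (h.1 (Fin.last (t + 1))) :=
      (S.measurable_obsDens t).comp
        (by fun_prop : Measurable fun x : X => ((x, u), h.1 (Fin.last (t + 1))))
    rw [smooth_succ_apply, bayes_eq_withDensity _ _ (hobs.fun_comp (by fun_prop :
      Measurable fun x : Fin (t + 2) → X => x (Fin.last (t + 1)))), ← hh₀, ← hu]
    -- The Bayes weight of the whole path equals that of the predicted state, since the predicted
    -- path has the predictor as its last marginal.
    have hw : bayesWeight (S.pathPredK t (S.smooth t) (h₀, u))
        (fun x => S.obsDens t (x (Fin.last (t + 1))) u (h.1 (Fin.last (t + 1))))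
        = fun z => S.stepWeight t (S.filter t h₀, u) (h.1 (Fin.last (t + 1)))
          (z (Fin.last (t + 1))) := by
      funext z
      have := bayesWeight_map (S.pathPredK t (S.smooth t) (h₀, u))
        (fun z => z (Fin.last (t + 1))) (by fun_prop) _ hobs z
      rw [this, S.map_last_pathPredK t (S.smooth t) _ _ (S.map_last_smooth t h₀)]
      rfl
    have hwm : Measurable fun z : Fin (t + 2) → X =>
        S.stepWeight t (S.filter t h₀, u) (h.1 (Fin.last (t + 1))) (z (Fin.last (t + 1))) :=
      (S.measurable_stepWeight t).comp (by fun_prop : Measurable fun z : Fin (t + 2) → X =>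
        (((S.filter t h₀, u), h.1 (Fin.last (t + 1))), z (Fin.last (t + 1))))
    rw [hw, hpred, ← withDensity_mul _ hDT hwm]
    rfl

end System

end

end SmoothingAverse

/-! ### The stage reward as a conditional expectation of log density increments and costs. -/

namespace SmoothingAverse

noncomputable section

variable {X U Y W V : Type*} [MeasurableSpace X] [MeasurableSpace U] [MeasurableSpace Y]
  [MeasurableSpace W] [MeasurableSpace V]

lemma integral_sub_add_sub {A : Type*} [MeasurableSpace A] {κ : Measure A} {a b c d : A → ℝ}
    (ha : Integrable a κ) (hb : Integrable b κ) (hc : Integrable c κ) (hd : Integrable d κ) :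
    Integrable (fun x => a x - b x + c x - d x) κ ∧
      ∫ x, (a x - b x + c x - d x) ∂κ = ∫ x, a x ∂κ - ∫ x, b x ∂κ + ∫ x, c x ∂κ - ∫ x, d x ∂κ := by
  have h1 : Integrable (fun x => a x - b x) κ := ha.sub hb
  have h2 : Integrable (fun x => a x - b x + c x) κ := h1.add hc
  exact ⟨h2.sub hd, by rw [integral_sub h2 hd, integral_add h1 hc, integral_sub ha hb]⟩

namespace System

variable (S : System X U Y W V)

/-! ### Conditional laws within one step -/

lemma lintegral_oneStepK_obs (t : ℕ) (p : S.Info × U) {F : X × Y → ℝ≥0∞} (hF : Measurable F) :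
    ∫⁻ q, F (q.1.2, q.2) ∂S.oneStepK t p
      = ∫⁻ x', ∫⁻ y, F (x', y) ∂S.obsK t (x', p.2) ∂S.predK t p := by
  rw [lintegral_oneStepK S t p (F := fun q => F (q.1.2, q.2)) (by fun_prop),
    S.lintegral_predK t p]
  exact Measurable.lintegral_kernel_prod_right' (κ := (S.obsK t).comap
    (fun x : X => (x, p.2)) (by fun_prop)) hF

lemma lintegral_oneStepK_pred (t : ℕ) (p : S.Info × U) {F : X → ℝ≥0∞} (hF : Measurable F) :
    ∫⁻ q, F q.1.2 ∂S.oneStepK t p = ∫⁻ x', F x' ∂S.predK t p := by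
  rw [S.lintegral_oneStepK_obs t p (F := fun q => F q.1) (by fun_prop)]
  simp

lemma lintegral_oneStepK_trans (t : ℕ) (p : S.Info × U) {F : X × X → ℝ≥0∞} (hF : Measurable F) :
    ∫⁻ q, F q.1 ∂S.oneStepK t p = ∫⁻ x, ∫⁻ x', F (x, x') ∂S.transK t (x, p.2) ∂p.1.1 := by
  rw [lintegral_oneStepK S t p (F := fun q => F q.1) (by fun_prop)]
  simp

lemma lintegral_oneStepK_state (t : ℕ) (p : S.Info × U) {F : X → ℝ≥0∞} (hF : Measurable F) :
    ∫⁻ q, F q.1.1 ∂S.oneStepK t p = ∫⁻ x, F x ∂p.1.1 := by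
  rw [S.lintegral_oneStepK_trans t p (F := fun q => F q.1) (by fun_prop)]
  simp

/-- Averaging over the predicted law first. -/
lemma lintegral_oneStepK_pred_avg (t : ℕ) (p : S.Info × U) {F : X → ℝ≥0∞} (hF : Measurable F) :
    ∫⁻ q, F q.1.2 ∂S.oneStepK t p = ∫⁻ _q, ∫⁻ x, F x ∂S.predK t p ∂S.oneStepK t p := by
  rw [S.lintegral_oneStepK_pred t p hF, lintegral_const, measure_univ, mul_one]

/-- Averaging over the transition kernel first. -/
lemma lintegral_oneStepK_trans_avg (t : ℕ) (p : S.Info × U) {F : X × X → ℝ≥0∞}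
    (hF : Measurable F) :
    ∫⁻ q, F q.1 ∂S.oneStepK t p
      = ∫⁻ q, ∫⁻ x', F (q.1.1, x') ∂S.transK t (q.1.1, p.2) ∂S.oneStepK t p := by
  rw [S.lintegral_oneStepK_trans t p hF, S.lintegral_oneStepK_state t p
    (F := fun x => ∫⁻ x', F (x, x') ∂S.transK t (x, p.2))
    (Measurable.lintegral_kernel_prod_right' (κ := (S.transK t).comap
      (fun x : X => (x, p.2)) (by fun_prop)) hF)]

/-- The filter map as a kernel in the measurement. -/
def stepFilterK (t : ℕ) (p : S.Info × U) : Kernel Y X :=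
  ⟨fun y => (S.filterStep t p.1 p.2 y).1, measurable_subtype_coe.comp
    ((S.measurable_filterStep t).comp (by fun_prop : Measurable fun y : Y => (p, y)))⟩

instance (t : ℕ) (p : S.Info × U) : IsMarkovKernel (S.stepFilterK t p) :=
  ⟨fun y => (S.filterStep t p.1 p.2 y).2.1⟩

/-- Averaging over the filter first. -/
lemma lintegral_oneStepK_filt_avg (t : ℕ) (p : S.Info × U) {F : Y × X → ℝ≥0∞}
    (hF : Measurable F) :
    ∫⁻ q, F (q.2, q.1.2) ∂S.oneStepK t p
      = ∫⁻ q, ∫⁻ x, F (q.2, x) ∂S.stepFilterK t p q.2 ∂S.oneStepK t p := by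
  have hm : Measurable fun y => ∫⁻ x, F (y, x) ∂S.stepFilterK t p y :=
    Measurable.lintegral_kernel_prod_right' (κ := S.stepFilterK t p) hF
  have hO : ∀ x : X, (S.obsK t).comap (fun x : X => (x, p.2)) (by fun_prop) x
        = S.lamY.withDensity (S.obsDens t x p.2) := fun x => by
      rw [Kernel.comap_apply, obsK_apply]
  rw [S.lintegral_oneStepK_obs t p (F := fun q => F (q.2, q.1)) (by fun_prop),
    S.lintegral_oneStepK_obs t p (F := fun q => ∫⁻ x, F (q.2, x) ∂S.stepFilterK t p q.2)
      (hm.comp measurable_snd)]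
  exact lintegral_bayes (S.predK t p) S.lamY _ (fun x y => S.obsDens t x p.2 y)
      ((S.measurable_obsDens t).comp (by fun_prop : Measurable fun q : X × Y =>
          ((q.1, p.2), q.2))) hO (fun x y => F (y, x)) (by fun_prop)

lemma map_obs_oneStepK (t : ℕ) (p : S.Info × U) :
    (S.oneStepK t p).map (fun q => q.2) = S.obsPredK t p := by
  rw [obsPredK, Kernel.snd_apply, stateObsK_eq_map, Kernel.map_apply _ (by fun_prop),
    Measure.map_map (by fun_prop) (by fun_prop)]
  rfl

lemma map_state_oneStepK (t : ℕ) (p : S.Info × U) :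
    (S.oneStepK t p).map (fun q => q.1.1) = p.1.1 :=
  Measure.ext_of_lintegral _ fun F hF => by
    rw [lintegral_map hF (by fun_prop), S.lintegral_oneStepK_state t p hF]

lemma map_pred_oneStepK (t : ℕ) (p : S.Info × U) :
    (S.oneStepK t p).map (fun q => q.1.2) = S.predK t p :=
  Measure.ext_of_lintegral _ fun F hF => by
    rw [lintegral_map hF (by fun_prop), S.lintegral_oneStepK_pred t p hF]

/-- The transition kernel for a given control. -/
def ctrlTransK (t : ℕ) (u : U) : Kernel X X := (S.transK t).comap (fun x => (x, u)) (by fun_prop)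

instance (t : ℕ) (u : U) : IsMarkovKernel (S.ctrlTransK t u) := by
  unfold ctrlTransK; infer_instance

lemma map_filt_oneStepK (t : ℕ) (p : S.Info × U) :
    (S.oneStepK t p).map (fun q => (q.2, q.1.2))
      = ((S.oneStepK t p).map (fun q => q.2)) ⊗ₘ S.stepFilterK t p :=
  map_prodMk_eq_compProd_of_lintegral (by fun_prop) (by fun_prop) _ fun _ hF =>
    S.lintegral_oneStepK_filt_avg t p hF

lemma map_trans_oneStepK (t : ℕ) (p : S.Info × U) :
    (S.oneStepK t p).map (fun q => (q.1.1, q.1.2))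
      = ((S.oneStepK t p).map (fun q => q.1.1)) ⊗ₘ S.ctrlTransK t p.2 :=
  map_prodMk_eq_compProd_of_lintegral (by fun_prop) (by fun_prop) _ fun _ hF =>
    S.lintegral_oneStepK_trans_avg t p hF

/-! ### The stage reward as an average over one step -/

/-- The logarithm of the filter density at `x_{t+1}`. -/
def logFilt (t : ℕ) (r : (S.Info × U) × ((X × X) × Y)) : ℝ :=
  logDens (S.filtDens t r.1 r.2.2 r.2.1.2)

/-- The logarithm of the predicted density at `x_{t+1}`. -/
def logPred (t : ℕ) (r : (S.Info × U) × ((X × X) × Y)) : ℝ :=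
  logDens (S.predDens t r.1 r.2.1.2)

/-- The logarithm of the transition density at `x_{t+1}`. -/
def logTrans (t : ℕ) (r : (S.Info × U) × ((X × X) × Y)) : ℝ :=
  logDens (S.transDens t r.2.1.1 r.1.2 r.2.1.2)

/-- The weighted cost of one step. -/
def stepCost (c : ℕ → X → U → ℝ≥0) (γ : ℝ≥0) (t : ℕ) (r : (S.Info × U) × ((X × X) × Y)) : ℝ :=
  γ * (c t r.2.1.1 r.1.2 : ℝ)

lemma measurable_logFilt (t : ℕ) : Measurable (S.logFilt t) :=
  measurable_logDens.comp ((S.measurable_filtDens t).comp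
    (by fun_prop : Measurable fun r : (S.Info × U) × ((X × X) × Y) => ((r.1, r.2.2), r.2.1.2)))

lemma measurable_logPred (t : ℕ) : Measurable (S.logPred t (Y := Y)) :=
  measurable_logDens.comp ((S.measurable_predDens t).comp
    (by fun_prop : Measurable fun r : (S.Info × U) × ((X × X) × Y) => (r.1, r.2.1.2)))

lemma measurable_logTrans (t : ℕ) : Measurable (S.logTrans t (Y := Y)) :=
  measurable_logDens.comp ((S.measurable_transDens t).comp
    (by fun_prop : Measurable fun r : (S.Info × U) × ((X × X) × Y) =>
      ((r.2.1.1, r.1.2), r.2.1.2)))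

variable {c : ℕ → X → U → ℝ≥0} (hc : ∀ t, Measurable (fun p : X × U => c t p.1 p.2)) (γ : ℝ≥0)

include hc in
lemma measurable_stepCost (t : ℕ) : Measurable (S.stepCost c γ t (Y := Y)) := by
  have : Measurable fun r : (S.Info × U) × ((X × X) × Y) => c t r.2.1.1 r.1.2 :=
    (hc t).comp (by fun_prop : Measurable fun r : (S.Info × U) × ((X × X) × Y) =>
      (r.2.1.1, r.1.2))
  exact this.coe_nnreal_real.const_mul _

variable (c) in
/-- The gain of one step, whose conditional expectation is the stage reward. -/
def stepGain (t : ℕ) (r : (S.Info × U) × ((X × X) × Y)) : ℝ :=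
  S.logPred t r - S.logFilt t r + - S.logTrans t r - S.stepCost c γ t r

variable (c) in
/-- The sum of the absolute values of the terms of `stepGain`. -/
def stepAbs (t : ℕ) (r : (S.Info × U) × ((X × X) × Y)) : ℝ≥0∞ :=
  ‖S.logFilt t r‖ₑ + ‖S.logPred t r‖ₑ + ‖S.logTrans t r‖ₑ + ‖S.stepCost c γ t r‖ₑ

lemma enorm_stepCost (t : ℕ) (r : (S.Info × U) × ((X × X) × Y)) :
    ‖S.stepCost c γ t r‖ₑ = γ * c t r.2.1.1 r.1.2 := by
  unfold stepCost
  rw [enorm_mul, Real.enorm_of_nonneg γ.coe_nonneg, Real.enorm_of_nonneg (c t _ _).coe_nonneg,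
    ENNReal.ofReal_coe_nnreal, ENNReal.ofReal_coe_nnreal]

include hc in
lemma measurable_stepAbs (t : ℕ) : Measurable (S.stepAbs c γ t) :=
  (((S.measurable_logFilt t).enorm.add (S.measurable_logPred t).enorm).add
    (S.measurable_logTrans t).enorm).add (S.measurable_stepCost hc γ t).enorm

include hc in
lemma measurable_stepGain (t : ℕ) : Measurable (S.stepGain c γ t) :=
  (((S.measurable_logPred t).sub (S.measurable_logFilt t)).add
    (S.measurable_logTrans t).neg).sub (S.measurable_stepCost hc γ t)

include hc in
lemma lintegral_stepAbs {κ : Measure ((S.Info × U) × ((X × X) × Y))} (t : ℕ) :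
    ∫⁻ r, S.stepAbs c γ t r ∂κ = ∫⁻ r, ‖S.logFilt t r‖ₑ ∂κ + ∫⁻ r, ‖S.logPred t r‖ₑ ∂κ
      + ∫⁻ r, ‖S.logTrans t r‖ₑ ∂κ + ∫⁻ r, ‖S.stepCost c γ t r‖ₑ ∂κ := by
  unfold stepAbs
  rw [lintegral_add_right _ (S.measurable_stepCost hc γ t).enorm,
    lintegral_add_right _ (S.measurable_logTrans t).enorm,
    lintegral_add_right _ (S.measurable_logPred t).enorm]

/-- The four parts of the one-step gain are integrable if `stepAbs` has a finite integral. -/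
structure StepIntegrable (c : ℕ → X → U → ℝ≥0) (γ : ℝ≥0) (t : ℕ)
    (κ : Measure ((S.Info × U) × ((X × X) × Y))) : Prop where
  filt : Integrable (S.logFilt t) κ
  pred : Integrable (S.logPred t) κ
  trans : Integrable (S.logTrans t) κ
  cost : Integrable (S.stepCost c γ t) κ

include hc in
lemma stepIntegrable_of_lt_top {κ : Measure ((S.Info × U) × ((X × X) × Y))} {t : ℕ}
    (h : ∫⁻ r, S.stepAbs c γ t r ∂κ < ⊤) : S.StepIntegrable c γ t κ := by
  rw [S.lintegral_stepAbs hc, ENNReal.add_lt_top, ENNReal.add_lt_top, ENNReal.add_lt_top] at h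
  exact ⟨⟨(S.measurable_logFilt t).aestronglyMeasurable, h.1.1.1⟩,
    ⟨(S.measurable_logPred t).aestronglyMeasurable, h.1.1.2⟩,
    ⟨(S.measurable_logTrans t).aestronglyMeasurable, h.1.2⟩,
    ⟨(S.measurable_stepCost hc γ t).aestronglyMeasurable, h.2⟩⟩

lemma StepIntegrable.gain {S : System X U Y W V} {γ : ℝ≥0} {t : ℕ}
    {κ : Measure ((S.Info × U) × ((X × X) × Y))}
    (h : S.StepIntegrable c γ t κ) : Integrable (S.stepGain c γ t) κ :=
  (integral_sub_add_sub h.pred h.filt h.trans.neg h.cost).1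

lemma StepIntegrable.integral_gain {S : System X U Y W V} {γ : ℝ≥0} {t : ℕ}
    {κ : Measure ((S.Info × U) × ((X × X) × Y))}
    (h : S.StepIntegrable c γ t κ) : ∫ r, S.stepGain c γ t r ∂κ
      = ∫ r, S.logPred t r ∂κ - ∫ r, S.logFilt t r ∂κ + - ∫ r, S.logTrans t r ∂κ
        - ∫ r, S.stepCost c γ t r ∂κ := by
  rw [← integral_neg]
  exact (integral_sub_add_sub h.pred h.filt h.trans.neg h.cost).2

lemma measurable_filtDens_curry (t : ℕ) (p : S.Info × U) :
    Measurable (Function.uncurry (S.filtDens t p)) :=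
  (S.measurable_filtDens t).comp (by fun_prop : Measurable fun q : Y × X => ((p, q.1), q.2))

lemma measurable_transDens_curry (t : ℕ) (u : U) :
    Measurable (Function.uncurry fun x x' => S.transDens t x u x') :=
  (S.measurable_transDens t).comp (by fun_prop : Measurable fun q : X × X => ((q.1, u), q.2))

include hc in
/-- The absolute reward is the expected sum of the absolute values of the parts of the gain. -/
lemma absReward_eq (t : ℕ) (p : S.Info × U) :
    S.absReward c γ t p.1 p.2 = ∫⁻ q, S.stepAbs c γ t (p, q) ∂S.oneStepK t p := by
  -- A fixed `p` is treated as a random pair concentrated at `p`, so that the splitting into four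
  -- integrals also applies here.
  have e : ∫⁻ q, S.stepAbs c γ t (p, q) ∂S.oneStepK t p
      = ∫⁻ r, S.stepAbs c γ t r ∂((S.oneStepK t p).map (Prod.mk p)) := by
    rw [lintegral_map (S.measurable_stepAbs hc γ t) measurable_prodMk_left]
  rw [e, S.lintegral_stepAbs hc, absReward,
    lintegral_map (S.measurable_logFilt t).enorm measurable_prodMk_left,
    lintegral_map (S.measurable_logPred t).enorm measurable_prodMk_left,
    lintegral_map (S.measurable_logTrans t).enorm measurable_prodMk_left,
    lintegral_map (S.measurable_stepCost hc γ t).enorm measurable_prodMk_left]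
  congr 1
  · congr 1
    · congr 1
      · rw [← map_obs_oneStepK]
        exact lintegral_absEntropy_eq S.lamX (S.oneStepK t p) (by fun_prop) (by fun_prop)
          (S.stepFilterK t p) (S.map_filt_oneStepK t p) (S.filtDens t p)
          (S.measurable_filtDens_curry t p) (S.filterStep_eq_withDensity t p)
      · have hp : Measurable (S.predDens t p) := (S.measurable_predDens t).of_uncurry_left
        -- Once `p` is fixed the predictor has nothing left to condition on, so no disintegration is
        -- needed for this term.
        have : IsFiniteMeasure (S.lamX.withDensity (S.predDens t p)) :=
          S.predK_eq_withDensity t p ▸ inferInstance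
        rw [S.predK_eq_withDensity t p, absEntropy_withDensity S.lamX hp,
          ← S.predK_eq_withDensity, ← S.lintegral_oneStepK_pred t p
          (measurable_logDens.fun_comp hp).enorm]
        rfl
    · have := lintegral_absEntropy_eq S.lamX (S.oneStepK t p) (X := fun q => q.1.2)
          (Z := fun q => q.1.1) (by fun_prop) (by fun_prop)
          (S.ctrlTransK t p.2) (S.map_trans_oneStepK t p) (fun x x' => S.transDens t x p.2 x')
          (S.measurable_transDens_curry t p.2) (fun x => S.transK_apply t (x, p.2))
      rw [map_state_oneStepK] at this
      exact this
  · simp only [enorm_stepCost]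
    rw [S.lintegral_oneStepK_state t p (F := fun x => (γ * c t x p.2 : ℝ≥0∞))]
    have : Measurable fun x => c t x p.2 := (hc t).comp (by fun_prop : Measurable
      fun x : X => (x, p.2))
    exact this.coe_nnreal_ennreal.const_mul _

include hc in
/-- The reward is the expected gain of one step. -/
lemma reward_eq (t : ℕ) (p : S.Info × U) (h : S.absReward c γ t p.1 p.2 < ⊤) :
    S.reward c γ t p.1 p.2 = ∫ q, S.stepGain c γ t (p, q) ∂S.oneStepK t p := by
  set κ := (S.oneStepK t p).map (Prod.mk p) with hκ
  have hmk : AEMeasurable (Prod.mk p : (X × X) × Y → _) (S.oneStepK t p) :=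
    measurable_prodMk_left.aemeasurable
  -- Finiteness of `absReward` makes each term integrable by itself. Without it the Bochner
  -- integrals could be default zeros and would not add up.
  have hint : S.StepIntegrable c γ t κ := by
    refine S.stepIntegrable_of_lt_top hc γ ?_
    rwa [hκ, lintegral_map (S.measurable_stepAbs hc γ t) measurable_prodMk_left,
      ← S.absReward_eq hc]
  have push : ∀ f : (S.Info × U) × ((X × X) × Y) → ℝ, Measurable f →
      ∫ r, f r ∂κ = ∫ q, f (p, q) ∂S.oneStepK t p := fun f hf => by
    rw [hκ, integral_map hmk hf.aestronglyMeasurable]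
  have pull : ∀ {f : (S.Info × U) × ((X × X) × Y) → ℝ}, Integrable f κ →
      Integrable (fun q => f (p, q)) (S.oneStepK t p) := fun hf => hf.comp_aemeasurable hmk
  rw [← push _ (S.measurable_stepGain hc γ t), hint.integral_gain,
    push _ (S.measurable_logFilt t), push _ (S.measurable_logPred t),
    push _ (S.measurable_logTrans t), push _ (S.measurable_stepCost hc γ t)]
  obtain ⟨i1, e1⟩ := integral_entropy_eq S.lamX (S.oneStepK t p) (X := fun q => q.1.2)
    (Z := fun q => q.2) (by fun_prop) (by fun_prop)
    (S.stepFilterK t p) (S.map_filt_oneStepK t p) (S.filtDens t p)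
    (S.measurable_filtDens_curry t p) (S.filterStep_eq_withDensity t p) (pull hint.filt)
  obtain ⟨i3, e3⟩ := integral_entropy_eq S.lamX (S.oneStepK t p) (X := fun q => q.1.2)
    (Z := fun q => q.1.1) (by fun_prop) (by fun_prop)
    (S.ctrlTransK t p.2) (S.map_trans_oneStepK t p) (fun x x' => S.transDens t x p.2 x')
    (S.measurable_transDens_curry t p.2) (fun x => S.transK_apply t (x, p.2)) (pull hint.trans)
  have e2 : entropy S.lamX (S.predK t p) = - ∫ q, S.logPred t (p, q) ∂S.oneStepK t p := by
    have hp : Measurable (S.predDens t p) := (S.measurable_predDens t).of_uncurry_left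
    have : IsFiniteMeasure (S.lamX.withDensity (S.predDens t p)) :=
      S.predK_eq_withDensity t p ▸ inferInstance
    rw [S.predK_eq_withDensity t p, entropy_withDensity S.lamX hp, ← S.predK_eq_withDensity,
      ← S.map_pred_oneStepK, integral_map (by fun_prop)
        (measurable_logDens.fun_comp hp).aestronglyMeasurable]
    rfl
  have e3' : ∫ x, entropy S.lamX (S.transK t (x, p.2)) ∂p.1.1
      = - ∫ q, S.logTrans t (p, q) ∂S.oneStepK t p := by
    rw [map_state_oneStepK] at e3
    exact e3
  have i1' : Integrable (fun q : (X × X) × Y => entropy S.lamX (S.filterStep t p.1 p.2 q.2).1)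
      (S.oneStepK t p) := i1.comp_aemeasurable (by fun_prop)
  have e1' : ∫ q, entropy S.lamX (S.filterStep t p.1 p.2 q.2).1 ∂S.oneStepK t p
      = - ∫ q, S.logFilt t (p, q) ∂S.oneStepK t p := by
    rw [integral_map (by fun_prop) i1.aestronglyMeasurable] at e1
    exact e1
  have hm : AEStronglyMeasurable
      (fun q : X × Y => S.rTilde t p.1 p.2 q.2 - γ * (c t q.1 p.2 : ℝ))
      ((S.oneStepK t p).map (fun q => (q.1.1, q.2))) := by
    have h1 : Measurable fun y => entropy S.lamX (S.filterStep t p.1 p.2 y).1 :=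
      measurable_entropy S.lamX _ (S.filtDens t p) (S.measurable_filtDens_curry t p)
        (S.filterStep_eq_withDensity t p)
    have h2 : Measurable fun x => c t x p.2 := (hc t).comp (by fun_prop : Measurable
      fun x : X => (x, p.2))
    have h3 : Measurable fun y => S.rTilde t p.1 p.2 y :=
      (h1.sub measurable_const).add measurable_const
    exact ((h3.comp measurable_snd).sub
      ((h2.comp measurable_fst).coe_nnreal_real.const_mul _)).aestronglyMeasurable
  rw [reward, stateObsK_eq_map, Kernel.map_apply _ (by fun_prop),
    integral_map (by fun_prop) hm]
  unfold rTilde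
  have i4 : Integrable (fun q : (X × X) × Y => γ * (c t q.1.1 p.2 : ℝ)) (S.oneStepK t p) :=
    pull hint.cost
  -- The second and third terms of `rTilde` do not depend on the measurement, so they enter as
  -- constants.
  have := (integral_sub_add_sub i1' (integrable_const (entropy S.lamX (S.predK t p)))
    (integrable_const (∫ x, entropy S.lamX (S.transK t (x, p.2)) ∂p.1.1)) i4).2
  refine this.trans ?_
  rw [e1', integral_const, integral_const, e2, e3']
  simp only [probReal_univ, one_smul, stepCost]
  ring

end System

end

end SmoothingAverse

/-! ### Admissibility and the entropy chain rule in terms of the law of `(π_t, U_t)`. -/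

namespace SmoothingAverse

noncomputable section

variable {X U Y W V : Type*} [MeasurableSpace X] [MeasurableSpace U] [MeasurableSpace Y]
  [MeasurableSpace W] [MeasurableSpace V]

namespace System

variable (S : System X U Y W V)

/-! ### The law of the information state and the control -/

/-- The law of `(π_t, U_t)`. -/
def ctrlLaw (μ : OutputPolicy U Y) (t : ℕ) : Measure (S.Info × U) :=
  (S.histCtrlLaw μ t).map (fun p => (S.filter t p.1, p.2))

lemma measurable_filter_prod (t : ℕ) :
    Measurable (fun p : ObsHist U Y t × U => (S.filter t p.1, p.2)) :=
  ((S.measurable_filter t).comp measurable_fst).prodMk measurable_snd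

instance (μ : OutputPolicy U Y) (t : ℕ) : IsProbabilityMeasure (S.ctrlLaw μ t) :=
  Measure.isProbabilityMeasure_map (S.measurable_filter_prod t).aemeasurable

/-- The last step of a trajectory in terms of the information state. -/
def infoLastStep (t : ℕ) (ω : Traj X U Y (t + 1)) : (S.Info × U) × ((X × X) × Y) :=
  ((S.filter t (Fin.init ω.2.1, Fin.init ω.2.2), ω.2.2 (Fin.last t)),
    ((ω.1 (Fin.last t).castSucc, ω.1 (Fin.last (t + 1))), ω.2.1 (Fin.last (t + 1))))

lemma measurable_infoLastStep (t : ℕ) : Measurable (S.infoLastStep t) :=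
  ((S.measurable_histCtrl t).comp measurable_snd).prodMk
    ((measurable_lastStep t).snd)

lemma lintegral_lastStep (μ : OutputPolicy U Y) (t : ℕ)
    {F : (ObsHist U Y t × U) × ((X × X) × Y) → ℝ≥0∞} (hF : Measurable F) :
    ∫⁻ ω, F (lastStep t ω) ∂S.law μ (t + 1)
      = ∫⁻ p, ∫⁻ q, F (p, q) ∂S.oneStepK t (S.filter t p.1, p.2) ∂S.histCtrlLaw μ t := by
  rw [← lintegral_map hF (measurable_lastStep t), map_lastStep_law,
    Measure.lintegral_compProd hF]
  rfl

/-- The policy enters only through the first factor. Everything that is a function of this last step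
therefore depends on `μ` only through `ctrlLaw`. -/
lemma map_infoLastStep_law (μ : OutputPolicy U Y) (t : ℕ) :
    (S.law μ (t + 1)).map (S.infoLastStep t) = S.ctrlLaw μ t ⊗ₘ S.oneStepK t := by
  refine Measure.ext_of_lintegral _ fun F hF => ?_
  rw [lintegral_map hF (S.measurable_infoLastStep t), Measure.lintegral_compProd hF, ctrlLaw,
    lintegral_map (Measurable.lintegral_kernel_prod_right' hF) (S.measurable_filter_prod t)]
  exact S.lintegral_lastStep μ t (F := fun r => F ((S.filter t r.1.1, r.1.2), r.2))
    (hF.comp (((S.measurable_filter_prod t).comp measurable_fst).prodMk measurable_snd))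

/-- The predicted law as a kernel in `(y^t, u^t)`. -/
def histPredK (t : ℕ) : Kernel ((Fin (t + 1) → Y) × (Fin (t + 1) → U)) X :=
  (S.predK t).comap (fun z => (S.filter t (z.1, Fin.init z.2), z.2 (Fin.last t)))
    (((S.measurable_filter t).comp
      (measurable_fst.prodMk ((measurable_init t).comp measurable_snd))).prodMk (by fun_prop))

instance (t : ℕ) : IsMarkovKernel (S.histPredK t) := by unfold histPredK; infer_instance

/-- The predictor is the conditional law of `X_{t+1}` given `(Y^t, U^t)`. -/
lemma map_pred_law (μ : OutputPolicy U Y) (t : ℕ) :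
    (S.law μ (t + 1)).map
        (fun ω => (((Fin.init ω.2.1 : Fin (t + 1) → Y), ω.2.2), ω.1 (Fin.last (t + 1))))
      = ((S.law μ (t + 1)).map (fun ω => ((Fin.init ω.2.1 : Fin (t + 1) → Y), ω.2.2)))
        ⊗ₘ S.histPredK t := by
  have hz : Measurable fun r : (ObsHist U Y t × U) × ((X × X) × Y) =>
      (r.1.1.1, (Fin.snoc r.1.1.2 r.1.2 : Fin (t + 1) → U)) :=
    measurable_fst.fst.fst.prodMk ((measurable_snoc t).comp
      (measurable_fst.fst.snd.prodMk measurable_fst.snd))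
  refine map_prodMk_eq_compProd_of_lintegral (by fun_prop) (by unfold Fin.init; fun_prop) _
    fun F hF => ?_
  have h1 := S.lintegral_lastStep μ t
    (F := fun r => F ((r.1.1.1, Fin.snoc r.1.1.2 r.1.2), r.2.1.2))
    (hF.comp (hz.prodMk (by fun_prop)))
  have hm : Measurable fun z => ∫⁻ x, F (z, x) ∂S.histPredK t z :=
    Measurable.lintegral_kernel_prod_right' hF
  have h2 := S.lintegral_lastStep μ t
    (F := fun r => ∫⁻ x, F ((r.1.1.1, Fin.snoc r.1.1.2 r.1.2), x)
      ∂S.histPredK t (r.1.1.1, Fin.snoc r.1.1.2 r.1.2))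
    (hm.comp hz)
  -- The conditioning variable contains the whole of `u^t`, whereas `lastStep` splits off `u_t`; the
  -- two pieces are glued together again here.
  simp only [lastStep, Fin.snoc_init_self] at h1 h2
  rw [h1, h2]
  refine lintegral_congr fun p => ?_
  rw [S.lintegral_oneStepK_pred_avg t _
    (F := fun x => F ((p.1.1, Fin.snoc p.1.2 p.2), x)) (by fun_prop)]
  simp only [histPredK, Kernel.comap_apply, Fin.init_snoc, Fin.snoc_last]

/-- The transition kernel as a kernel in `(x_t, y^t, u^t)`. -/
def histTransK (X U Y : Type*) {W V : Type*} [MeasurableSpace X] [MeasurableSpace U]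
    [MeasurableSpace Y] [MeasurableSpace W] [MeasurableSpace V] (S : System X U Y W V) (t : ℕ) :
    Kernel (X × (Fin (t + 1) → Y) × (Fin (t + 1) → U)) X :=
  (S.transK t).comap (fun z => (z.1, z.2.2 (Fin.last t))) (by fun_prop)

instance (t : ℕ) : IsMarkovKernel (histTransK X U Y S t) := by unfold histTransK; infer_instance

/-- The transition kernel is the conditional law of `X_{t+1}` given `(X_t, Y^t, U^t)`. -/
lemma map_trans_law (μ : OutputPolicy U Y) (t : ℕ) :
    (S.law μ (t + 1)).map (fun ω => ((ω.1 (Fin.last t).castSucc,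
        (Fin.init ω.2.1 : Fin (t + 1) → Y), ω.2.2), ω.1 (Fin.last (t + 1))))
      = ((S.law μ (t + 1)).map (fun ω => (ω.1 (Fin.last t).castSucc,
        (Fin.init ω.2.1 : Fin (t + 1) → Y), ω.2.2))) ⊗ₘ histTransK X U Y S t := by
  have hz : Measurable fun r : (ObsHist U Y t × U) × ((X × X) × Y) =>
      (r.2.1.1, r.1.1.1, (Fin.snoc r.1.1.2 r.1.2 : Fin (t + 1) → U)) :=
    measurable_snd.fst.fst.prodMk
      (measurable_fst.fst.fst.prodMk ((measurable_snoc t).comp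
      (measurable_fst.fst.snd.prodMk measurable_fst.snd)))
  refine map_prodMk_eq_compProd_of_lintegral (by fun_prop) (by unfold Fin.init; fun_prop) _
    fun F hF => ?_
  have h1 := S.lintegral_lastStep μ t
    (F := fun r => F ((r.2.1.1, r.1.1.1, Fin.snoc r.1.1.2 r.1.2), r.2.1.2))
    (hF.comp (hz.prodMk (by fun_prop)))
  have hm : Measurable fun z => ∫⁻ x, F (z, x) ∂histTransK X U Y S t z :=
    Measurable.lintegral_kernel_prod_right' hF
  have h2 := S.lintegral_lastStep μ t
    (F := fun r => ∫⁻ x, F ((r.2.1.1, r.1.1.1, Fin.snoc r.1.1.2 r.1.2), x)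
      ∂histTransK X U Y S t (r.2.1.1, r.1.1.1, Fin.snoc r.1.1.2 r.1.2))
    (hm.comp hz)
  simp only [lastStep, Fin.snoc_init_self] at h1 h2
  rw [h1, h2]
  refine lintegral_congr fun p => ?_
  rw [S.lintegral_oneStepK_trans_avg t _
    (F := fun q => F ((q.1, p.1.1, Fin.snoc p.1.2 p.2), q.2)) (by fun_prop)]
  simp only [histTransK, Kernel.comap_apply, Fin.snoc_last]

/-! ### The conditional densities of the last state -/

/-- The density of the filter in terms of the history. -/
def histFiltDens (t : ℕ) (h : ObsHist U Y (t + 1)) : X → ℝ≥0∞ :=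
  S.filtDens t (S.filter t (Fin.init h.1, Fin.init h.2), h.2 (Fin.last t)) (h.1 (Fin.last (t + 1)))

lemma measurable_histFiltDens (t : ℕ) :
    Measurable (Function.uncurry (S.histFiltDens (U := U) t)) :=
  (S.measurable_filtDens t).comp ((((S.measurable_histCtrl t).comp measurable_fst).prodMk
    (by fun_prop)).prodMk measurable_snd)

lemma filterK_succ_eq_withDensity (t : ℕ) (h : ObsHist U Y (t + 1)) :
    S.filterK (t + 1) h = S.lamX.withDensity (S.histFiltDens t h) :=
  S.filterStep_eq_withDensity t (S.filter t (Fin.init h.1, Fin.init h.2), h.2 (Fin.last t)) _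

/-- The predicted density in terms of `(y^t, u^t)`. -/
def histPredDens (t : ℕ) (z : (Fin (t + 1) → Y) × (Fin (t + 1) → U)) : X → ℝ≥0∞ :=
  S.predDens t (S.filter t (z.1, Fin.init z.2), z.2 (Fin.last t))

lemma measurable_histPredDens (t : ℕ) : Measurable (Function.uncurry (S.histPredDens t)) :=
  (S.measurable_predDens t).comp
    ((((S.measurable_filter t).comp (measurable_fst.fst.prodMk ((measurable_init t).comp
      measurable_fst.snd))).prodMk (by fun_prop)).prodMk measurable_snd)

lemma histPredK_eq_withDensity (t : ℕ) (z : (Fin (t + 1) → Y) × (Fin (t + 1) → U)) :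
    S.histPredK t z = S.lamX.withDensity (S.histPredDens t z) :=
  S.predK_eq_withDensity t _

/-- The transition density in terms of `(x_t, y^t, u^t)`. -/
def histTransDens (t : ℕ) (z : X × (Fin (t + 1) → Y) × (Fin (t + 1) → U)) : X → ℝ≥0∞ :=
  S.transDens t z.1 (z.2.2 (Fin.last t))

lemma measurable_histTransDens (t : ℕ) : Measurable (Function.uncurry (S.histTransDens t)) :=
  (S.measurable_transDens t).comp (by fun_prop : Measurable
    fun p : (X × (Fin (t + 1) → Y) × (Fin (t + 1) → U)) × X =>
      ((p.1.1, p.1.2.2 (Fin.last t)), p.2))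

lemma histTransK_eq_withDensity (t : ℕ) (z : X × (Fin (t + 1) → Y) × (Fin (t + 1) → U)) :
    histTransK X U Y S t z = S.lamX.withDensity (S.histTransDens t z) :=
  S.transK_apply t _

lemma measurable_predInfo (t : ℕ) : Measurable (fun ω : Traj X U Y (t + 1) =>
    ((Fin.init ω.2.1 : Fin (t + 1) → Y), ω.2.2)) := by
  unfold Fin.init; fun_prop

lemma measurable_transInfo (t : ℕ) : Measurable (fun ω : Traj X U Y (t + 1) =>
    (ω.1 (Fin.last t).castSucc, (Fin.init ω.2.1 : Fin (t + 1) → Y), ω.2.2)) := by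
  unfold Fin.init; fun_prop

lemma measurable_lastState (t : ℕ) : Measurable (fun ω : Traj X U Y t => ω.1 (Fin.last t)) := by
  fun_prop

/-! ### Admissibility in terms of the stage rewards -/

variable {c : ℕ → X → U → ℝ≥0} (hc : ∀ t, Measurable (fun p : X × U => c t p.1 p.2)) (γ : ℝ≥0)

include hc in
lemma lintegral_absReward_ctrlLaw (μ : OutputPolicy U Y) (t : ℕ) :
    ∫⁻ p, S.absReward c γ t p.1 p.2 ∂S.ctrlLaw μ t
      = ∫⁻ r, S.stepAbs c γ t r ∂(S.ctrlLaw μ t ⊗ₘ S.oneStepK t) := by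
  rw [Measure.lintegral_compProd (S.measurable_stepAbs hc γ t)]
  exact lintegral_congr fun p => S.absReward_eq hc γ t p

include hc in
lemma measurable_absReward (t : ℕ) :
    Measurable fun p : S.Info × U => S.absReward c γ t p.1 p.2 := by
  simp only [S.absReward_eq hc γ t]
  exact Measurable.lintegral_kernel_prod_right' (S.measurable_stepAbs hc γ t)

include hc in
-- The four conditions of admissibility are, term by term, the four summands of the mean of
-- `absReward`: each conditional entropy is the mean of a log density of the last step.
lemma admissible_iff [StandardBorelSpace X] [Nonempty X] (T : ℕ) (μ : OutputPolicy U Y) :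
    S.Admissible c γ T μ ↔
      ∀ t < T, ∫⁻ p, S.absReward c γ t p.1 p.2 ∂S.ctrlLaw μ t < ⊤ := by
  unfold Admissible
  refine forall_congr' fun t => forall_congr' fun _ => ?_
  have hls := S.measurable_infoLastStep t
  rw [S.lintegral_absReward_ctrlLaw hc γ μ t, S.lintegral_stepAbs hc γ, ENNReal.add_lt_top,
    ENNReal.add_lt_top, ENNReal.add_lt_top, ← map_infoLastStep_law,
    lintegral_map (S.measurable_logFilt t).enorm hls,
    lintegral_map (S.measurable_logPred t).enorm hls,
    lintegral_map (S.measurable_logTrans t).enorm hls,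
    lintegral_map (S.measurable_stepCost hc γ t).enorm hls,
    absCondEntropy_eq_lintegral_logDens S.lamX _ (measurable_lastState (t + 1)) measurable_snd
      (S.filterK (t + 1)) (S.map_last_law μ (t + 1)) _ (S.measurable_histFiltDens t)
      (S.filterK_succ_eq_withDensity t),
    absCondEntropy_eq_lintegral_logDens S.lamX _ (measurable_lastState (t + 1))
      (measurable_predInfo t) (S.histPredK t) (S.map_pred_law μ t) _ (S.measurable_histPredDens t)
      (S.histPredK_eq_withDensity t),
    absCondEntropy_eq_lintegral_logDens S.lamX _ (measurable_lastState (t + 1))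
      (measurable_transInfo t) (histTransK X U Y S t) (S.map_trans_law μ t) _
      (S.measurable_histTransDens t) (S.histTransK_eq_withDensity t)]
  simp only [enorm_stepCost]
  rw [and_assoc, and_assoc]
  -- Densities written in terms of histories unfold to `logFilt`, `logPred` and `logTrans` at
  -- `infoLastStep`.
  rfl

/-! ### Integrability and the value of the stage rewards under a policy -/

include hc in
lemma stepIntegrable_ctrlLaw {μ : OutputPolicy U Y} {t : ℕ}
    (h : ∫⁻ p, S.absReward c γ t p.1 p.2 ∂S.ctrlLaw μ t < ⊤) :
    S.StepIntegrable c γ t (S.ctrlLaw μ t ⊗ₘ S.oneStepK t) :=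
  S.stepIntegrable_of_lt_top hc γ (by rwa [← S.lintegral_absReward_ctrlLaw hc γ])

include hc in
lemma reward_ae_eq {θ : Measure (S.Info × U)} {t : ℕ}
    (h : ∫⁻ p, S.absReward c γ t p.1 p.2 ∂θ < ⊤) :
    (fun p => S.reward c γ t p.1 p.2)
      =ᵐ[θ] fun p => ∫ q, S.stepGain c γ t (p, q) ∂S.oneStepK t p := by
  filter_upwards [ae_lt_top (S.measurable_absReward hc γ t) h.ne] with p hp
  exact S.reward_eq hc γ t p hp

include hc in
-- The reward is almost everywhere the conditional mean of an integrable gain. The measure `θ` is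
-- left general because the lemma serves both the unconditional law of `(π_t, U_t)` and its law
-- given `π_0`.
lemma integrable_reward {θ : Measure (S.Info × U)} [SFinite θ] {t : ℕ}
    (h : ∫⁻ p, S.absReward c γ t p.1 p.2 ∂θ < ⊤) :
    Integrable (fun p => S.reward c γ t p.1 p.2) θ := by
  have hg : Integrable (S.stepGain c γ t) (θ ⊗ₘ S.oneStepK t) :=
    (S.stepIntegrable_of_lt_top hc γ (by
      rw [Measure.lintegral_compProd (S.measurable_stepAbs hc γ t)]
      simpa only [S.absReward_eq hc γ t] using h)).gain
  exact (integrable_integral_of_compProd hg).congr (S.reward_ae_eq hc γ h).symm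

include hc in
lemma integral_reward_ctrlLaw {μ : OutputPolicy U Y} {t : ℕ}
    (h : ∫⁻ p, S.absReward c γ t p.1 p.2 ∂S.ctrlLaw μ t < ⊤) :
    ∫ p, S.reward c γ t p.1 p.2 ∂S.ctrlLaw μ t
      = ∫ r, S.stepGain c γ t r ∂(S.ctrlLaw μ t ⊗ₘ S.oneStepK t) := by
  rw [Measure.integral_compProd (S.stepIntegrable_ctrlLaw hc γ h).gain]
  exact integral_congr_ae (S.reward_ae_eq hc γ h)

/-! ### The chain rule for the smoother entropy -/

/-- Dropping the last step of a trajectory. -/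
def trajInit (t : ℕ) (ω : Traj X U Y (t + 1)) : Traj X U Y t :=
  (Fin.init ω.1, Fin.init ω.2.1, Fin.init ω.2.2)

lemma measurable_trajInit (t : ℕ) : Measurable (trajInit (X := X) (U := U) (Y := Y) t) := by
  unfold trajInit Fin.init; fun_prop

lemma map_trajInit_law (μ : OutputPolicy U Y) (t : ℕ) :
    (S.law μ (t + 1)).map (trajInit t) = S.law μ t := by
  rw [law, Measure.map_map (measurable_trajInit t) (measurable_extend t)]
  have : trajInit t ∘ extend X U Y t = Prod.fst := by
    funext p
    simp only [Function.comp, trajInit, extend, Fin.init_snoc]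
  rw [this]
  exact Measure.fst_compProd _ _

/-- The logarithm of the smoother density along a trajectory. -/
def logSmooth (t : ℕ) (ω : Traj X U Y t) : ℝ := logDens (S.smoothDens t ω.2 ω.1)

lemma measurable_logSmooth (t : ℕ) : Measurable (S.logSmooth t (U := U)) :=
  measurable_logDens.comp ((S.measurable_smoothDens t).comp measurable_swap)

lemma ae_smoothDens_ne (μ : OutputPolicy U Y) (t : ℕ) :
    ∀ᵐ ω ∂S.law μ t, S.smoothDens t ω.2 ω.1 ≠ 0 ∧ S.smoothDens t ω.2 ω.1 ≠ ⊤ :=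
  ae_condDens_ne_zero_ne_top _ (S.law μ t) measurable_fst measurable_snd (S.smooth t)
    (S.map_swap_law μ t) _ (S.measurable_smoothDens t) (S.smooth_eq_withDensity t)

/-- The chain rule before taking expectations. The Bayes weight is the ratio of the filter and
predictor densities, so its logarithm is the last bracket. -/
lemma logSmooth_succ_ae_eq (μ : OutputPolicy U Y) (t : ℕ) :
    ∀ᵐ ω ∂S.law μ (t + 1), S.logSmooth (t + 1) ω
      = S.logSmooth t (trajInit t ω) + (S.logTrans t (S.infoLastStep t ω)
        + (S.logFilt t (S.infoLastStep t ω) - S.logPred t (S.infoLastStep t ω))) := by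
  have h1 : ∀ᵐ ω ∂S.law μ (t + 1), S.smoothDens t (trajInit t ω).2 (trajInit t ω).1 ≠ 0 ∧
      S.smoothDens t (trajInit t ω).2 (trajInit t ω).1 ≠ ⊤ := by
    refine ae_of_ae_map (measurable_trajInit t).aemeasurable
      (p := fun ω => S.smoothDens t ω.2 ω.1 ≠ 0 ∧ S.smoothDens t ω.2 ω.1 ≠ ⊤) ?_
    rw [map_trajInit_law]
    exact S.ae_smoothDens_ne μ t
  have h2 := ae_condDens_ne_zero_ne_top S.lamX _ (measurable_lastState (t + 1)) measurable_snd
      (S.filterK (t + 1)) (S.map_last_law μ (t + 1)) _ (S.measurable_histFiltDens t)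
      (S.filterK_succ_eq_withDensity t)
  have h3 := ae_condDens_ne_zero_ne_top S.lamX _ (measurable_lastState (t + 1))
      (measurable_predInfo t) (S.histPredK t) (S.map_pred_law μ t) _ (S.measurable_histPredDens t)
      (S.histPredK_eq_withDensity t)
  have h4 := ae_condDens_ne_zero_ne_top S.lamX _ (measurable_lastState (t + 1))
      (measurable_transInfo t) (histTransK X U Y S t) (S.map_trans_law μ t) _
      (S.measurable_histTransDens t) (S.histTransK_eq_withDensity t)
  filter_upwards [h1, h2, h3, h4] with ω ⟨a1, b1⟩ ⟨a2, b2⟩ ⟨a3, b3⟩ ⟨a4, b4⟩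
  set r := S.infoLastStep t ω with hr
  set w := S.stepWeight t r.1 r.2.2 r.2.1.2 with hw
  have e2 : S.histFiltDens t ω.2 (ω.1 (Fin.last (t + 1)))
      = S.predDens t r.1 r.2.1.2 * w := rfl
  have e3 : S.histPredDens t ((Fin.init ω.2.1 : Fin (t + 1) → Y), ω.2.2)
      (ω.1 (Fin.last (t + 1))) = S.predDens t r.1 r.2.1.2 := rfl
  have e4 : S.histTransDens t (ω.1 (Fin.last t).castSucc, (Fin.init ω.2.1 : Fin (t + 1) → Y), ω.2.2)
      (ω.1 (Fin.last (t + 1))) = S.transDens t r.2.1.1 r.1.2 r.2.1.2 := rfl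
  rw [e2] at a2 b2
  rw [e3] at a3 b3
  rw [e4] at a4 b4
  -- The weight is positive and finite because its product with the nonzero predicted density is.
  have a5 : w ≠ 0 := right_ne_zero_of_mul a2
  have b5 : w ≠ ⊤ := fun h => b2 (by rw [h, ENNReal.mul_top a3])
  have e1 : S.logSmooth (t + 1) ω = logDens (S.smoothDens t (trajInit t ω).2 (trajInit t ω).1 *
      S.transDens t r.2.1.1 r.1.2 r.2.1.2 * w) := rfl
  have e6 : S.logFilt t r = logDens (S.predDens t r.1 r.2.1.2 * w) := rfl
  rw [e1, logDens_mul (mul_ne_zero a1 a4) (ENNReal.mul_ne_top b1 b4) a5 b5,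
    logDens_mul a1 b1 a4 b4, e6, logDens_mul a3 b3 a5 b5]
  unfold logSmooth logTrans logPred
  ring

section Chain

/-- The initial information state as a kernel. -/
def initFilterK : Kernel Y X := ⟨fun y => (S.filterInit y).1,
  measurable_subtype_coe.comp S.measurable_filterInit⟩

instance : IsMarkovKernel S.initFilterK := ⟨fun y => (S.filterInit y).2.1⟩

lemma map_swap_initLaw : S.initLaw.map (fun p => (p.2, p.1))
    = (S.initLaw.map Prod.snd) ⊗ₘ S.initFilterK := by
  refine map_prodMk_eq_compProd_of_lintegral measurable_fst measurable_snd _ fun F hF => ?_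
  have hm : Measurable fun y => ∫⁻ x, F (y, x) ∂S.initFilterK y :=
    Measurable.lintegral_kernel_prod_right' hF
  rw [initLaw, Measure.lintegral_compProd (f := fun p => F (p.2, p.1)) (by fun_prop),
    Measure.lintegral_compProd (f := fun p => ∫⁻ x, F (p.2, x) ∂S.initFilterK p.2)
      (hm.comp measurable_snd)]
  exact lintegral_bayes S.lawX0 S.lamY S.obsK0 S.obsDens0 S.measurable_obsDens0 S.obsK0_apply
    (fun x y => F (y, x)) (by fun_prop)

variable [StandardBorelSpace X] [Nonempty X]

lemma logSmooth_zero (μ : OutputPolicy U Y) (hinit : S.absInitEntropy < ⊤) :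
    Integrable (S.logSmooth 0) (S.law μ 0) ∧
      S.initEntropy = - ∫ ω, S.logSmooth 0 ω ∂S.law μ 0 := by
  have hm : Measurable fun p : X × Y =>
    ((fun _ => p.1, fun _ => p.2, Fin.elim0) : Traj X U Y 0) := by fun_prop
  have hd : Measurable fun p : X × Y => logDens (S.initDens p.2 p.1) :=
    measurable_logDens.comp (S.measurable_initDens.comp measurable_swap)
  have hint : Integrable (fun p : X × Y => logDens (S.initDens p.2 p.1)) S.initLaw := by
    refine ⟨hd.aestronglyMeasurable, ?_⟩
    unfold absInitEntropy at hinit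
    rw [absCondEntropy_eq_lintegral_logDens S.lamX _ measurable_fst measurable_snd S.initFilterK
      S.map_swap_initLaw _ S.measurable_initDens S.filterInit_eq_withDensity] at hinit
    exact hinit
  constructor
  · rw [law, integrable_map_measure (S.measurable_logSmooth 0).aestronglyMeasurable
      hm.aemeasurable]
    exact hint
  · rw [law, integral_map hm.aemeasurable (S.measurable_logSmooth 0).aestronglyMeasurable]
    exact condEntropy_eq_integral_logDens S.lamX _ measurable_fst measurable_snd S.initFilterK
      S.map_swap_initLaw _ S.measurable_initDens S.filterInit_eq_withDensity hint

include hc in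
/-- The chain rule: the smoother entropy minus the costs is the initial entropy plus the sum of
the stage rewards. -/
lemma logSmooth_chain (μ : OutputPolicy U Y) (hinit : S.absInitEntropy < ⊤) (T : ℕ)
    (h : ∀ t < T, ∫⁻ p, S.absReward c γ t p.1 p.2 ∂S.ctrlLaw μ t < ⊤) :
    Integrable (S.logSmooth T) (S.law μ T) ∧
      - ∫ ω, S.logSmooth T ω ∂S.law μ T
          - ∑ t ∈ Finset.range T, ∫ r, S.stepCost c γ t r ∂(S.ctrlLaw μ t ⊗ₘ S.oneStepK t)
        = S.initEntropy + ∑ t ∈ Finset.range T, ∫ p, S.reward c γ t p.1 p.2 ∂S.ctrlLaw μ t := by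
  induction T with
  | zero =>
    obtain ⟨h1, h2⟩ := S.logSmooth_zero μ hinit
    exact ⟨h1, by simp [h2]⟩
  | succ T ih =>
    obtain ⟨i0, e0⟩ := ih fun t ht => h t (by omega)
    have hT := h T (by omega)
    have hs := S.stepIntegrable_ctrlLaw hc γ hT
    have hls := (S.measurable_infoLastStep T).aemeasurable (μ := S.law μ (T + 1))
    have hti := (measurable_trajInit T).aemeasurable (μ := S.law μ (T + 1))
    have j0 : Integrable (fun ω => S.logSmooth T (trajInit T ω)) (S.law μ (T + 1)) := by
      rw [← S.map_trajInit_law μ T] at i0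
      exact i0.comp_aemeasurable hti
    have f0 : ∫ ω, S.logSmooth T (trajInit T ω) ∂S.law μ (T + 1)
        = ∫ ω, S.logSmooth T ω ∂S.law μ T := by
      rw [← S.map_trajInit_law μ T,
        integral_map hti (S.measurable_logSmooth T).aestronglyMeasurable]
    have pull : ∀ {f : (S.Info × U) × ((X × X) × Y) → ℝ},
        Integrable f (S.ctrlLaw μ T ⊗ₘ S.oneStepK T) →
        Integrable (fun ω => f (S.infoLastStep T ω)) (S.law μ (T + 1)) ∧
        ∫ ω, f (S.infoLastStep T ω) ∂S.law μ (T + 1)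
          = ∫ r, f r ∂(S.ctrlLaw μ T ⊗ₘ S.oneStepK T) := fun hf => by
      rw [← map_infoLastStep_law] at hf ⊢
      exact ⟨hf.comp_aemeasurable hls, (integral_map hls hf.aestronglyMeasurable).symm⟩
    obtain ⟨j1, f1⟩ := pull hs.trans
    obtain ⟨j2, f2⟩ := pull hs.filt
    obtain ⟨j3, f3⟩ := pull hs.pred
    have j23 := j2.sub j3
    have j123 := j1.add j23
    have hae := S.logSmooth_succ_ae_eq μ T
    -- Absolute convergence of the smoother entropy is not assumed; it is inherited from the terms
    -- of the chain rule.
    refine ⟨(j0.add j123).congr (hae.mono fun ω hω => hω.symm), ?_⟩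
    rw [integral_congr_ae hae]
    have g : ∫ ω, (S.logSmooth T (trajInit T ω) + (S.logTrans T (S.infoLastStep T ω)
        + (S.logFilt T (S.infoLastStep T ω) - S.logPred T (S.infoLastStep T ω))))
          ∂S.law μ (T + 1)
        = ∫ ω, S.logSmooth T ω ∂S.law μ T + (∫ r, S.logTrans T r ∂(S.ctrlLaw μ T ⊗ₘ S.oneStepK T)
          + (∫ r, S.logFilt T r ∂(S.ctrlLaw μ T ⊗ₘ S.oneStepK T)
            - ∫ r, S.logPred T r ∂(S.ctrlLaw μ T ⊗ₘ S.oneStepK T))) := by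
      rw [← f0, ← f1, ← f2, ← f3, ← integral_sub j2 j3]
      rw [← integral_add j1 (g := fun ω => S.logFilt T (S.infoLastStep T ω)
        - S.logPred T (S.infoLastStep T ω)) j23]
      exact integral_add j0 j123
    rw [g, Finset.sum_range_succ, Finset.sum_range_succ, S.integral_reward_ctrlLaw hc γ hT,
      hs.integral_gain]
    linarith

end Chain

end System

end

end SmoothingAverse

namespace SmoothingAverse

noncomputable section

variable {X U Y W V : Type*} [MeasurableSpace X] [MeasurableSpace U] [MeasurableSpace Y]
  [MeasurableSpace W] [MeasurableSpace V]

namespace System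

variable (S : System X U Y W V)

/-! ### The objective -/

/-- Restricting a trajectory to the first steps. -/
def trajRestrict {s T : ℕ} (h : s ≤ T) (ω : Traj X U Y T) : Traj X U Y s :=
  (fun i => ω.1 (Fin.castLE (Nat.succ_le_succ h) i),
    fun i => ω.2.1 (Fin.castLE (Nat.succ_le_succ h) i), fun i => ω.2.2 (Fin.castLE h i))

lemma measurable_trajRestrict {s T : ℕ} (h : s ≤ T) :
    Measurable (trajRestrict (X := X) (U := U) (Y := Y) h) := by
  unfold trajRestrict; fun_prop

lemma map_trajRestrict_law (μ : OutputPolicy U Y) {s T : ℕ} (h : s ≤ T) :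
    (S.law μ T).map (trajRestrict h) = S.law μ s := by
  induction T, h using Nat.le_induction with
  | base => exact Measure.map_id
  | succ T h ih =>
    rw [← ih, ← S.map_trajInit_law μ T, Measure.map_map (measurable_trajRestrict h)
      (measurable_trajInit T)]
    rfl

lemma map_infoLastStep_trajRestrict (μ : OutputPolicy U Y) {T : ℕ} (t : Fin T) :
    (S.law μ T).map (fun ω => S.infoLastStep t (trajRestrict (Nat.succ_le_of_lt t.isLt) ω))
      = S.ctrlLaw μ t ⊗ₘ S.oneStepK t := by
  rw [← map_infoLastStep_law, ← S.map_trajRestrict_law μ (Nat.succ_le_of_lt t.isLt),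
    Measure.map_map (S.measurable_infoLastStep t) (measurable_trajRestrict _)]
  rfl

variable {c : ℕ → X → U → ℝ≥0} (hc : ∀ t, Measurable (fun p : X × U => c t p.1 p.2)) (γ : ℝ≥0)

include hc in
lemma integral_cost_eq (μ : OutputPolicy U Y) (T : ℕ)
    (h : ∀ t < T, ∫⁻ p, S.absReward c γ t p.1 p.2 ∂S.ctrlLaw μ t < ⊤) :
    γ * ∫ ω, ∑ t : Fin T, (c t (ω.1 t.castSucc) (ω.2.2 t) : ℝ) ∂(S.law μ T)
      = ∑ t ∈ Finset.range T, ∫ r, S.stepCost c γ t r ∂(S.ctrlLaw μ t ⊗ₘ S.oneStepK t) := by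
  -- The weight is moved inside first: only `γ * c` is known to be integrable, and for `γ = 0` the
  -- cost itself need not be.
  rw [← integral_const_mul, Finset.sum_range]
  simp only [Finset.mul_sum]
  have hm : ∀ t : Fin T, AEMeasurable
      (fun ω : Traj X U Y T => S.infoLastStep t (trajRestrict (Nat.succ_le_of_lt t.isLt) ω))
      (S.law μ T) := fun t =>
    ((S.measurable_infoLastStep t).comp (measurable_trajRestrict _)).aemeasurable
  rw [integral_finsetSum]
  · refine Finset.sum_congr rfl fun t _ => ?_
    rw [← S.map_infoLastStep_trajRestrict μ t, integral_map (hm t)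
      (S.measurable_stepCost hc γ t).aestronglyMeasurable]
    rfl
  · intro t _
    have := (S.stepIntegrable_ctrlLaw hc γ (h t t.isLt)).cost
    rw [← S.map_infoLastStep_trajRestrict μ t] at this
    exact this.comp_aemeasurable (hm t)

include hc in
lemma integral_totalReward_infoPath (μ : OutputPolicy U Y) (T : ℕ)
    (h : ∀ t < T, ∫⁻ p, S.absReward c γ t p.1 p.2 ∂S.ctrlLaw μ t < ⊤) :
    Integrable (fun ω => S.totalReward c γ T (S.infoPath T ω.2)) (S.law μ T) ∧
      ∫ ω, S.totalReward c γ T (S.infoPath T ω.2) ∂(S.law μ T)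
        = ∑ t ∈ Finset.range T, ∫ p, S.reward c γ t p.1 p.2 ∂S.ctrlLaw μ t := by
  -- Truncating the trajectory to time `t + 1` does not change the law of `(π_t, U_t)`, so all
  -- stages can be evaluated under the law at the horizon.
  have hmap : ∀ t : Fin T, (S.law μ T).map (fun ω => (S.infoLastStep t
      (trajRestrict (Nat.succ_le_of_lt t.isLt) ω)).1) = S.ctrlLaw μ t := fun t => by
    have := congrArg (Measure.map Prod.fst) (S.map_infoLastStep_trajRestrict μ t)
    rw [Measure.map_map measurable_fst ((S.measurable_infoLastStep t).fun_comp
      (measurable_trajRestrict _))] at this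
    exact this.trans (Measure.fst_compProd _ _)
  have hm : ∀ t : Fin T, AEMeasurable
      (fun ω : Traj X U Y T => (S.infoLastStep t
        (trajRestrict (Nat.succ_le_of_lt t.isLt) ω)).1) (S.law μ T) := fun t =>
    ((S.measurable_infoLastStep t).comp (measurable_trajRestrict _)).fst.aemeasurable
  have hi : ∀ t : Fin T, Integrable (fun p => S.reward c γ t p.1 p.2) (S.ctrlLaw μ t) :=
    fun t => S.integrable_reward hc γ (h t t.isLt)
  have hint : ∀ t : Fin T, Integrable (fun ω => S.reward c γ t
      ((S.infoPath T ω.2).1 t.castSucc) ((S.infoPath T ω.2).2 t)) (S.law μ T) := fun t => by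
    have := hi t
    rw [← hmap t] at this
    exact this.comp_aemeasurable (hm t)
  refine ⟨integrable_finsetSum _ fun t _ => hint t, ?_⟩
  unfold totalReward
  rw [integral_finsetSum _ fun t _ => hint t, Finset.sum_range]
  refine Finset.sum_congr rfl fun t _ => ?_
  have := (hi t).aestronglyMeasurable
  rw [← hmap t] at this ⊢
  rw [integral_map (hm t) this]
  rfl

include hc in
/-- The objective in terms of the stage rewards. -/
lemma objective_eq [StandardBorelSpace X] [Nonempty X] (hinit : S.absInitEntropy < ⊤)
    (μ : OutputPolicy U Y) (T : ℕ)
    (h : ∀ t < T, ∫⁻ p, S.absReward c γ t p.1 p.2 ∂S.ctrlLaw μ t < ⊤) :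
    S.absSmootherEntropy μ T < ⊤ ∧ S.objective c γ T μ
      = S.initEntropy + ∑ t ∈ Finset.range T, ∫ p, S.reward c γ t p.1 p.2 ∂S.ctrlLaw μ t := by
  obtain ⟨hi, he⟩ := S.logSmooth_chain hc γ μ hinit T h
  constructor
  · unfold absSmootherEntropy
    rw [absCondEntropy_eq_lintegral_logDens _ (S.law μ T) measurable_fst measurable_snd
      (S.smooth T) (S.map_swap_law μ T) _ (S.measurable_smoothDens T)
      (S.smooth_eq_withDensity T)]
    exact hi.2
  · rw [← he, objective, S.integral_cost_eq hc γ μ T h, smootherEntropy,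
      condEntropy_eq_integral_logDens _ (S.law μ T) measurable_fst measurable_snd
      (S.smooth T) (S.map_swap_law μ T) _ (S.measurable_smoothDens T)
      (S.smooth_eq_withDensity T) hi]
    rfl

end System

end

end SmoothingAverse

/-! ### The information state as a controlled Markov process, and the reduction to its policies. -/

namespace SmoothingAverse

noncomputable section

variable {X U Y W V : Type*} [MeasurableSpace X] [MeasurableSpace U] [MeasurableSpace Y]
  [MeasurableSpace W] [MeasurableSpace V]

namespace System

variable (S : System X U Y W V)

/-! ### The dynamics of the information state -/

lemma lintegral_infoStepK (t : ℕ) (p : S.Info × U) {G : S.Info → ℝ≥0∞} (hG : Measurable G) :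
    ∫⁻ π, G π ∂S.infoStepK t p
      = ∫⁻ q, G (S.filterStep t p.1 p.2 q.2) ∂S.oneStepK t p := by
  have hf : Measurable fun y : Y => S.filterStep t p.1 p.2 y :=
    (S.measurable_filterStep t).comp (by fun_prop : Measurable fun y : Y => (p, y))
  rw [infoStepK, Kernel.map_apply _ (S.measurable_filterStep t), Kernel.prod_apply,
    Kernel.id_apply, Measure.dirac_prod, lintegral_map hG (S.measurable_filterStep t),
    lintegral_map (hG.fun_comp (S.measurable_filterStep t)) measurable_prodMk_left,
    ← map_obs_oneStepK, lintegral_map (hG.fun_comp hf) measurable_snd]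

/-- The pair of the first and the current information state. -/
def infoPair (t : ℕ) (h : ObsHist U Y t) : S.Info × S.Info := (S.filterInit (h.1 0), S.filter t h)

lemma measurable_infoPair (t : ℕ) : Measurable (S.infoPair (U := U) t) :=
  (S.measurable_filterInit.comp (by fun_prop)).prodMk (S.measurable_filter t)

/-- The filter evolves by `infoStepK` whatever the policy. The initial state `π_0` is carried along
since values are conditioned on it and since some policies below use it. -/
lemma lintegral_infoPair_succ (μ : OutputPolicy U Y) (t : ℕ) {G : S.Info × S.Info → ℝ≥0∞}
    (hG : Measurable G) :
    ∫⁻ ω, G (S.infoPair (t + 1) ω.2) ∂S.law μ (t + 1)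
      = ∫⁻ ω, ∫⁻ u, ∫⁻ π, G ((S.infoPair t ω.2).1, π) ∂S.infoStepK t ((S.infoPair t ω.2).2, u)
          ∂μ.ker t ω.2 ∂S.law μ t := by
  have h0 : Measurable fun p : ObsHist U Y t × U => S.filterInit (p.1.1 0) :=
    S.measurable_filterInit.comp (by fun_prop)
  have h1 : Measurable fun r : (ObsHist U Y t × U) × ((X × X) × Y) =>
      (S.filterInit (r.1.1.1 0), S.filterStep t (S.filter t r.1.1) r.1.2 r.2.2) :=
    (h0.comp measurable_fst).prodMk ((S.measurable_filterStep t).comp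
      (((S.measurable_filter_prod t).comp measurable_fst).prodMk measurable_snd.snd))
  have h2 : Measurable fun p : ObsHist U Y t × U =>
      ∫⁻ π, G (S.filterInit (p.1.1 0), π) ∂S.infoStepK t (S.filter t p.1, p.2) :=
    Measurable.lintegral_kernel_prod_right' (κ := (S.infoStepK t).comap _
      (S.measurable_filter_prod t))
      (f := fun q : (ObsHist U Y t × U) × S.Info => G (S.filterInit (q.1.1.1 0), q.2))
      (hG.comp ((h0.comp measurable_fst).prodMk measurable_snd))
  have := S.lintegral_lastStep μ t (F := fun r => G (S.filterInit (r.1.1.1 0),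
    S.filterStep t (S.filter t r.1.1) r.1.2 r.2.2)) (hG.comp h1)
  refine this.trans ?_
  have e := S.lintegral_histCtrlLaw μ t h2
  refine Eq.trans ?_ e
  refine lintegral_congr fun p => ?_
  exact (S.lintegral_infoStepK t (S.filter t p.1, p.2)
    (G := fun π => G (S.filterInit (p.1.1 0), π)) (by fun_prop)).symm

lemma lintegral_ctrlLaw (μ : OutputPolicy U Y) (t : ℕ) {F : S.Info × U → ℝ≥0∞}
    (hF : Measurable F) :
    ∫⁻ p, F p ∂S.ctrlLaw μ t
      = ∫⁻ ω, ∫⁻ u, F (S.filter t ω.2, u) ∂μ.ker t ω.2 ∂S.law μ t := by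
  rw [ctrlLaw, lintegral_map hF (S.measurable_filter_prod t),
    S.lintegral_histCtrlLaw μ t (hF.fun_comp (S.measurable_filter_prod t))]

lemma lintegral_filter_succ (μ : OutputPolicy U Y) (t : ℕ) {G : S.Info → ℝ≥0∞}
    (hG : Measurable G) :
    ∫⁻ ω, G (S.filter (t + 1) ω.2) ∂S.law μ (t + 1)
      = ∫⁻ p, ∫⁻ π, G π ∂S.infoStepK t p ∂S.ctrlLaw μ t := by
  rw [S.lintegral_ctrlLaw μ t hG.lintegral_kernel]
  exact S.lintegral_infoPair_succ μ t (G := fun q => G q.2) (by fun_prop)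

lemma lintegral_infoPair_zero (μ : OutputPolicy U Y) {G : S.Info × S.Info → ℝ≥0∞}
    (hG : Measurable G) :
    ∫⁻ ω, G (S.infoPair 0 ω.2) ∂S.law μ 0 = ∫⁻ π, G (π, π) ∂S.infoInit := by
  rw [law, lintegral_map (hG.fun_comp ((S.measurable_infoPair 0).fun_comp measurable_snd))
    (by fun_prop), infoInit]
  exact (lintegral_map (f := fun π => G (π, π)) (by fun_prop)
    (S.measurable_filterInit.comp measurable_snd)).symm

/-! ### Policies that depend on the first and the current information state -/

variable (η : ℕ → Kernel (S.Info × S.Info) U)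

/-- The law of `π_t` given `π_0` if `U_t` is drawn from `η_t(⬝ | π_0, π_t)`. -/
def stateM : ℕ → Kernel S.Info S.Info
  | 0 => Kernel.id
  | t + 1 => S.infoStepK t ∘ₖ (stateM t ⊗ₖ η t)

/-- The law of `(π_t, U_t)` given `π_0` if `U_t` is drawn from `η_t(⬝ | π_0, π_t)`. -/
def ctrlM (t : ℕ) : Kernel S.Info (S.Info × U) := S.stateM η t ⊗ₖ η t

lemma lintegral_stateM_succ (t : ℕ) (π : S.Info) {G : S.Info → ℝ≥0∞} (hG : Measurable G) :
    ∫⁻ π', G π' ∂S.stateM η (t + 1) π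
      = ∫⁻ p, ∫⁻ π', G π' ∂S.infoStepK t p ∂S.ctrlM η t π := by
  rw [stateM, Kernel.lintegral_comp _ _ _ hG]
  rfl

variable [∀ t, IsMarkovKernel (η t)]

instance (t : ℕ) : IsMarkovKernel (S.stateM η t) := by
  induction t with
  | zero => unfold stateM; infer_instance
  | succ t ih => unfold stateM; infer_instance

instance (t : ℕ) : IsMarkovKernel (S.ctrlM η t) := by unfold ctrlM; infer_instance

lemma lintegral_ctrlM (t : ℕ) (π : S.Info) {F : S.Info × U → ℝ≥0∞} (hF : Measurable F) :
    ∫⁻ p, F p ∂S.ctrlM η t π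
      = ∫⁻ π', ∫⁻ u, F (π', u) ∂η t (π, π') ∂S.stateM η t π := by
  rw [ctrlM, Kernel.lintegral_compProd _ _ _ hF]

/-- The output feedback policy that feeds `π_0` and `π_t` to `η`. -/
def trackOutput : OutputPolicy U Y where
  ker t := (η t).comap (S.infoPair t) (S.measurable_infoPair t)
  isMarkov _ := inferInstance

lemma lintegral_infoPair (t : ℕ) {G : S.Info × S.Info → ℝ≥0∞} (hG : Measurable G) :
    ∫⁻ ω, G (S.infoPair t ω.2) ∂S.law (S.trackOutput η) t
      = ∫⁻ π, ∫⁻ π', G (π, π') ∂S.stateM η t π ∂S.infoInit := by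
  -- The test function must vary: the step applies the hypothesis to the one-step conditional
  -- expectation of `G`.
  induction t generalizing G with
  | zero =>
    rw [S.lintegral_infoPair_zero _ hG]
    refine lintegral_congr fun π => ?_
    rw [stateM, Kernel.id_apply, lintegral_dirac' _ (by fun_prop)]
  | succ t ih =>
    have h1 : Measurable fun q : (S.Info × S.Info) × U =>
        ∫⁻ π, G (q.1.1, π) ∂S.infoStepK t (q.1.2, q.2) :=
      Measurable.lintegral_kernel_prod_right' (κ := (S.infoStepK t).comap
        (fun q : (S.Info × S.Info) × U => (q.1.2, q.2)) (by fun_prop))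
        (f := fun r : ((S.Info × S.Info) × U) × S.Info => G (r.1.1.1, r.2)) (by fun_prop)
    have h2 := Measurable.lintegral_kernel_prod_right' (κ := η t) h1
    rw [S.lintegral_infoPair_succ _ t hG]
    refine (ih h2).trans (lintegral_congr fun π => ?_)
    rw [S.lintegral_stateM_succ η t π (G := fun π' => G (π, π')) (by fun_prop),
      S.lintegral_ctrlM η t π (Measurable.lintegral_kernel (by fun_prop))]

/-- The bridge between the two problems: averaging the fully observed dynamics over `π_0` gives the
law of `(π_t, U_t)` in the partially observed system. -/
lemma ctrlLaw_trackOutput (t : ℕ) :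
    S.ctrlLaw (S.trackOutput η) t = (S.infoInit ⊗ₘ S.ctrlM η t).map Prod.snd := by
  refine Measure.ext_of_lintegral _ fun F hF => ?_
  have h2 : Measurable fun q : S.Info × S.Info => ∫⁻ u, F (q.2, u) ∂η t q :=
    Measurable.lintegral_kernel_prod_right' (κ := η t)
      (f := fun r : (S.Info × S.Info) × U => F (r.1.2, r.2)) (by fun_prop)
  rw [S.lintegral_ctrlLaw _ t hF, lintegral_map hF measurable_snd,
    Measure.lintegral_compProd (by fun_prop)]
  refine (S.lintegral_infoPair η t h2).trans (lintegral_congr fun π => ?_)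
  rw [S.lintegral_ctrlM η t π hF]

lemma lintegral_ctrlLaw_trackOutput (t : ℕ) {F : S.Info × U → ℝ≥0∞} (hF : Measurable F) :
    ∫⁻ p, F p ∂S.ctrlLaw (S.trackOutput η) t
      = ∫⁻ π, ∫⁻ p, F p ∂S.ctrlM η t π ∂S.infoInit := by
  rw [ctrlLaw_trackOutput, lintegral_map hF measurable_snd,
    Measure.lintegral_compProd (by fun_prop)]

variable (c : ℕ → X → U → ℝ≥0) (γ : ℝ≥0)

/-- The expected total reward given `π_0`. -/
def trackValue (T : ℕ) (π : S.Info) : ℝ :=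
  ∑ t ∈ Finset.range T, ∫ p, S.reward c γ t p.1 p.2 ∂S.ctrlM η t π

variable {c} (hc : ∀ t, Measurable (fun p : X × U => c t p.1 p.2))

include hc in
lemma integral_trackValue (T : ℕ)
    (h : ∀ t < T, ∫⁻ p, S.absReward c γ t p.1 p.2 ∂S.ctrlLaw (S.trackOutput η) t < ⊤) :
    Integrable (S.trackValue η c γ T) S.infoInit ∧
      ∫ π, S.trackValue η c γ T π ∂S.infoInit
        = ∑ t ∈ Finset.range T, ∫ p, S.reward c γ t p.1 p.2 ∂S.ctrlLaw (S.trackOutput η) t := by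
  have h1 : ∀ t ∈ Finset.range T, Integrable (fun q : S.Info × (S.Info × U) =>
      S.reward c γ t q.2.1 q.2.2) (S.infoInit ⊗ₘ S.ctrlM η t) := fun t ht => by
    have := S.integrable_reward hc γ (h t (Finset.mem_range.1 ht))
    rw [ctrlLaw_trackOutput] at this
    exact this.comp_aemeasurable measurable_snd.aemeasurable
  have h2 := fun t ht => integrable_integral_of_compProd (h1 t ht)
  refine ⟨integrable_finsetSum _ h2, ?_⟩
  unfold trackValue
  rw [integral_finsetSum _ h2]
  refine Finset.sum_congr rfl fun t ht => ?_
  have := (S.integrable_reward hc γ (h t (Finset.mem_range.1 ht))).aestronglyMeasurable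
  rw [ctrlLaw_trackOutput] at this ⊢
  rw [integral_map measurable_snd.aemeasurable this, Measure.integral_compProd (h1 t ht)]

/-! ### Policies of the information state -/

variable {S}

/-- A policy of the information state as a policy that may also depend on `π_0`. -/
def InfoPolicy.track (ν : S.InfoPolicy) (t : ℕ) : Kernel (S.Info × S.Info) U :=
  (ν.ker t).comap Prod.snd measurable_snd

instance (ν : S.InfoPolicy) (t : ℕ) : IsMarkovKernel (ν.track t) := by
  unfold InfoPolicy.track; infer_instance

lemma InfoPolicy.trackOutput_track (ν : S.InfoPolicy) : S.trackOutput ν.track = ν.toOutput := rfl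

lemma lintegral_infoLaw_succ (ν : S.InfoPolicy) (T : ℕ) (π : S.Info)
    {F : (Fin (T + 2) → S.Info) × (Fin (T + 1) → U) → ℝ≥0∞} (hF : Measurable F) :
    ∫⁻ p, F p ∂infoLaw ν (T + 1) π
      = ∫⁻ p, ∫⁻ u, ∫⁻ π', F (Fin.snoc p.1 π', Fin.snoc p.2 u)
          ∂S.infoStepK T (p.1 (Fin.last T), u) ∂ν.ker T (p.1 (Fin.last T)) ∂infoLaw ν T π := by
  have hm : Measurable fun p : ((Fin (T + 1) → S.Info) × (Fin T → U)) × (U × S.Info) =>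
      ((Fin.snoc p.1.1 p.2.2, Fin.snoc p.1.2 p.2.1) :
        (Fin (T + 2) → S.Info) × (Fin (T + 1) → U)) :=
    ((measurable_snoc (T + 1)).comp (by fun_prop : Measurable
        fun p : ((Fin (T + 1) → S.Info) × (Fin T → U)) × (U × S.Info) => (p.1.1, p.2.2))).prodMk
      ((measurable_snoc T).comp (by fun_prop : Measurable
        fun p : ((Fin (T + 1) → S.Info) × (Fin T → U)) × (U × S.Info) => (p.1.2, p.2.1)))
  rw [infoLaw, Kernel.map_apply _ hm, lintegral_map hF hm,
    Kernel.lintegral_compProd _ _ _ (hF.fun_comp hm)]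
  refine lintegral_congr fun p => ?_
  rw [Kernel.lintegral_compProd _ _ _ ((hF.fun_comp hm).fun_comp measurable_prodMk_left)]
  rfl

lemma map_last_infoLaw (ν : S.InfoPolicy) (T : ℕ) (π : S.Info) :
    (infoLaw ν T π).map (fun p => p.1 (Fin.last T)) = S.stateM ν.track T π := by
  induction T with
  | zero =>
    have hm : Measurable fun p : (Fin 1 → S.Info) × (Fin 0 → U) => p.1 (Fin.last 0) := by
      fun_prop
    rw [infoLaw, Kernel.deterministic_apply, stateM, Kernel.id_apply]
    exact Measure.map_dirac' hm _
  | succ T ih =>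
    refine Measure.ext_of_lintegral _ fun G hG => ?_
    have h1 : Measurable fun p : S.Info × U => ∫⁻ π', G π' ∂S.infoStepK T p :=
      hG.lintegral_kernel
    rw [lintegral_map hG (by fun_prop), lintegral_infoLaw_succ ν T π (by fun_prop),
      S.lintegral_stateM_succ ν.track T π hG, S.lintegral_ctrlM ν.track T π h1, ← ih]
    simp only [Fin.snoc_last]
    exact (lintegral_map (Measurable.lintegral_kernel_prod_right' (κ := ν.ker T) h1)
      (by fun_prop)).symm

/-- Rewards are sums over stages, so these one-time marginals are all that is needed of the path
law. Steps after time `t` are Markov kernels and integrate to one. -/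
lemma map_ctrl_infoLaw (ν : S.InfoPolicy) (T : ℕ) (π : S.Info) (t : Fin T) :
    (infoLaw ν T π).map (fun p => (p.1 t.castSucc, p.2 t)) = S.ctrlM ν.track t π := by
  induction T with
  | zero => exact t.elim0
  | succ T ih =>
    refine Measure.ext_of_lintegral _ fun G hG => ?_
    rw [lintegral_map hG (by fun_prop), lintegral_infoLaw_succ ν T π (by fun_prop)]
    induction t using Fin.lastCases with
    | last =>
      have h1 := Measurable.lintegral_kernel_prod_right' (κ := ν.ker T) hG
      simp only [Fin.snoc_castSucc, Fin.snoc_last, lintegral_const, measure_univ, mul_one,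
        Fin.val_last]
      rw [S.lintegral_ctrlM ν.track T π hG, ← map_last_infoLaw]
      exact (lintegral_map h1 (by fun_prop)).symm
    | cast t =>
      simp only [Fin.snoc_castSucc, lintegral_const, measure_univ, mul_one,
        Fin.val_castSucc]
      rw [← ih t, lintegral_map hG (by fun_prop)]

include hc in
lemma lintegral_absReward_infoLaw (ν : S.InfoPolicy) (T : ℕ) (π : S.Info) :
    ∫⁻ p, ∑ t : Fin T, S.absReward c γ t (p.1 t.castSucc) (p.2 t) ∂(infoLaw ν T π)
      = ∑ t : Fin T, ∫⁻ p, S.absReward c γ t p.1 p.2 ∂S.ctrlM ν.track t π := by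
  rw [lintegral_finsetSum]
  · refine Finset.sum_congr rfl fun t _ => ?_
    rw [← map_ctrl_infoLaw, lintegral_map (S.measurable_absReward hc γ t) (by fun_prop)]
  · exact fun t _ => (S.measurable_absReward hc γ t).comp (by fun_prop : Measurable
      fun p : (Fin (T + 1) → S.Info) × (Fin T → U) => (p.1 t.castSucc, p.2 t))

include hc in
lemma measurable_lintegral_absReward_ctrlM (η : ℕ → Kernel (S.Info × S.Info) U)
    [∀ t, IsMarkovKernel (η t)] (t : ℕ) :
    Measurable fun π => ∫⁻ p, S.absReward c γ t p.1 p.2 ∂S.ctrlM η t π :=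
  (S.measurable_absReward hc γ t).lintegral_kernel

include hc in
-- By Tonelli, both sides express finiteness of the mean of `absReward` under the same laws of
-- `(π_t, U_t)`.
lemma infoAdmissible_iff (ν : S.InfoPolicy) (T : ℕ) :
    S.InfoAdmissible c γ T ν ↔
      ∀ t < T, ∫⁻ p, S.absReward c γ t p.1 p.2 ∂S.ctrlLaw ν.toOutput t < ⊤ := by
  unfold InfoAdmissible
  simp only [lintegral_absReward_infoLaw γ hc]
  rw [lintegral_finsetSum _ fun (t : Fin T) _ =>
    measurable_lintegral_absReward_ctrlM γ hc ν.track t, ENNReal.sum_lt_top]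
  simp only [← ν.trackOutput_track,
    S.lintegral_ctrlLaw_trackOutput ν.track _ (S.measurable_absReward hc γ _)]
  exact ⟨fun h t ht => h ⟨t, ht⟩ (Finset.mem_univ _), fun h t _ => h t t.isLt⟩

include hc in
lemma infoValue_ae_eq (ν : S.InfoPolicy) (T : ℕ) (h : S.InfoAdmissible c γ T ν) :
    ∀ᵐ π ∂S.infoInit, Integrable (S.totalReward c γ T) (infoLaw ν T π) ∧
      S.infoValue c γ T ν π = S.trackValue ν.track c γ T π := by
  have hm : Measurable fun π => ∑ t : Fin T,
      ∫⁻ p, S.absReward c γ t p.1 p.2 ∂S.ctrlM ν.track t π :=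
    Finset.measurable_sum _ fun t _ => measurable_lintegral_absReward_ctrlM γ hc ν.track t
  unfold InfoAdmissible at h
  simp only [lintegral_absReward_infoLaw γ hc] at h
  filter_upwards [ae_lt_top hm h.ne] with π hπ
  rw [ENNReal.sum_lt_top] at hπ
  have hi : ∀ t : Fin T, Integrable (fun p => S.reward c γ t p.1 p.2) (S.ctrlM ν.track t π) :=
    fun t => S.integrable_reward hc γ (hπ t (Finset.mem_univ _))
  have hpm : ∀ t : Fin T, AEMeasurable (fun p : (Fin (T + 1) → S.Info) × (Fin T → U) =>
      (p.1 t.castSucc, p.2 t)) (infoLaw ν T π) := fun t => by fun_prop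
  have hint : ∀ t : Fin T, Integrable (fun p : (Fin (T + 1) → S.Info) × (Fin T → U) =>
      S.reward c γ t (p.1 t.castSucc) (p.2 t)) (infoLaw ν T π) := fun t => by
    have := hi t
    rw [← map_ctrl_infoLaw] at this
    exact this.comp_aemeasurable (hpm t)
  refine ⟨integrable_finsetSum _ fun t _ => hint t, ?_⟩
  unfold infoValue totalReward trackValue
  rw [integral_finsetSum _ fun t _ => hint t, Finset.sum_range]
  refine Finset.sum_congr rfl fun t _ => ?_
  have := (hi t).aestronglyMeasurable
  rw [← map_ctrl_infoLaw] at this ⊢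
  rw [integral_map (hpm t) this]

include hc in
lemma integral_infoValue (ν : S.InfoPolicy) (T : ℕ) (h : S.InfoAdmissible c γ T ν) :
    Integrable (S.infoValue c γ T ν) S.infoInit ∧
      ∫ π, S.infoValue c γ T ν π ∂S.infoInit
        = ∑ t ∈ Finset.range T, ∫ p, S.reward c γ t p.1 p.2 ∂S.ctrlLaw ν.toOutput t := by
  have hae := (infoValue_ae_eq γ hc ν T h).mono fun _ h => h.2
  rw [infoAdmissible_iff γ hc ν T, ← ν.trackOutput_track] at h
  obtain ⟨h1, h2⟩ := S.integral_trackValue ν.track γ hc T h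
  exact ⟨h1.congr (hae.mono fun _ h => h.symm), by
    rw [integral_congr_ae hae, h2, ν.trackOutput_track]⟩

/-! ### Policies of the information state suffice -/

variable (S) in
/-- Replacing an output feedback policy by the conditional law of its control given the information
state. -/
def markovPolicy [StandardBorelSpace U] [Nonempty U] (μ : OutputPolicy U Y) : S.InfoPolicy where
  ker t := (S.ctrlLaw μ t).condKernel
  isMarkov _ := inferInstance

variable (S) in
-- Equal laws of `π_t` give equal laws of `(π_t, U_t)`, as the control is drawn from the same
-- conditional law. These give equal laws of `π_{t+1}`, as the filter dynamics do not depend on the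
-- policy.
lemma ctrlLaw_markovPolicy [StandardBorelSpace U] [Nonempty U] (μ : OutputPolicy U Y) (t : ℕ) :
    S.ctrlLaw (S.markovPolicy μ).toOutput t = S.ctrlLaw μ t := by
  have key : ∀ t, (∀ G : S.Info → ℝ≥0∞, Measurable G →
      ∫⁻ ω, G (S.filter t ω.2) ∂S.law (S.markovPolicy μ).toOutput t
        = ∫⁻ ω, G (S.filter t ω.2) ∂S.law μ t) →
      S.ctrlLaw (S.markovPolicy μ).toOutput t = S.ctrlLaw μ t := by
    intro t ht
    refine Measure.ext_of_lintegral _ fun F hF => ?_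
    have hm : Measurable fun π => ∫⁻ u, F (π, u) ∂(S.ctrlLaw μ t).condKernel π :=
      Measurable.lintegral_kernel_prod_right' hF
    -- The test function ignores the control, so this only says that the first marginal of `ctrlLaw`
    -- is the law of `π_t`.
    have e := S.lintegral_ctrlLaw μ t (F := fun p =>
      ∫⁻ u, F (p.1, u) ∂(S.ctrlLaw μ t).condKernel p.1) (hm.comp measurable_fst)
    simp only [lintegral_const, measure_univ, mul_one] at e
    rw [S.lintegral_ctrlLaw _ t hF]
    refine (ht _ hm).trans (e.symm.trans ?_)
    conv_rhs => rw [← (S.ctrlLaw μ t).disintegrate (S.ctrlLaw μ t).condKernel]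
    rw [Measure.lintegral_compProd hF, Measure.fst, lintegral_map hm measurable_fst]
  refine key t ?_
  induction t with
  | zero =>
    intro G hG
    exact (S.lintegral_infoPair_zero _ (G := fun q => G q.2) (by fun_prop)).trans
      (S.lintegral_infoPair_zero μ (G := fun q => G q.2) (by fun_prop)).symm
  | succ t ih =>
    intro G hG
    rw [S.lintegral_filter_succ _ t hG, key t ih, S.lintegral_filter_succ μ t hG]

end System

end

end SmoothingAverse

/-! ### Analytic tools for the supremum over policies. -/

namespace SmoothingAverse

noncomputable section

/-! ### Essential suprema and expectations of extended-real functions -/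

section EssSup

variable {A I : Type*} [MeasurableSpace A] (P : Measure A)

/-- A bounded increasing reparametrisation of the real line. -/
def squash (x : ℝ) : ℝ≥0∞ := ENNReal.ofReal (Real.arctan x + Real.pi / 2)

lemma squash_strictMono : StrictMono squash := fun x y h =>
  (ENNReal.ofReal_lt_ofReal_iff (by linarith [Real.neg_pi_div_two_lt_arctan y])).2
    (by linarith [Real.arctan_strictMono h])

lemma measurable_squash : Measurable squash :=
  ENNReal.measurable_ofReal.comp (Real.measurable_arctan.add_const _)

lemma squash_le (x : ℝ) : squash x ≤ ENNReal.ofReal Real.pi :=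
  ENNReal.ofReal_le_ofReal (by linarith [Real.arctan_lt_pi_div_two x])

/-- A family of functions has a countable subfamily whose supremum is an essential supremum. -/
lemma exists_seq_ae_le_iSup [IsFiniteMeasure P] [Nonempty I] (f : I → A → ℝ)
    (hf : ∀ i, Measurable (f i)) :
    ∃ s : ℕ → I, ∀ i, ∀ᵐ a ∂P, (f i a : EReal) ≤ ⨆ n, (f (s n) a : EReal) := by
  -- Squashed suprema have bounded integrals, so a countable subfamily can be chosen to maximise the
  -- integral.
  let g : (ℕ → I) → A → ℝ≥0∞ := fun s a => ⨆ n, squash (f (s n) a)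
  have hg : ∀ s, Measurable (g s) := fun s =>
    Measurable.iSup fun n => measurable_squash.comp (hf (s n))
  have hbound : ∀ s, ∫⁻ a, g s a ∂P ≤ ENNReal.ofReal Real.pi * P Set.univ := fun s => by
    rw [← lintegral_const]
    exact lintegral_mono fun a => iSup_le fun n => squash_le _
  have hbdd : ∀ s, ∫⁻ a, g s a ∂P ≠ ⊤ := fun s =>
    ((hbound s).trans_lt (ENNReal.mul_lt_top ENNReal.ofReal_lt_top (measure_lt_top _ _))).ne
  obtain ⟨u, -, hu, hmem⟩ := exists_seq_tendsto_sSup (α := ℝ≥0∞)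
    (S := Set.range fun s => ∫⁻ a, g s a ∂P)
    ⟨_, fun _ => Classical.arbitrary I, rfl⟩ (OrderTop.bddAbove _)
  choose s hs using hmem
  -- All sequences of a maximising sequence are merged into one, which therefore attains the
  -- supremum of the integrals.
  let r : ℕ → I := fun m => s (Nat.unpair m).1 (Nat.unpair m).2
  have hr : ∀ k, ∫⁻ a, g (s k) a ∂P ≤ ∫⁻ a, g r a ∂P := fun k => lintegral_mono fun a =>
    iSup_le fun n => le_iSup_of_le (Nat.pair k n) (by simp [r])
  have hmax : ∀ s', ∫⁻ a, g s' a ∂P ≤ ∫⁻ a, g r a ∂P := fun s' =>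
    (le_sSup (Set.mem_range_self s')).trans
      (le_of_tendsto' hu fun k => (hs k).symm.trans_le (hr k))
  refine ⟨r, fun i => ?_⟩
  let r' : ℕ → I := fun n => Nat.casesOn n i r
  have hle : g r ≤ g r' := fun a => iSup_le fun n => le_iSup_of_le (n + 1) le_rfl
  -- Prepending `i` to the maximising `r` cannot raise the finite integral, so it changes the
  -- supremum only on a null set.
  have hae := ae_eq_of_ae_le_of_lintegral_le (Filter.Eventually.of_forall hle) (hbdd r)
    (hg r').aemeasurable (hmax r')
  filter_upwards [hae] with a ha
  by_contra hlt
  rw [not_le, EReal.lt_iff_exists_real_btwn] at hlt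
  -- The supremum may be `⊤` or `⊥`, where `squash` is not defined, so a real number is placed
  -- strictly in between.
  obtain ⟨x, hx1, hx2⟩ := hlt
  have h1 : g r a ≤ squash x := iSup_le fun n => squash_strictMono.monotone
    (EReal.coe_le_coe_iff.1 ((le_iSup (fun n => (f (r n) a : EReal)) n).trans hx1.le))
  have h2 : squash (f i a) ≤ g r' a := le_iSup_of_le 0 le_rfl
  exact absurd (squash_strictMono (EReal.coe_lt_coe_iff.1 hx2))
    (not_lt.2 (h2.trans (ha ▸ h1)))

lemma expect_mono {v w : A → EReal} (h : ∀ᵐ a ∂P, v a ≤ w a) : expect P v ≤ expect P w := by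
  unfold expect
  refine EReal.sub_le_sub ?_ ?_
  · refine EReal.coe_ennreal_le_coe_ennreal_iff.2 (lintegral_mono_ae ?_)
    exact h.mono fun a ha => EReal.toENNReal_le_toENNReal ha
  · refine EReal.coe_ennreal_le_coe_ennreal_iff.2 (lintegral_mono_ae ?_)
    exact h.mono fun a ha => EReal.toENNReal_le_toENNReal (EReal.neg_le_neg_iff.2 ha)

lemma expect_coe {f : A → ℝ} (hf : Integrable f P) :
    expect P (fun a => (f a : EReal)) = ((∫ a, f a ∂P : ℝ) : EReal) := by
  have h1 : ∫⁻ a, ENNReal.ofReal (f a) ∂P ≠ ⊤ := hf.lintegral_lt_top.ne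
  have h2 : ∫⁻ a, ENNReal.ofReal (-f a) ∂P ≠ ⊤ := hf.neg.lintegral_lt_top.ne
  unfold expect
  simp only [← EReal.coe_neg, EReal.real_coe_toENNReal]
  rw [integral_eq_lintegral_pos_part_sub_lintegral_neg_part hf, EReal.coe_sub,
    EReal.coe_ennreal_toReal h1, EReal.coe_ennreal_toReal h2]

lemma expect_bot [NeZero P] : expect P (fun _ => ⊥) = ⊥ := by
  simp [expect, NeZero.ne P]

/-- Monotone convergence for the extended expectation. -/
lemma expect_iSup_le {f : ℕ → A → ℝ} (hm : ∀ n, Measurable (f n))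
    (hi : ∀ n, Integrable (f n) P)
    (hmono : ∀ a, Monotone fun n => f n a) {s : EReal}
    (hs : ∀ n, ((∫ a, f n a ∂P : ℝ) : EReal) ≤ s) :
    expect P (fun a => ⨆ n, (f n a : EReal)) ≤ s := by
  have hmono' : ∀ a, Monotone fun n => (f n a : EReal) := fun a i j h =>
    EReal.coe_le_coe_iff.2 (hmono a h)
  have hlim : ∀ a, Filter.Tendsto (fun n => (f n a : EReal)) Filter.atTop
      (nhds (⨆ n, (f n a : EReal))) := fun a => tendsto_atTop_iSup (hmono' a)
  have hmE : ∀ n, Measurable fun a => (f n a : EReal) := fun n => (hm n).coe_real_ereal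
  have hpos := lintegral_tendsto_of_tendsto_of_monotone (μ := P)
    (f := fun n a => (f n a : EReal).toENNReal)
    (F := fun a => (⨆ n, (f n a : EReal)).toENNReal)
    (fun n => (hmE n).ereal_toENNReal.aemeasurable)
    (Filter.Eventually.of_forall fun a i j h => EReal.toENNReal_le_toENNReal (hmono' a h))
    (Filter.Eventually.of_forall fun a =>
      (EReal.continuous_toENNReal.tendsto _).comp (hlim a))
  have hfin : ∫⁻ a, (-(f 0 a : EReal)).toENNReal ∂P ≠ ⊤ := by
    simp only [← EReal.coe_neg, EReal.real_coe_toENNReal]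
    exact (hi 0).neg.lintegral_lt_top.ne
  have hneg := lintegral_tendsto_of_tendsto_of_antitone (μ := P)
    (f := fun n a => (-(f n a : EReal)).toENNReal)
    (F := fun a => (-⨆ n, (f n a : EReal)).toENNReal)
    (fun n => (hmE n).neg.ereal_toENNReal.aemeasurable)
    (Filter.Eventually.of_forall fun a i j h =>
      EReal.toENNReal_le_toENNReal (EReal.neg_le_neg_iff.2 (hmono' a h))) hfin
    (Filter.Eventually.of_forall fun a =>
      (EReal.continuous_toENNReal.tendsto _).comp ((continuous_neg.tendsto _).comp (hlim a)))
  have hfin' : ∫⁻ a, (-⨆ n, (f n a : EReal)).toENNReal ∂P ≠ ⊤ := by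
    refine ne_top_of_le_ne_top hfin (lintegral_mono fun a => ?_)
    exact EReal.toENNReal_le_toENNReal (EReal.neg_le_neg_iff.2
      (le_iSup (fun n => (f n a : EReal)) 0))
  have key : Filter.Tendsto (fun n => expect P (fun a => (f n a : EReal))) Filter.atTop
      (nhds (expect P (fun a => ⨆ n, (f n a : EReal)))) := by
    unfold expect
    -- Addition of extended reals is continuous here because the negative part of the limit is
    -- dominated by that of `f 0`; this rules out `⊤ - ⊤`.
    have hc := EReal.continuousAt_add
      (p := (((∫⁻ a, (⨆ n, (f n a : EReal)).toENNReal ∂P : ℝ≥0∞) : EReal),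
        -((∫⁻ a, (-⨆ n, (f n a : EReal)).toENNReal ∂P : ℝ≥0∞) : EReal)))
      (Or.inr (by simpa using hfin')) (Or.inl (EReal.coe_ennreal_ne_bot _))
    exact hc.tendsto.comp ((EReal.tendsto_coe_ennreal.2 hpos).prodMk_nhds
      ((continuous_neg.tendsto _).comp (EReal.tendsto_coe_ennreal.2 hneg)))
  refine le_of_tendsto' key fun n => ?_
  rw [expect_coe P (hi n)]
  exact hs n

end EssSup

/-! ### Running maxima -/

section Selector

variable {A : Type*} (V : ℕ → A → ℝ)

/-- The index of the largest of `V 0 a, …, V N a`. -/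
def selector : ℕ → A → ℕ
  | 0, _ => 0
  | N + 1, a => open Classical in if V (selector N a) a < V (N + 1) a then N + 1 else selector N a

lemma selector_le (N : ℕ) (a : A) : selector V N a ≤ N := by
  induction N with
  | zero => exact le_rfl
  | succ N ih =>
    unfold selector
    split_ifs
    · exact le_rfl
    · omega

lemma selector_succ_eq_max (N : ℕ) (a : A) :
    V (selector V (N + 1) a) a = max (V (selector V N a) a) (V (N + 1) a) := by
  conv_lhs => unfold selector
  split_ifs with h
  · exact (max_eq_right h.le).symm
  · exact (max_eq_left (not_lt.1 h)).symm

lemma monotone_selector (a : A) : Monotone fun N => V (selector V N a) a :=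
  monotone_nat_of_le_succ fun N =>
    (le_max_left _ _).trans_eq (selector_succ_eq_max V N a).symm

lemma le_selector (N : ℕ) (a : A) : V N a ≤ V (selector V N a) a := by
  cases N with
  | zero => exact le_rfl
  | succ N => exact (le_max_right _ _).trans_eq (selector_succ_eq_max V N a).symm

lemma iSup_selector (a : A) :
    ⨆ N, (V (selector V N a) a : EReal) = ⨆ N, (V N a : EReal) :=
  le_antisymm (iSup_le fun N => le_iSup (fun n => (V n a : EReal)) (selector V N a))
    (iSup_mono fun N => EReal.coe_le_coe_iff.2 (le_selector V N a))

variable [MeasurableSpace A] {V} (hV : ∀ n, Measurable (V n))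

include hV in
lemma measurable_apply_index {σ : A → ℕ} (hσ : Measurable σ) : Measurable fun a => V (σ a) a :=
  (measurable_from_prod_countable_right (f := fun p : ℕ × A => V p.1 p.2) hV).comp
    (hσ.prodMk measurable_id)

include hV in
lemma measurable_selector (N : ℕ) : Measurable (selector V N) := by
  classical
  induction N with
  | zero => exact measurable_const
  | succ N ih =>
    have : selector V (N + 1) = fun a =>
        if V (selector V N a) a < V (N + 1) a then N + 1 else selector V N a := by
      funext a
      simp only [selector]
    rw [this]
    exact Measurable.ite (measurableSet_lt (measurable_apply_index hV ih) (hV (N + 1)))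
      measurable_const ih

end Selector

end

end SmoothingAverse

/-! ### Choosing policies by `π_0`, and the optimal value. -/

namespace SmoothingAverse

noncomputable section

variable {X U Y W V : Type*} [MeasurableSpace X] [MeasurableSpace U] [MeasurableSpace Y]
  [MeasurableSpace W] [MeasurableSpace V]

namespace System

variable {S : System X U Y W V}

/-! ### Choosing a policy by the initial information state -/

section Switch

variable (ν : ℕ → S.InfoPolicy) {σ : S.Info → ℕ} (hσ : Measurable σ)

/-- Following the policy `ν (σ π_0)`. -/
def switch (t : ℕ) : Kernel (S.Info × S.Info) U where
  toFun q := (ν (σ q.1)).ker t q.2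
  measurable' := (measurable_from_prod_countable_right
    (f := fun p : ℕ × S.Info => (ν p.1).ker t p.2) fun n => ((ν n).ker t).measurable).comp
      ((hσ.comp measurable_fst).prodMk measurable_snd)

instance (t : ℕ) : IsMarkovKernel (switch ν hσ t) := ⟨fun q => ((ν (σ q.1)).isMarkov t).1 q.2⟩

/-- Given `π_0 = π`, the chosen index is the constant `σ π`, so the switched policy acts as a single
policy. The implication is isolated because the induction for `stateM` passes through `ctrlM`. -/
lemma ctrlM_switch_of_stateM {t : ℕ} {π : S.Info}
    (h : S.stateM (switch ν hσ) t π = S.stateM (ν (σ π)).track t π) :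
    S.ctrlM (switch ν hσ) t π = S.ctrlM (ν (σ π)).track t π := by
  refine Measure.ext_of_lintegral _ fun F hF => ?_
  rw [S.lintegral_ctrlM _ t π hF, S.lintegral_ctrlM _ t π hF, h]
  rfl

lemma stateM_switch (t : ℕ) (π : S.Info) :
    S.stateM (switch ν hσ) t π = S.stateM (ν (σ π)).track t π := by
  induction t with
  | zero => rfl
  | succ t ih =>
    refine Measure.ext_of_lintegral _ fun F hF => ?_
    rw [S.lintegral_stateM_succ _ t π hF, S.lintegral_stateM_succ _ t π hF,
      ctrlM_switch_of_stateM ν hσ ih]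

lemma ctrlM_switch (t : ℕ) (π : S.Info) :
    S.ctrlM (switch ν hσ) t π = S.ctrlM (ν (σ π)).track t π :=
  ctrlM_switch_of_stateM ν hσ (stateM_switch ν hσ t π)

end Switch

variable {c : ℕ → X → U → ℝ≥0} (γ : ℝ≥0) (hc : ∀ t, Measurable (fun p : X × U => c t p.1 p.2))

include hc in
-- The bound `N` on the choice is essential: the absolute reward is dominated by the sum over `N +
-- 1` admissible policies, whereas a sum over all of them could diverge.
lemma lintegral_absReward_switch_lt_top {ν : ℕ → S.InfoPolicy} {σ : S.Info → ℕ}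
    (hσ : Measurable σ) {N T : ℕ} (hN : ∀ π, σ π ≤ N) (hν : ∀ n, S.InfoAdmissible c γ T (ν n))
    (t : ℕ) (ht : t < T) :
    ∫⁻ p, S.absReward c γ t p.1 p.2 ∂S.ctrlLaw (S.trackOutput (switch ν hσ)) t < ⊤ := by
  rw [S.lintegral_ctrlLaw_trackOutput _ t (S.measurable_absReward hc γ t)]
  simp only [ctrlM_switch]
  refine (lintegral_mono (g := fun π => ∑ n ∈ Finset.range (N + 1),
    ∫⁻ p, S.absReward c γ t p.1 p.2 ∂S.ctrlM (ν n).track t π) fun π => ?_).trans_lt ?_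
  · exact Finset.single_le_sum
      (f := fun n => ∫⁻ p, S.absReward c γ t p.1 p.2 ∂S.ctrlM (ν n).track t π)
      (fun _ _ => zero_le) (Finset.mem_range.2 (Nat.lt_succ_of_le (hN π)))
  · rw [lintegral_finsetSum _ fun n _ => measurable_lintegral_absReward_ctrlM γ hc (ν n).track t,
      ENNReal.sum_lt_top]
    intro n _
    rw [← S.lintegral_ctrlLaw_trackOutput _ t (S.measurable_absReward hc γ t),
      InfoPolicy.trackOutput_track]
    exact (infoAdmissible_iff γ hc (ν n) T).1 (hν n) t ht

variable [StandardBorelSpace U] [Nonempty U]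

include hc in
lemma infoAdmissible_markovPolicy {μ : OutputPolicy U Y} {T : ℕ}
    (h : ∀ t < T, ∫⁻ p, S.absReward c γ t p.1 p.2 ∂S.ctrlLaw μ t < ⊤) :
    S.InfoAdmissible c γ T (S.markovPolicy μ) ∧
      ∫ π, S.infoValue c γ T (S.markovPolicy μ) π ∂S.infoInit
        = ∑ t ∈ Finset.range T, ∫ p, S.reward c γ t p.1 p.2 ∂S.ctrlLaw μ t := by
  have h' : S.InfoAdmissible c γ T (S.markovPolicy μ) :=
    (infoAdmissible_iff γ hc _ T).2 (by simpa only [S.ctrlLaw_markovPolicy] using h)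
  refine ⟨h', ?_⟩
  rw [(integral_infoValue γ hc _ T h').2]
  simp only [S.ctrlLaw_markovPolicy]

include hc in
/-- Choosing among finitely many policies of the fully observed problem by the initial information
state does not improve on all policies of that problem. -/
lemma exists_infoPolicy_integral_eq {ν : ℕ → S.InfoPolicy} {σ : S.Info → ℕ}
    (hσ : Measurable σ) {N T : ℕ} (hN : ∀ π, σ π ≤ N) (hν : ∀ n, S.InfoAdmissible c γ T (ν n)) :
    Integrable (fun π => S.infoValue c γ T (ν (σ π)) π) S.infoInit ∧
      ∃ ν' : S.InfoPolicy, S.InfoAdmissible c γ T ν' ∧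
        ∫ π, S.infoValue c γ T ν' π ∂S.infoInit
          = ∫ π, S.infoValue c γ T (ν (σ π)) π ∂S.infoInit := by
  have hfin := lintegral_absReward_switch_lt_top γ hc hσ hN hν
  obtain ⟨h1, h2⟩ := S.integral_trackValue (switch ν hσ) γ hc T hfin
  have hae : S.trackValue (switch ν hσ) c γ T
      =ᵐ[S.infoInit] fun π => S.infoValue c γ T (ν (σ π)) π := by
    filter_upwards [ae_all_iff.2 fun n => infoValue_ae_eq γ hc (ν n) T (hν n)] with π hπ
    rw [(hπ (σ π)).2]
    simp only [trackValue, ctrlM_switch]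
  -- The switched policy remembers `π_0`. Its conditional version given `π_t` forgets it and keeps
  -- the mean value, though not necessarily the value for each `π_0`.
  obtain ⟨h3, h4⟩ := infoAdmissible_markovPolicy γ hc hfin
  exact ⟨h1.congr hae, _, h3, by rw [h4, ← h2, integral_congr_ae hae]⟩

/-! ### The optimal value of the fully observed problem -/

include hc in
-- The supremum of the means could be smaller than the mean of the essential supremum. Equality
-- holds because running maxima are attained by switching on `π_0`, which does not leave the set of
-- attainable means.
lemma exists_isOptimalValue (T : ℕ) :
    ∃ v : S.Info → EReal, Measurable v ∧ S.IsOptimalValue c γ T v ∧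
      (⨆ (ν : S.InfoPolicy) (_ : S.InfoAdmissible c γ T ν),
        ((∫ π, S.infoValue c γ T ν π ∂S.infoInit : ℝ) : EReal)) = expect S.infoInit v := by
  by_cases hne : ∃ ν : S.InfoPolicy, S.InfoAdmissible c γ T ν
  swap
  -- Without admissible policies the empty supremum is `⊥`, which is also the expectation of the
  -- constant `⊥` under a probability measure.
  · push Not at hne
    refine ⟨fun _ => ⊥, measurable_const, ⟨fun ν hν => (hne ν hν).elim, fun w _ _ =>
      Filter.Eventually.of_forall fun _ => bot_le⟩, ?_⟩
    simp [hne, expect_bot]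
  let I := {ν : S.InfoPolicy // S.InfoAdmissible c γ T ν}
  have : Nonempty I := let ⟨ν, hν⟩ := hne; ⟨⟨ν, hν⟩⟩
  have hint : ∀ i : I, Integrable (S.infoValue c γ T i.1) S.infoInit := fun i =>
    (integral_infoValue γ hc i.1 T i.2).1
  -- Values are known to be measurable only up to null sets, so measurable versions are used to
  -- select indices.
  let f : I → S.Info → ℝ := fun i => (hint i).1.mk _
  have hf : ∀ i, Measurable (f i) := fun i => (hint i).1.stronglyMeasurable_mk.measurable
  have hfe : ∀ i, S.infoValue c γ T i.1 =ᵐ[S.infoInit] f i := fun i => (hint i).1.ae_eq_mk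
  obtain ⟨s, hs⟩ := exists_seq_ae_le_iSup S.infoInit f hf
  let v : S.Info → EReal := fun π => ⨆ n, (f (s n) π : EReal)
  have hle : ∀ ν : S.InfoPolicy, S.InfoAdmissible c γ T ν →
      ∀ᵐ π ∂S.infoInit, (S.infoValue c γ T ν π : EReal) ≤ v π := fun ν hν => by
    filter_upwards [hs ⟨ν, hν⟩, hfe ⟨ν, hν⟩] with π h1 h2
    rw [h2]
    exact h1
  refine ⟨v, Measurable.iSup fun n => (hf (s n)).coe_real_ereal, ⟨hle, fun w _ hw => ?_⟩,
    le_antisymm (iSup₂_le fun ν hν => ?_) ?_⟩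
  · filter_upwards [ae_all_iff.2 fun n => hw (s n).1 (s n).2, ae_all_iff.2 fun n => hfe (s n)]
      with π h1 h2
    exact iSup_le fun n => h2 n ▸ h1 n
  · rw [← expect_coe _ (integral_infoValue γ hc ν T hν).1]
    exact expect_mono _ (hle ν hν)
  · let F : ℕ → S.Info → ℝ := fun n => f (s n)
    have hF : ∀ n, Measurable (F n) := fun n => hf (s n)
    have hv : v = fun π => ⨆ N, (F (selector F N π) π : EReal) :=
      funext fun π => (iSup_selector F π).symm
    have hae : ∀ N, (fun π => S.infoValue c γ T (s (selector F N π)).1 π)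
        =ᵐ[S.infoInit] fun π => F (selector F N π) π := fun N => by
      filter_upwards [ae_all_iff.2 fun n => hfe (s n)] with π h using h _
    have hsw := fun N => exists_infoPolicy_integral_eq γ hc (ν := fun n => (s n).1) (T := T)
      (measurable_selector hF N) (selector_le F N) fun n => (s n).2
    have hi : ∀ N, Integrable (fun π => F (selector F N π) π) S.infoInit := fun N =>
      (hsw N).1.congr (hae N)
    rw [hv]
    refine expect_iSup_le _ (fun N => measurable_apply_index hF (measurable_selector hF N))
      hi (monotone_selector F) fun N => ?_
    obtain ⟨-, ν', hν', e⟩ := hsw N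
    rw [← integral_congr_ae (hae N), ← e]
    exact le_iSup₂ (f := fun (ν : S.InfoPolicy) (_ : S.InfoAdmissible c γ T ν) =>
      ((∫ π, S.infoValue c γ T ν π ∂S.infoInit : ℝ) : EReal)) ν' hν'

include hc in
/-- A policy is optimal on average if and only if it is optimal for almost every initial
information state. -/
lemma forall_integral_infoValue_le_iff {ν : S.InfoPolicy} {T : ℕ}
    (hν : S.InfoAdmissible c γ T ν) :
    (∀ ν' : S.InfoPolicy, S.InfoAdmissible c γ T ν' →
      ∫ π, S.infoValue c γ T ν' π ∂S.infoInit ≤ ∫ π, S.infoValue c γ T ν π ∂S.infoInit) ↔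
    ∀ ν' : S.InfoPolicy, S.InfoAdmissible c γ T ν' →
      ∀ᵐ π ∂S.infoInit, S.infoValue c γ T ν' π ≤ S.infoValue c γ T ν π := by
  refine ⟨fun h ν' hν' => ?_, fun h ν' hν' => integral_mono_ae
    (integral_infoValue γ hc ν' T hν').1 (integral_infoValue γ hc ν T hν).1 (h ν' hν')⟩
  -- With `ν` at index `0` and `ν'` at index `1`, `selector F 1` picks the better of the two for
  -- each `π_0`.
  let s : ℕ → S.InfoPolicy := fun n => Nat.casesOn n ν fun _ => ν'
  have hs : ∀ n, S.InfoAdmissible c γ T (s n) := fun n => by cases n <;> assumption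
  have hint := fun n => (integral_infoValue γ hc (s n) T (hs n)).1
  let F : ℕ → S.Info → ℝ := fun n => (hint n).1.mk _
  have hF : ∀ n, Measurable (F n) := fun n => (hint n).1.stronglyMeasurable_mk.measurable
  have hFe : ∀ᵐ π ∂S.infoInit, ∀ n, S.infoValue c γ T (s n) π = F n π :=
    ae_all_iff.2 fun n => (hint n).1.ae_eq_mk
  obtain ⟨hi, ν'', hν'', e⟩ := exists_infoPolicy_integral_eq γ hc
    (measurable_selector hF 1) (selector_le F 1) hs
  have hmax : ∀ᵐ π ∂S.infoInit, S.infoValue c γ T ν π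
        ≤ S.infoValue c γ T (s (selector F 1 π)) π ∧
      S.infoValue c γ T ν' π ≤ S.infoValue c γ T (s (selector F 1 π)) π := by
    filter_upwards [hFe] with π h
    rw [h (selector F 1 π), show S.infoValue c γ T ν π = F 0 π from h 0,
      show S.infoValue c γ T ν' π = F 1 π from h 1]
    exact ⟨monotone_selector F π (Nat.zero_le 1), le_selector F 1 π⟩
  -- The better of the two dominates `ν` pointwise, yet by optimality on average its mean is no
  -- larger; hence they agree almost everywhere.
  have heq := (integral_eq_iff_of_ae_le (integral_infoValue γ hc ν T hν).1 hi
    (hmax.mono fun _ h => h.1)).1 (le_antisymm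
      (integral_mono_ae (integral_infoValue γ hc ν T hν).1 hi (hmax.mono fun _ h => h.1))
      (e ▸ h ν'' hν''))
  filter_upwards [hmax, heq] with π h1 h2
  rw [h2]
  exact h1.2

end System

end

end SmoothingAverse

/-! ### The equivalence of the two problems. -/

open MeasureTheory ProbabilityTheory SmoothingAverse in
theorem theorem1 {X U Y W V : Type*}
    [MeasurableSpace X] [StandardBorelSpace X] [Nonempty X]
    [MeasurableSpace U] [StandardBorelSpace U] [Nonempty U]
    [MeasurableSpace Y] [StandardBorelSpace Y]
    [MeasurableSpace W] [MeasurableSpace V]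
    (S : System X U Y W V) (c : ℕ → X → U → NNReal)
    (hc : ∀ t, Measurable (fun p : X × U => c t p.1 p.2)) (γ : NNReal) (T : ℕ)
    (hinit : S.absInitEntropy < ⊤) :
    -- under every policy, the information state is the conditional law of the state
    (∀ (μ : OutputPolicy U Y) (t : ℕ),
      ∀ᵐ h ∂((S.law μ t).map Prod.snd),
        condDistrib (fun ω : Traj X U Y t => ω.1 (Fin.last t)) (fun ω => ω.2) (S.law μ t) h
          = (S.filter t h).1) ∧
    -- the objective in terms of the stage rewards, for every policy
    (∀ μ : OutputPolicy U Y, S.Admissible c γ T μ →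
      S.absSmootherEntropy μ T < ⊤ ∧
      Integrable (fun ω => S.totalReward c γ T (S.infoPath T ω.2)) (S.law μ T) ∧
      S.objective c γ T μ
        = S.initEntropy + ∫ ω, S.totalReward c γ T (S.infoPath T ω.2) ∂(S.law μ T)) ∧
    -- for policies of the information state, this is the value in the fully observed problem
    (∀ ν : S.InfoPolicy, S.InfoAdmissible c γ T ν ↔ S.Admissible c γ T ν.toOutput) ∧
    (∀ ν : S.InfoPolicy, S.InfoAdmissible c γ T ν →
      (∀ᵐ π ∂S.infoInit, Integrable (S.totalReward c γ T) (System.infoLaw ν T π)) ∧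
      Integrable (S.infoValue c γ T ν) S.infoInit ∧
      S.objective c γ T ν.toOutput = S.initEntropy + ∫ π, S.infoValue c γ T ν π ∂S.infoInit) ∧
    -- policies of the information state suffice
    (∀ μ : OutputPolicy U Y, S.Admissible c γ T μ →
      ∃ ν : S.InfoPolicy, S.InfoAdmissible c γ T ν ∧
        S.objective c γ T ν.toOutput = S.objective c γ T μ) ∧
    -- the optimal values agree up to the constant
    (⨆ (μ : OutputPolicy U Y) (_ : S.Admissible c γ T μ), (S.objective c γ T μ : EReal))
      = S.initEntropy + (⨆ (ν : S.InfoPolicy) (_ : S.InfoAdmissible c γ T ν),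
          ((∫ π, S.infoValue c γ T ν π ∂S.infoInit : ℝ) : EReal)) ∧
    (∃ v : S.Info → EReal, Measurable v ∧ S.IsOptimalValue c γ T v ∧
      (⨆ (μ : OutputPolicy U Y) (_ : S.Admissible c γ T μ), (S.objective c γ T μ : EReal))
        = S.initEntropy + expect S.infoInit v) ∧
    -- the optimal policies agree
    (∀ ν : S.InfoPolicy, S.InfoAdmissible c γ T ν →
      ((∀ μ : OutputPolicy U Y, S.Admissible c γ T μ →
          S.objective c γ T μ ≤ S.objective c γ T ν.toOutput) ↔
        ∀ ν' : S.InfoPolicy, S.InfoAdmissible c γ T ν' →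
          ∀ᵐ π ∂S.infoInit, S.infoValue c γ T ν' π ≤ S.infoValue c γ T ν π)) := by
  have hadm := fun μ => S.admissible_iff hc γ T μ
  have hobj := fun μ hμ => S.objective_eq hc γ hinit μ T ((hadm μ).1 hμ)
  have hiff : ∀ ν : S.InfoPolicy, S.InfoAdmissible c γ T ν ↔ S.Admissible c γ T ν.toOutput :=
    fun ν => (System.infoAdmissible_iff γ hc ν T).trans (hadm ν.toOutput).symm
  have hval : ∀ ν : S.InfoPolicy, S.InfoAdmissible c γ T ν → S.objective c γ T ν.toOutput
      = S.initEntropy + ∫ π, S.infoValue c γ T ν π ∂S.infoInit := fun ν hν => by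
    rw [(hobj _ ((hiff ν).1 hν)).2, (System.integral_infoValue γ hc ν T hν).2]
  have hmarkov : ∀ μ : OutputPolicy U Y, S.Admissible c γ T μ →
      ∃ ν : S.InfoPolicy, S.InfoAdmissible c γ T ν ∧
        S.objective c γ T ν.toOutput = S.objective c γ T μ := fun μ hμ => by
    obtain ⟨h1, h2⟩ := System.infoAdmissible_markovPolicy γ hc ((hadm μ).1 hμ)
    exact ⟨_, h1, by rw [hval _ h1, h2, (hobj μ hμ).2]⟩
  have hsup : (⨆ (μ : OutputPolicy U Y) (_ : S.Admissible c γ T μ), (S.objective c γ T μ : EReal))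
      = S.initEntropy + (⨆ (ν : S.InfoPolicy) (_ : S.InfoAdmissible c γ T ν),
          ((∫ π, S.infoValue c γ T ν π ∂S.infoInit : ℝ) : EReal)) := by
    refine le_antisymm (iSup₂_le fun μ hμ => ?_) ?_
    · obtain ⟨ν, hν, e⟩ := hmarkov μ hμ
      rw [← e, hval ν hν, EReal.coe_add]
      exact add_le_add_right (le_iSup₂ (f := fun (ν : S.InfoPolicy)
        (_ : S.InfoAdmissible c γ T ν) =>
          ((∫ π, S.infoValue c γ T ν π ∂S.infoInit : ℝ) : EReal)) ν hν) _
    -- The initial entropy is a real number, so it can be moved across the inequality even when a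
    -- supremum is infinite.
    · rw [add_comm, ← EReal.le_sub_iff_add_le (Or.inl (EReal.coe_ne_bot _))
        (Or.inl (EReal.coe_ne_top _))]
      refine iSup₂_le fun ν hν => ?_
      rw [EReal.le_sub_iff_add_le (Or.inl (EReal.coe_ne_bot _)) (Or.inl (EReal.coe_ne_top _)),
        ← EReal.coe_add, add_comm, ← hval ν hν]
      exact le_iSup₂ (f := fun (μ : OutputPolicy U Y) (_ : S.Admissible c γ T μ) =>
        (S.objective c γ T μ : EReal)) ν.toOutput ((hiff ν).1 hν)
  refine ⟨fun μ t => S.condDistrib_last_ae_eq_filter μ t, fun μ hμ => ?_, hiff,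
    fun ν hν => ⟨(System.infoValue_ae_eq γ hc ν T hν).mono fun _ h => h.1,
      (System.integral_infoValue γ hc ν T hν).1, hval ν hν⟩, hmarkov, hsup, ?_, fun ν hν => ?_⟩
  · obtain ⟨h1, h2⟩ := S.integral_totalReward_infoPath hc γ μ T ((hadm μ).1 hμ)
    exact ⟨(hobj μ hμ).1, h1, by rw [h2, (hobj μ hμ).2]⟩
  · obtain ⟨v, hv, hopt, e⟩ := System.exists_isOptimalValue (S := S) γ hc T
    exact ⟨v, hv, hopt, by rw [hsup, e]⟩
  · rw [← System.forall_integral_infoValue_le_iff γ hc hν]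
    constructor
    · intro h ν' hν'
      have := h ν'.toOutput ((hiff ν').1 hν')
      rwa [hval ν' hν', hval ν hν, add_le_add_iff_left] at this
    · intro h μ hμ
      obtain ⟨ν', hν', e⟩ := hmarkov μ hμ
      rw [← e, hval ν' hν', hval ν hν, add_le_add_iff_left]
      exact h ν' hν'
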